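/- Let $(M^n,g)$ be a smooth Einstein manifold ($\mathrm{Ric}=\rho g$ for a constant $\rho$) of dimension $n=4$, $n=5$ or $n\ge 8$. Let $R_{ijkl}$ be its Riemann curvature tensor, with the sign convention that $R_{ijkl}=g_{ik}g_{jl}-g_{il}g_{jk}$ on the unit sphere; let $\Delta R=\sum_a\nabla_{e_a}\nabla_{e_a}R$ (trace of the second covariant derivative of the Levi-Civita connection) and $\langle S,T\rangle=\sum_{i,j,k,l} S_{ijkl}T_{ijkl}$, where components and sums are taken with respect to an orthonormal basis $(e_a)$ of the tangent space. At a point $p$, let the curvature operator of the second kind $\mathring R$ be the operator $\varphi\mapsto \pi\bigl(\sum_{k,l}R_{iklj}\varphi_{kl}\bigr)_{ij}$ on the space $S^2_0(T_pM)$ of traceless symmetric two-tensors, where $\pi$ is the orthogonal projection onto $S_0^2(T_pM)$. Let $N=\frac{(n-1)(n+2)}2=\dim S_0^2(T_pM)$, let $\lambda_1\le\lambda_2\le\dots\le\lambda_N$ be the eigenvalues of $\mathring R$ at $p$ with multiplicity, let $\bar\lambda=\frac1N\sum_{j=1}^N\lambda_j$, and let $$\theta=\theta(n)=\begin{cases}1/2,&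 n=4,\\ 2/3,& n=5,\\ \dfrac{2N-9n+6}{N+6n-3},& n\ge 8.\end{cases}$$ If $\lambda_1+\lambda_2\ge-2\theta(n)\bar\lambda$ at $p$, then $$\langle\Delta R,R\rangle\ge 0\quad\text{at } p,$$ and equality holds at $p$ if and only if $$(\lambda_1,\dots,\lambda_N)=(1,1,\dots,1)\,\bar\lambda\quad\text{or}\quad(\lambda_1,\dots,\lambda_N)=\Bigl(-\tfrac{2(N-1)\theta+N}{N-2},\tfrac{N+2\theta}{N-2},\dots,\tfrac{N+2\theta}{N-2}\Bigr)\bar\lambda .$$ In particular, if the cone condition holds at every point of $M$, these conclusions hold at every point of $M$. -/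

import Mathlib

open scoped Manifold ContDiff Bundle

noncomputable section

namespace SecondKind

/-! ### Tensor calculus in coordinates on `ℝⁿ` -/

/-- The partial derivative `∂ᵢ f` of a function on (an open subset of) `ℝⁿ`. -/
def pderiv {n : ℕ} (i : Fin n) (f : EuclideanSpace ℝ (Fin n) → ℝ)
    (y : EuclideanSpace ℝ (Fin n)) : ℝ :=
  fderiv ℝ f y (EuclideanSpace.single i 1)

/-- The coordinate components `T_{i₁…iₖ}(y)` of a `(0,k)`-tensor field, as functions of the
coordinates `y`. -/
abbrev CoordTensor (n k : ℕ) : Type :=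
  EuclideanSpace ℝ (Fin n) → (Fin k → Fin n) → ℝ

variable {n : ℕ}

/-- The Christoffel symbol `Γᵏᵢⱼ = ½ ∑ₗ gᵏˡ (∂ᵢ gⱼₗ + ∂ⱼ gᵢₗ - ∂ₗ gᵢⱼ)` of the Levi-Civita
connection of the metric with components `g`. -/
def christoffel (g : EuclideanSpace ℝ (Fin n) → Matrix (Fin n) (Fin n) ℝ)
    (y : EuclideanSpace ℝ (Fin n)) (k i j : Fin n) : ℝ :=
  1 / 2 * ∑ l, (g y)⁻¹ k l *
    (pderiv i (fun z => g z j l) y + pderiv j (fun z => g z i l) y - pderiv l (fun z => g z i j) y)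

/-- The Riemann curvature tensor `R_{ijkl} = ⟨R(∂ᵢ,∂ⱼ)∂ₗ, ∂ₖ⟩`, where
`R(X,Y)Z = ∇_X ∇_Y Z - ∇_Y ∇_X Z - ∇_{[X,Y]} Z`. With this convention the unit sphere has
`R_{ijkl} = g_{ik} g_{jl} - g_{il} g_{jk}`. -/
def riemann (g : EuclideanSpace ℝ (Fin n) → Matrix (Fin n) (Fin n) ℝ) : CoordTensor n 4 :=
  fun y I => ∑ m, g y (I 2) m *
    (pderiv (I 0) (fun z => christoffel g z m (I 1) (I 3)) y
      - pderiv (I 1) (fun z => christoffel g z m (I 0) (I 3)) y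
      + ∑ p, (christoffel g y p (I 1) (I 3) * christoffel g y m (I 0) p
          - christoffel g y p (I 0) (I 3) * christoffel g y m (I 1) p))

/-- The Ricci tensor `R_{ik} = ∑_{j,l} gʲˡ R_{ijkl}`. -/
def ricci (g : EuclideanSpace ℝ (Fin n) → Matrix (Fin n) (Fin n) ℝ)
    (y : EuclideanSpace ℝ (Fin n)) (i k : Fin n) : ℝ :=
  ∑ j, ∑ l, (g y)⁻¹ j l * riemann g y ![i, j, k, l]

/-- The covariant derivative of a `(0,k)`-tensor field, with the direction of differentiation as
first index: `(∇T)_{m i₁…iₖ} = ∂ₘ T_{i₁…iₖ} - ∑ₛ ∑ₚ Γᵖ_{m iₛ} T_{i₁…p…iₖ}`. -/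
def covDeriv {k : ℕ} (g : EuclideanSpace ℝ (Fin n) → Matrix (Fin n) (Fin n) ℝ)
    (T : CoordTensor n k) : CoordTensor n (k + 1) :=
  fun y I => pderiv (I 0) (fun z => T z (Fin.tail I)) y
    - ∑ s : Fin k, ∑ p : Fin n,
        christoffel g y p (I 0) (Fin.tail I s) * T y (Function.update (Fin.tail I) s p)

/-- The Laplacian `(ΔT)_{i₁…iₖ} = ∑_{a,b} gᵃᵇ ∇ₐ∇_b T_{i₁…iₖ}` of a `(0,k)`-tensor field. -/
def laplacian {k : ℕ} (g : EuclideanSpace ℝ (Fin n) → Matrix (Fin n) (Fin n) ℝ)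
    (T : CoordTensor n k) : CoordTensor n k :=
  fun y I => ∑ a, ∑ b, (g y)⁻¹ a b * covDeriv g (covDeriv g T) y (Fin.cons a (Fin.cons b I))

/-! ### The curvature operator of the second kind -/

/-- The space `S²₀(ℝⁿ)` of traceless symmetric two-tensors, written as matrices of components in an
orthonormal basis. -/
def tracelessSym (n : ℕ) : Submodule ℝ (Matrix (Fin n) (Fin n) ℝ) where
  carrier := {φ | φ.IsSymm ∧ φ.trace = 0}
  add_mem' := by
    rintro φ ψ ⟨h₁, h₂⟩ ⟨h₃, h₄⟩
    exact ⟨h₁.add h₃, by rw [Matrix.trace_add, h₂, h₄, add_zero]⟩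
  zero_mem' := ⟨Matrix.isSymm_zero, Matrix.trace_zero _ _⟩
  smul_mem' := by
    rintro c φ ⟨h₁, h₂⟩
    exact ⟨h₁.smul c, by rw [Matrix.trace_smul, h₂, smul_zero]⟩

/-- The operator `R̄(φ)ᵢⱼ = ∑_{k,l} R_{iklj} φₖₗ`, where `R` holds the components of a curvature
tensor in an orthonormal basis. -/
def barOperator (R : (Fin 4 → Fin n) → ℝ) :
    Matrix (Fin n) (Fin n) ℝ →ₗ[ℝ] Matrix (Fin n) (Fin n) ℝ where
  toFun φ := Matrix.of fun i j => ∑ k, ∑ l, R ![i, k, l, j] * φ k l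
  map_add' φ ψ := by
    ext i j
    simp [mul_add, Finset.sum_add_distrib]
  map_smul' c φ := by
    ext i j
    simp only [Matrix.of_apply, Matrix.smul_apply, smul_eq_mul, Finset.mul_sum, RingHom.id_apply]
    exact Finset.sum_congr rfl fun k _ => Finset.sum_congr rfl fun l _ => by ring

/-- The orthogonal projection `φ ↦ ½ (φ + φᵀ) - (tr φ / n) g` onto `S²₀(ℝⁿ)`; on symmetric `φ` it is
`φ - (tr φ / n) g`. -/
def tracelessProj (n : ℕ) : Matrix (Fin n) (Fin n) ℝ →ₗ[ℝ] tracelessSym n where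
  toFun φ := ⟨(1 / 2 : ℝ) • (φ + φ.transpose) - (φ.trace / n) • (1 : Matrix (Fin n) (Fin n) ℝ), by
    constructor
    · refine Matrix.IsSymm.sub (Matrix.IsSymm.smul ?_ _) (Matrix.isSymm_one.smul _)
      rw [Matrix.IsSymm, Matrix.transpose_add, Matrix.transpose_transpose, add_comm]
    · rcases Nat.eq_zero_or_pos n with rfl | hn
      · simp [Matrix.trace]
      · have : (n : ℝ) ≠ 0 := by positivity
        simp only [Matrix.trace_sub, Matrix.trace_smul, Matrix.trace_add, Matrix.trace_transpose,
          Matrix.trace_one, Fintype.card_fin, smul_eq_mul]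
        field_simp
        ring⟩
  map_add' φ ψ := by
    apply Subtype.ext
    ext i j
    simp [Matrix.trace_add]
    ring
  map_smul' c φ := by
    apply Subtype.ext
    ext i j
    simp [Matrix.trace_smul]
    ring

/-- The curvature operator of the second kind `R̊ = π ∘ R̄ : S²₀ → S²₀`. -/
def secondKindOperator (R : (Fin 4 → Fin n) → ℝ) : tracelessSym n →ₗ[ℝ] tracelessSym n :=
  tracelessProj n ∘ₗ barOperator R ∘ₗ (tracelessSym n).subtype

/-- The dimension `N = (n - 1)(n + 2) / 2` of `S²₀(ℝⁿ)`. -/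
def secondKindDim (n : ℕ) : ℕ := (n - 1) * (n + 2) / 2

/-- The eigenvalues of `R̊`, repeated according to multiplicity and in nondecreasing order. The
eigenvalue `λ_{j+1}` of the usual one-based numbering is `secondKindEigenvalue R j`, for
`j < secondKindDim n`. -/
def secondKindEigenvalue (R : (Fin 4 → Fin n) → ℝ) (j : ℕ) : ℝ :=
  ((secondKindOperator R).charpoly.roots.sort (· ≤ ·)).getD j 0

/-- The average `λ̄` of the eigenvalues of `R̊`. -/
def secondKindMean (R : (Fin 4 → Fin n) → ℝ) : ℝ :=
  (∑ j ∈ Finset.range (secondKindDim n), secondKindEigenvalue R j) / secondKindDim n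

/-- The constant `θ(n)`; only its values for `n = 4`, `n = 5` and `n ≥ 8` are used. -/
def coneConstant (n : ℕ) : ℝ :=
  if n = 4 then 1 / 2
  else if n = 5 then 2 / 3
  else (2 * (secondKindDim n : ℝ) - 9 * n + 6) / ((secondKindDim n : ℝ) + 6 * n - 3)

/-- The cone condition `λ₁ + λ₂ ≥ -2 θ(n) λ̄`. -/
def ConeCondition (R : (Fin 4 → Fin n) → ℝ) : Prop :=
  secondKindEigenvalue R 0 + secondKindEigenvalue R 1 ≥ -2 * coneConstant n * secondKindMean R

/-! ### Riemannian manifolds -/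

section Manifold

variable {M : Type*} [TopologicalSpace M] [ChartedSpace (EuclideanSpace ℝ (Fin n)) M]

/-- The coordinate vector field `∂ᵢ` of a chart `e`, at the point with coordinates `y`. -/
def coordVector (e : OpenPartialHomeomorph M (EuclideanSpace ℝ (Fin n)))
    (y : EuclideanSpace ℝ (Fin n)) (i : Fin n) : TangentSpace (𝓡 n) (e.symm y) :=
  mfderiv (𝓡 n) (𝓡 n) e.symm y (EuclideanSpace.single i 1 : EuclideanSpace ℝ (Fin n))

/-- The `i`-th component, in the coordinates of a chart `e`, of a tangent vector at `x`. -/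
def coordComponent (e : OpenPartialHomeomorph M (EuclideanSpace ℝ (Fin n))) {x : M}
    (v : TangentSpace (𝓡 n) x) (i : Fin n) : ℝ :=
  let w : EuclideanSpace ℝ (Fin n) := mfderiv (𝓡 n) (𝓡 n) e x v
  w i

/-- The value `T(v₁, …, vₖ)` on tangent vectors at `x` of the tensor field with components `T` in
the chart `e`. -/
def tensorEval {k : ℕ} (e : OpenPartialHomeomorph M (EuclideanSpace ℝ (Fin n)))
    (T : CoordTensor n k) (x : M) (v : Fin k → TangentSpace (𝓡 n) x) : ℝ :=
  ∑ I : Fin k → Fin n, (∏ s, coordComponent e (v s) (I s)) * T (e x) I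

variable [Bundle.RiemannianBundle (fun x : M => TangentSpace (𝓡 n) x)]

/-- The components `gᵢⱼ = ⟨∂ᵢ, ∂ⱼ⟩` of the Riemannian metric in a chart `e`. -/
def chartMetric (e : OpenPartialHomeomorph M (EuclideanSpace ℝ (Fin n)))
    (y : EuclideanSpace ℝ (Fin n)) : Matrix (Fin n) (Fin n) ℝ :=
  Matrix.of fun i j => inner ℝ (coordVector e y i) (coordVector e y j)

/-- The Riemannian manifold is Einstein: `Ric = ρ g` with a constant `ρ`, as an identity of
components in every smooth chart. -/
def IsEinstein (n : ℕ) (M : Type*) [TopologicalSpace M]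
    [ChartedSpace (EuclideanSpace ℝ (Fin n)) M]
    [Bundle.RiemannianBundle (fun x : M => TangentSpace (𝓡 n) x)] : Prop :=
  ∃ ρ : ℝ, ∀ e ∈ IsManifold.maximalAtlas (𝓡 n) ∞ M, ∀ y ∈ e.target, ∀ i k : Fin n,
    ricci (chartMetric e) y i k = ρ * chartMetric e y i k

/-- The components `R(b_{A₀}, b_{A₁}, b_{A₂}, b_{A₃})` at `x` of the Riemann curvature tensor in an
orthonormal basis `b` of the tangent space, computed in the chart `e`. -/
def curvatureAt (e : OpenPartialHomeomorph M (EuclideanSpace ℝ (Fin n))) (x : M)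
    (b : OrthonormalBasis (Fin n) ℝ (TangentSpace (𝓡 n) x)) (A : Fin 4 → Fin n) : ℝ :=
  tensorEval e (riemann (chartMetric e)) x fun s => b (A s)

/-- The components at `x` of the Laplacian `ΔR` of the Riemann curvature tensor in an orthonormal
basis `b` of the tangent space, computed in the chart `e`. -/
def laplacianCurvatureAt (e : OpenPartialHomeomorph M (EuclideanSpace ℝ (Fin n))) (x : M)
    (b : OrthonormalBasis (Fin n) ℝ (TangentSpace (𝓡 n) x)) (A : Fin 4 → Fin n) : ℝ :=
  tensorEval e (laplacian (chartMetric e) (riemann (chartMetric e))) x fun s => b (A s)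

end Manifold

/-- The inner product `⟨S, T⟩ = ∑ S_{abcd} T_{abcd}` of `(0,4)`-tensors, in components with respect
to an orthonormal basis. -/
def tensorInner (S T : (Fin 4 → Fin n) → ℝ) : ℝ := ∑ A, S A * T A

end SecondKind

end

/-!
For an Einstein metric `⟨ΔR, R⟩` at a point is a polynomial in the curvature tensor at that point, and
the theorem is an inequality for the eigenvalues of the curvature operator of the second kind.

*Reduction to algebra.* The second Bianchi identity and the Einstein condition make `R` divergence
free. The covariant derivative of the Bianchi identity and the Ricci identity then express `ΔR`
through quadratic contractions of `R` (`MetricAlgebra.laplacian_Rm`), and in an orthonormal frame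
`⟨ΔR, R⟩ = 2 ρ |R|² - A(R) - 4 B(R)` with the cubic invariants `cubicA` and `cubicB`
(`MetricAlgebra.tensorInner_laplacian`). This tensor calculus uses nothing but a symmetric invertible
matrix over a commutative algebra with commuting derivations (`MetricAlgebra`); the chart enters only
through the algebra of smooth functions on its target (`smoothMetricAlgebra`).

*Eigenvalues.* For an Einstein curvature tensor the curvature operator of the second kind is
`φ ↦ R_{iklj} φ_{kl}` on `S²₀`, the mean `m` of its eigenvalues satisfies `ρ = (n - 1) m`, and the
differences `μ_c = λ_c - m` are the eigenvalues of the Weyl part `W` of `R` (`exists_isEigenframe`).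
They satisfy `∑ μ_c = 0`, `∑ μ_c² = 3/4 |W|²` and `∑ μ_c³ = A(W)/8 - B(W)`, and by `cubic_eq_weyl`
`⟨ΔR, R⟩ = 2 (n - 1) m |W|² - A(W) - 4 B(W)`.

*Dimension at least eight.* The derivation action of an orthonormal eigenbasis `φ_c` on `W` satisfies
`∑ μ_c |φ_c · W|² = 4 B(W) - 5 A(W)`, so that `3 ⟨ΔR, R⟩` equals
`∑ μ_c |φ_c · W|² + 16 ∑ μ_c³ + 6 (n - 1) m |W|²`. No `|φ_c · W|²` exceeds half of their sum, hence
the first term is controlled by the sum of the two smallest eigenvalues, as is `∑ μ_c³`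
(`IsEigenframe.nonneg_of_eight_le`).

*Dimensions four and five.* Antisymmetrization over six indices yields `A(W) = 2 B(W)`
(`IsWeylTensor.cubicA_eq_two_mul_cubicB`), so `⟨ΔR, R⟩` is a positive multiple of
`(n - 1)/3 m ∑ μ_c² + ∑ μ_c³`. The Cauchy-Schwarz inequality for `W` and tensors built from one or two
eigentensors bounds the smallest eigenvalues by `∑ μ_c²` (`IsEigenframe.sq_le`,
`IsEigenframe.sq_add_le`), and this leaves an inequality between real numbers.

*Equality.* In every case equality forces `W = 0`, that is, all eigenvalues equal. The second list of
eigenvalues in the statement, with all but one of them equal, occurs only when all its members agree: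
by the bound for a single eigenvalue, a Weyl part with such a spectrum vanishes
(`IsEigenframe.eq_zero_of_forall_ne_eq`).
-/

namespace SecondKind

/-! ### Algebraic curvature tensors and their cubic invariants -/

/-- The four-index array `W` has the algebraic symmetries of a Riemann curvature tensor. -/
structure IsCurvatureTensor {n : ℕ} (W : Fin n → Fin n → Fin n → Fin n → ℝ) : Prop where
  antisymm : ∀ i j k l, W i j k l = -W j i k l
  pair : ∀ i j k l, W i j k l = W k l i j
  bianchi : ∀ i j k l, W i j k l + W i k l j + W i l j k = 0

/-- The four-index array `W` has the symmetries of a Weyl tensor: those of a curvature tensor, and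
its Ricci contraction in an orthonormal basis vanishes. -/
structure IsWeylTensor {n : ℕ} (W : Fin n → Fin n → Fin n → Fin n → ℝ) : Prop
    extends IsCurvatureTensor W where
  trace : ∀ i k, ∑ j, W i j k j = 0

/-- The squared norm `∑ W_{ijkl}²`. -/
def normSq {n : ℕ} (W : Fin n → Fin n → Fin n → Fin n → ℝ) : ℝ :=
  ∑ x : Fin 4 → Fin n, W (x 0) (x 1) (x 2) (x 3) ^ 2

/-- The cubic invariant `W_{ijkl} W_{klpq} W_{pqij}`, with summation variables `i, …, q` collected
in one function `x`. -/
def cubicA {n : ℕ} (W : Fin n → Fin n → Fin n → Fin n → ℝ) : ℝ :=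
  ∑ x : Fin 6 → Fin n, W (x 0) (x 1) (x 2) (x 3) * W (x 2) (x 3) (x 4) (x 5) *
    W (x 4) (x 5) (x 0) (x 1)

/-- The cubic invariant `W_{ijkl} W_{ipkq} W_{jplq}`. -/
def cubicB {n : ℕ} (W : Fin n → Fin n → Fin n → Fin n → ℝ) : ℝ :=
  ∑ x : Fin 6 → Fin n, W (x 0) (x 1) (x 2) (x 3) * W (x 0) (x 4) (x 2) (x 5) *
    W (x 1) (x 4) (x 3) (x 5)

/-- Renaming of the summation variables in a sum over `k` indices. -/
lemma sum_rename {n k : ℕ} (e : Fin k → Fin k) (he : Function.Bijective e)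
    (f : (Fin k → Fin n) → ℝ) : ∑ x : Fin k → Fin n, f (fun i => x (e i)) = ∑ x, f x :=
  Equiv.sum_comp ((Equiv.ofBijective e he).arrowCongr (Equiv.refl (Fin n))).symm f

/-- A sum over functions on `Fin (k + 1)` as an iterated sum. -/
lemma sum_fun_succ {n k : ℕ} {α : Type*} [AddCommMonoid α] (f : (Fin (k + 1) → Fin n) → α) :
    ∑ x, f x = ∑ a, ∑ y : Fin k → Fin n, f (Fin.cons a y) := by
  rw [← Fintype.sum_prod_type', ← (Fin.consEquiv fun _ : Fin (k + 1) => Fin n).sum_comp]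
  rfl

lemma sum_fun_six {n : ℕ} (f : Fin n → Fin n → Fin n → Fin n → Fin n → Fin n → ℝ) :
    ∑ x : Fin 6 → Fin n, f (x 0) (x 1) (x 2) (x 3) (x 4) (x 5) =
      ∑ a, ∑ b, ∑ c, ∑ d, ∑ p, ∑ q, f a b c d p q := by
  simp only [sum_fun_succ]
  simp
  rfl

lemma sum_fun_four {n : ℕ} {α : Type*} [AddCommMonoid α] (f : (Fin 4 → Fin n) → α) :
    ∑ x : Fin 4 → Fin n, f x = ∑ a, ∑ b, ∑ c, ∑ d, f ![a, b, c, d] := by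
  simp only [sum_fun_succ]
  simp
  rfl

namespace IsCurvatureTensor

variable {n : ℕ} {W : Fin n → Fin n → Fin n → Fin n → ℝ}

lemma antisymm_right (h : IsCurvatureTensor W) (i j k l : Fin n) : W i j k l = -W i j l k := by
  rw [h.pair, h.antisymm, h.pair]

lemma self_left (h : IsCurvatureTensor W) (i k l : Fin n) : W i i k l = 0 := by
  linarith [h.antisymm i i k l]

/-- The first Bianchi identity, as the value of an antisymmetrization in two middle indices. -/
lemma sub_middle (h : IsCurvatureTensor W) (i k l j : Fin n) :
    W i k l j - W i l k j = -W i j k l := by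
  linarith [h.bianchi i k l j, h.antisymm_right i l j k]

/-- The first Bianchi identity, as the value of an antisymmetrization in the indices `1` and `3`. -/
lemma sub_odd (h : IsCurvatureTensor W) (i j q l : Fin n) :
    W i j q l - W q j i l = W i q j l := by
  linarith [h.bianchi i j q l, h.antisymm_right i l j q, h.pair i l q j, h.antisymm q j i l,
    h.pair q j i l, h.antisymm_right i l q j, h.antisymm_right i q l j]

/-- The first Bianchi identity, as the value of an antisymmetrization in the indices `2` and `4`. -/
lemma sub_even (h : IsCurvatureTensor W) (i k q p : Fin n) :
    W i k q p - W i p q k = W i q k p := by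
  linarith [h.sub_odd k i p q, h.antisymm i k q p, h.antisymm_right k i q p, h.antisymm i p q k,
    h.antisymm_right p i q k, h.pair i q k p, h.pair k p i q]

lemma cubicA_eq (h : IsCurvatureTensor W) :
    ∑ x : Fin 6 → Fin n, W (x 0) (x 1) (x 2) (x 3) * W (x 0) (x 1) (x 4) (x 5) *
      W (x 2) (x 3) (x 4) (x 5) = cubicA W := by
  refine Finset.sum_congr rfl fun x _ => ?_
  rw [h.pair (x 0) (x 1) (x 4) (x 5)]
  ring

/-- With `sum_cubic₂`, one of the two contractions into which the cubic trace of
`φ ↦ W_{iklj} φ_{kl}` on symmetric two-tensors splits. -/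
lemma sum_cubic₁ (h : IsCurvatureTensor W) :
    ∑ x : Fin 6 → Fin n, W (x 0) (x 1) (x 3) (x 2) * W (x 0) (x 4) (x 5) (x 2) *
      W (x 1) (x 4) (x 5) (x 3) = -cubicB W := by
  rw [cubicB, ← Finset.sum_neg_distrib]
  refine Finset.sum_congr rfl fun x _ => ?_
  rw [h.antisymm_right (x 0) (x 1) (x 3), h.antisymm_right (x 0) (x 4) (x 5),
    h.antisymm_right (x 1) (x 4) (x 5)]
  ring

/-- The difference to `sum_cubic₁` is a multiple of `cubicA W`, after four applications of the first
Bianchi identity. -/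
lemma sum_cubic₂ (h : IsCurvatureTensor W) :
    ∑ x : Fin 6 → Fin n, W (x 0) (x 1) (x 3) (x 2) * W (x 0) (x 4) (x 5) (x 2) *
      W (x 1) (x 5) (x 4) (x 3) = -cubicB W + cubicA W / 4 := by
  have e1 := sum_rename (n := n) ![0, 1, 2, 3, 5, 4] (by decide) fun x =>
    W (x 0) (x 1) (x 3) (x 2) * W (x 0) (x 4) (x 5) (x 2) * W (x 1) (x 5) (x 4) (x 3)
  have e2 := sum_rename (n := n) ![0, 1, 2, 3, 5, 4] (by decide) fun x =>
    W (x 0) (x 1) (x 3) (x 2) * W (x 0) (x 2) (x 4) (x 5) * W (x 1) (x 4) (x 5) (x 3)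
  have e3 := sum_rename (n := n) ![0, 3, 2, 1, 4, 5] (by decide) fun x =>
    W (x 0) (x 1) (x 3) (x 2) * W (x 0) (x 2) (x 4) (x 5) * W (x 1) (x 3) (x 4) (x 5)
  have e4 := sum_rename (n := n) ![0, 2, 1, 3, 4, 5] (by decide) fun x =>
    W (x 0) (x 1) (x 2) (x 3) * W (x 0) (x 1) (x 4) (x 5) * W (x 2) (x 3) (x 4) (x 5)
  rw [h.cubicA_eq] at e4
  have s1 := h.sum_cubic₁
  dsimp at e1 e2 e3 e4
  have d1 : ∑ x : Fin 6 → Fin n, W (x 0) (x 1) (x 3) (x 2) * W (x 0) (x 4) (x 5) (x 2) *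
      W (x 1) (x 4) (x 5) (x 3) - ∑ x : Fin 6 → Fin n, W (x 0) (x 1) (x 3) (x 2) *
      W (x 0) (x 5) (x 4) (x 2) * W (x 1) (x 4) (x 5) (x 3) =
      - ∑ x : Fin 6 → Fin n, W (x 0) (x 1) (x 3) (x 2) * W (x 0) (x 2) (x 4) (x 5) *
      W (x 1) (x 4) (x 5) (x 3) := by
    rw [← Finset.sum_sub_distrib, ← Finset.sum_neg_distrib]
    refine Finset.sum_congr rfl fun x _ => ?_
    linear_combination W (x 0) (x 1) (x 3) (x 2) * W (x 1) (x 4) (x 5) (x 3) *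
      h.sub_middle (x 0) (x 4) (x 5) (x 2)
  have d2 : ∑ x : Fin 6 → Fin n, W (x 0) (x 1) (x 3) (x 2) * W (x 0) (x 2) (x 4) (x 5) *
      W (x 1) (x 4) (x 5) (x 3) + ∑ x : Fin 6 → Fin n, W (x 0) (x 1) (x 3) (x 2) *
      W (x 0) (x 2) (x 5) (x 4) * W (x 1) (x 5) (x 4) (x 3) =
      - ∑ x : Fin 6 → Fin n, W (x 0) (x 1) (x 3) (x 2) * W (x 0) (x 2) (x 4) (x 5) *
      W (x 1) (x 3) (x 4) (x 5) := by
    rw [← Finset.sum_add_distrib, ← Finset.sum_neg_distrib]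
    refine Finset.sum_congr rfl fun x _ => ?_
    linear_combination W (x 0) (x 1) (x 3) (x 2) * W (x 0) (x 2) (x 4) (x 5) *
      h.sub_middle (x 1) (x 4) (x 5) (x 3) + W (x 0) (x 1) (x 3) (x 2) * W (x 1) (x 5) (x 4) (x 3) *
      h.antisymm_right (x 0) (x 2) (x 5) (x 4)
  have d3 : ∑ x : Fin 6 → Fin n, W (x 0) (x 1) (x 3) (x 2) * W (x 0) (x 2) (x 4) (x 5) *
      W (x 1) (x 3) (x 4) (x 5) + ∑ x : Fin 6 → Fin n, W (x 0) (x 3) (x 1) (x 2) *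
      W (x 0) (x 2) (x 4) (x 5) * W (x 3) (x 1) (x 4) (x 5) =
      - ∑ x : Fin 6 → Fin n, W (x 0) (x 2) (x 1) (x 3) * W (x 0) (x 2) (x 4) (x 5) *
      W (x 1) (x 3) (x 4) (x 5) := by
    rw [← Finset.sum_add_distrib, ← Finset.sum_neg_distrib]
    refine Finset.sum_congr rfl fun x _ => ?_
    linear_combination W (x 0) (x 2) (x 4) (x 5) * W (x 1) (x 3) (x 4) (x 5) *
      h.sub_middle (x 0) (x 1) (x 3) (x 2) + W (x 0) (x 3) (x 1) (x 2) * W (x 0) (x 2) (x 4) (x 5) *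
      h.antisymm (x 3) (x 1) (x 4) (x 5)
  linarith

end IsCurvatureTensor

/-! ### The derivation action of a symmetric two-tensor on a curvature tensor -/

section Forms

variable {n : ℕ} (W : Fin n → Fin n → Fin n → Fin n → ℝ) (S : Fin n → Fin n → ℝ)

/-- The contraction `S_{ip} S_{iq} W_{pjkl} W_{qjkl}`. -/
def formA : ℝ := ∑ x : Fin 6 → Fin n, S (x 0) (x 1) * S (x 0) (x 2) *
  (W (x 1) (x 3) (x 4) (x 5) * W (x 2) (x 3) (x 4) (x 5))

/-- The contraction `S_{ip} S_{jq} W_{pjkl} W_{iqkl}`. -/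
def formB : ℝ := ∑ x : Fin 6 → Fin n, S (x 0) (x 1) * S (x 2) (x 3) *
  (W (x 1) (x 2) (x 4) (x 5) * W (x 0) (x 3) (x 4) (x 5))

/-- The contraction `S_{ip} S_{kq} W_{pjkl} W_{ijql}`. -/
def formC : ℝ := ∑ x : Fin 6 → Fin n, S (x 0) (x 1) * S (x 2) (x 3) *
  (W (x 1) (x 4) (x 2) (x 5) * W (x 0) (x 4) (x 3) (x 5))

/-- The squared norm of the derivation action
`(S · W)_{ijkl} = S_{ip} W_{pjkl} + S_{jp} W_{ipkl} + S_{kp} W_{ijpl} + S_{lp} W_{ijkp}`, expanded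
into contractions (see `actionSq_eq`). -/
def actionSq : ℝ := 4 * formA W S + 4 * formB W S + 8 * formC W S

/-- The part of the derivation action of `S` on `W` that acts on the first two indices. -/
def leftAction (i j k l : Fin n) : ℝ := ∑ p, (S i p * W p j k l + S j p * W i p k l)

end Forms

namespace IsCurvatureTensor

variable {n : ℕ} {W : Fin n → Fin n → Fin n → Fin n → ℝ}

lemma sum_leftAction_sq (h : IsCurvatureTensor W) (S : Fin n → Fin n → ℝ) :
    ∑ x : Fin 4 → Fin n, leftAction W S (x 0) (x 1) (x 2) (x 3) ^ 2 =
      2 * formA W S + 2 * formB W S := by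
  have e0 : ∑ x : Fin 4 → Fin n, leftAction W S (x 0) (x 1) (x 2) (x 3) ^ 2 =
      ∑ x : Fin 6 → Fin n, (S (x 0) (x 4) * W (x 4) (x 1) (x 2) (x 3) +
        S (x 1) (x 4) * W (x 0) (x 4) (x 2) (x 3)) * (S (x 0) (x 5) * W (x 5) (x 1) (x 2) (x 3) +
        S (x 1) (x 5) * W (x 0) (x 5) (x 2) (x 3)) := by
    rw [sum_fun_six fun i j k l p q => (S i p * W p j k l + S j p * W i p k l) *
      (S i q * W q j k l + S j q * W i q k l)]
    simp only [sum_fun_four, leftAction, sq, Finset.sum_mul_sum, Matrix.cons_val]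
  have e1 := sum_rename (n := n) ![0, 4, 5, 1, 2, 3] (by decide) fun x =>
    S (x 0) (x 1) * S (x 0) (x 2) * (W (x 1) (x 3) (x 4) (x 5) * W (x 2) (x 3) (x 4) (x 5))
  have e2 := sum_rename (n := n) ![1, 4, 5, 0, 2, 3] (by decide) fun x =>
    S (x 0) (x 1) * S (x 0) (x 2) * (W (x 1) (x 3) (x 4) (x 5) * W (x 2) (x 3) (x 4) (x 5))
  have e3 := sum_rename (n := n) ![0, 4, 1, 5, 2, 3] (by decide) fun x =>
    S (x 0) (x 1) * S (x 2) (x 3) * (W (x 1) (x 2) (x 4) (x 5) * W (x 0) (x 3) (x 4) (x 5))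
  have e4 := sum_rename (n := n) ![0, 5, 1, 4, 2, 3] (by decide) fun x =>
    S (x 0) (x 1) * S (x 2) (x 3) * (W (x 1) (x 2) (x 4) (x 5) * W (x 0) (x 3) (x 4) (x 5))
  dsimp at e1 e2 e3 e4
  have : 2 * formA W S + 2 * formB W S = (formA W S + formA W S) + (formB W S + formB W S) := by
    ring
  rw [e0, this]
  unfold formA formB
  nth_rw 1 [← e1]
  rw [← e2]
  nth_rw 1 [← e3]
  rw [← e4]
  simp only [← Finset.sum_add_distrib]
  refine Finset.sum_congr rfl fun x _ => ?_
  rw [h.antisymm (x 4) (x 0) (x 2) (x 3), h.antisymm (x 5) (x 0) (x 2) (x 3)]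
  ring

lemma sum_leftAction_mul_swap (h : IsCurvatureTensor W) (S : Fin n → Fin n → ℝ) :
    ∑ x : Fin 4 → Fin n, leftAction W S (x 0) (x 1) (x 2) (x 3) *
      leftAction W S (x 2) (x 3) (x 0) (x 1) = 4 * formC W S := by
  have e0 : ∑ x : Fin 4 → Fin n, leftAction W S (x 0) (x 1) (x 2) (x 3) *
      leftAction W S (x 2) (x 3) (x 0) (x 1) =
      ∑ x : Fin 6 → Fin n, (S (x 0) (x 4) * W (x 4) (x 1) (x 2) (x 3) +
        S (x 1) (x 4) * W (x 0) (x 4) (x 2) (x 3)) * (S (x 2) (x 5) * W (x 5) (x 3) (x 0) (x 1) +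
        S (x 3) (x 5) * W (x 2) (x 5) (x 0) (x 1)) := by
    rw [sum_fun_six fun i j k l p q => (S i p * W p j k l + S j p * W i p k l) *
      (S k q * W q l i j + S l q * W k q i j)]
    simp only [sum_fun_four, leftAction, Finset.sum_mul_sum, Matrix.cons_val]
  have e1 := sum_rename (n := n) ![0, 4, 2, 5, 1, 3] (by decide) fun x =>
    S (x 0) (x 1) * S (x 2) (x 3) * (W (x 1) (x 4) (x 2) (x 5) * W (x 0) (x 4) (x 3) (x 5))
  have e2 := sum_rename (n := n) ![0, 4, 3, 5, 1, 2] (by decide) fun x =>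
    S (x 0) (x 1) * S (x 2) (x 3) * (W (x 1) (x 4) (x 2) (x 5) * W (x 0) (x 4) (x 3) (x 5))
  have e3 := sum_rename (n := n) ![1, 4, 2, 5, 0, 3] (by decide) fun x =>
    S (x 0) (x 1) * S (x 2) (x 3) * (W (x 1) (x 4) (x 2) (x 5) * W (x 0) (x 4) (x 3) (x 5))
  have e4 := sum_rename (n := n) ![1, 4, 3, 5, 0, 2] (by decide) fun x =>
    S (x 0) (x 1) * S (x 2) (x 3) * (W (x 1) (x 4) (x 2) (x 5) * W (x 0) (x 4) (x 3) (x 5))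
  dsimp at e1 e2 e3 e4
  have : 4 * formC W S = formC W S + formC W S + (formC W S + formC W S) := by ring
  rw [e0, this]
  unfold formC
  nth_rw 1 [← e1]
  nth_rw 1 [← e2]
  nth_rw 1 [← e3]
  rw [← e4]
  simp only [← Finset.sum_add_distrib]
  refine Finset.sum_congr rfl fun x _ => ?_
  rw [h.antisymm_right (x 4) (x 1) (x 3) (x 2), h.antisymm (x 4) (x 0) (x 2) (x 3),
    h.antisymm (x 4) (x 0) (x 3) (x 2), h.antisymm_right (x 0) (x 4) (x 3) (x 2),
    h.pair (x 5) (x 3) (x 0) (x 1), h.pair (x 2) (x 5) (x 0) (x 1),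
    h.antisymm_right (x 0) (x 1) (x 2) (x 5), h.antisymm (x 1) (x 0) (x 5) (x 3),
    h.antisymm (x 1) (x 0) (x 5) (x 2)]
  ring

/-- The squared norm of the derivation action; by pair symmetry its part on the last two indices is
the part on the first two with the pairs interchanged. -/
lemma actionSq_eq (h : IsCurvatureTensor W) (S : Fin n → Fin n → ℝ) :
    actionSq W S = ∑ x : Fin 4 → Fin n, (leftAction W S (x 0) (x 1) (x 2) (x 3) +
      leftAction W S (x 2) (x 3) (x 0) (x 1)) ^ 2 := by
  have e := sum_rename (n := n) ![2, 3, 0, 1] (by decide) fun x =>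
    leftAction W S (x 0) (x 1) (x 2) (x 3) ^ 2
  dsimp at e
  have h1 := h.sum_leftAction_sq S
  have h2 := h.sum_leftAction_mul_swap S
  simp only [add_sq, Finset.sum_add_distrib, e, mul_assoc, ← Finset.mul_sum, h1, h2, actionSq]
  ring

lemma actionSq_nonneg (h : IsCurvatureTensor W) (S : Fin n → Fin n → ℝ) :
    0 ≤ actionSq W S := by
  rw [h.actionSq_eq]
  positivity

/-- An antisymmetric matrix `w` satisfies `|w v|² ≤ ½ |w|² |v|²`: its singular values come in
pairs. This is the Cauchy-Schwarz inequality for `w` and `(w v) ⊗ v - v ⊗ (w v)`. -/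
lemma _root_.SecondKind.sq_mulVec_le_of_antisymm {w : Fin n → Fin n → ℝ}
    (hw : ∀ i j, w i j = -w j i) (v : Fin n → ℝ) :
    2 * ∑ i, (∑ j, w i j * v j) ^ 2 ≤ (∑ i, ∑ j, w i j ^ 2) * ∑ j, v j ^ 2 := by
  set u : Fin n → ℝ := fun i => ∑ j, w i j * v j with hu
  set U := ∑ i, u i ^ 2
  set V := ∑ i, v i ^ 2
  have huv : ∑ i, u i * v i = 0 := by
    have : ∑ i, u i * v i = -∑ i, u i * v i := by
      simp only [hu, Finset.sum_mul]
      conv_lhs => rw [Finset.sum_comm]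
      rw [← Finset.sum_neg_distrib]
      refine Finset.sum_congr rfl fun j _ => ?_
      rw [← Finset.sum_neg_distrib]
      refine Finset.sum_congr rfl fun i _ => ?_
      linear_combination v i * v j * hw i j
    linarith
  have h1 : ∑ i, ∑ j, w i j * (u i * v j) = U := by
    simp only [U]
    refine Finset.sum_congr rfl fun i _ => ?_
    rw [sq, hu]
    simp only [Finset.mul_sum]
    refine Finset.sum_congr rfl fun j _ => ?_
    ring
  have h2 : ∑ i, ∑ j, w i j * (v i * u j) = -U := by
    rw [← h1, Finset.sum_comm, ← Finset.sum_neg_distrib]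
    refine Finset.sum_congr rfl fun j _ => ?_
    rw [← Finset.sum_neg_distrib]
    refine Finset.sum_congr rfl fun i _ => ?_
    rw [hw i j]
    ring
  have h3 : ∑ i, ∑ j, (u i * v j - v i * u j) ^ 2 = 2 * (U * V) := by
    have : ∀ i j, (u i * v j - v i * u j) ^ 2 =
        u i ^ 2 * v j ^ 2 + v i ^ 2 * u j ^ 2 - 2 * ((u i * v i) * (u j * v j)) := by
      intros; ring
    simp only [this, Finset.sum_sub_distrib, Finset.sum_add_distrib, ← Finset.mul_sum,
      ← Finset.sum_mul, huv]
    ring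
  have hcs := Finset.sum_mul_sq_le_sq_mul_sq (Finset.univ : Finset (Fin n × Fin n))
    (fun x => w x.1 x.2) (fun x => u x.1 * v x.2 - v x.1 * u x.2)
  simp only [Fintype.sum_prod_type, mul_sub, Finset.sum_sub_distrib, h1, h2, h3] at hcs
  have hU : 0 ≤ U := by positivity
  have hV : 0 ≤ V := by positivity
  have hT : 0 ≤ ∑ i, ∑ j, w i j ^ 2 := by positivity
  rcases hU.eq_or_lt with h0 | h0
  · nlinarith [mul_nonneg hT hV]
  · nlinarith

lemma sum_leftAction_sq_le (h : IsCurvatureTensor W) (S : Fin n → Fin n → ℝ) :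
    ∑ x : Fin 4 → Fin n, leftAction W S (x 0) (x 1) (x 2) (x 3) ^ 2 ≤
      2 * (∑ i, ∑ j, S i j ^ 2) * normSq W := by
  have key : ∀ k l, ∑ i, ∑ j, leftAction W S i j k l ^ 2 ≤
      2 * (∑ i, ∑ j, S i j ^ 2) * ∑ i, ∑ j, W i j k l ^ 2 := by
    intro k l
    -- `S w + w S`, where `w = W_{··kl}`, is the antisymmetrization of `2 S w`
    have h1 : ∀ i j, leftAction W S i j k l ^ 2 ≤
        2 * (∑ p, W p j k l * S i p) ^ 2 + 2 * (∑ p, W p i k l * S j p) ^ 2 := by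
      intro i j
      have : leftAction W S i j k l = (∑ p, W p j k l * S i p) - ∑ p, W p i k l * S j p := by
        rw [leftAction, ← Finset.sum_sub_distrib]
        refine Finset.sum_congr rfl fun p _ => ?_
        rw [h.antisymm i p]
        ring
      rw [this]
      nlinarith [sq_nonneg ((∑ p, W p j k l * S i p) + ∑ p, W p i k l * S j p)]
    have h2 : ∑ i, ∑ j, (∑ p, W p j k l * S i p) ^ 2 ≤
        (∑ i, ∑ j, S i j ^ 2) * (∑ i, ∑ j, W i j k l ^ 2) / 2 := by
      rw [Finset.sum_mul, Finset.sum_div]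
      refine Finset.sum_le_sum fun i _ => ?_
      have := sq_mulVec_le_of_antisymm (w := fun j p => W p j k l)
        (fun a b => h.antisymm b a k l) (S i)
      rw [Finset.sum_comm (f := fun j p => W p j k l ^ 2)] at this
      linarith
    have h3 : ∑ i, ∑ j, (∑ p, W p i k l * S j p) ^ 2 =
        ∑ i, ∑ j, (∑ p, W p j k l * S i p) ^ 2 := Finset.sum_comm
    calc ∑ i, ∑ j, leftAction W S i j k l ^ 2
        ≤ ∑ i, ∑ j, (2 * (∑ p, W p j k l * S i p) ^ 2 + 2 * (∑ p, W p i k l * S j p) ^ 2) :=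
          Finset.sum_le_sum fun i _ => Finset.sum_le_sum fun j _ => h1 i j
      _ = 4 * ∑ i, ∑ j, (∑ p, W p j k l * S i p) ^ 2 := by
          simp only [Finset.sum_add_distrib, ← Finset.mul_sum, h3]
          ring
      _ ≤ _ := by linarith
  have e1 := sum_rename (n := n) ![2, 3, 0, 1] (by decide) fun x =>
    leftAction W S (x 0) (x 1) (x 2) (x 3) ^ 2
  have e2 := sum_rename (n := n) ![2, 3, 0, 1] (by decide) fun x =>
    W (x 0) (x 1) (x 2) (x 3) ^ 2
  dsimp at e1 e2
  rw [normSq, ← e1, ← e2]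
  simp only [sum_fun_four, Matrix.cons_val]
  generalize 2 * ∑ i, ∑ j, S i j ^ 2 = c at key ⊢
  rw [Finset.mul_sum]
  refine Finset.sum_le_sum fun k _ => ?_
  rw [Finset.mul_sum]
  exact Finset.sum_le_sum fun l _ => key k l

/-- The antisymmetry of `W` improves the constant from the obvious `16` to `8`. -/
lemma actionSq_le (h : IsCurvatureTensor W) {S : Fin n → Fin n → ℝ}
    (hS₁ : ∑ i, ∑ j, S i j ^ 2 = 1) : actionSq W S ≤ 8 * normSq W := by
  have e := sum_rename (n := n) ![2, 3, 0, 1] (by decide) fun x =>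
    leftAction W S (x 0) (x 1) (x 2) (x 3) ^ 2
  dsimp at e
  have h1 := h.sum_leftAction_sq_le S
  rw [hS₁] at h1
  rw [h.actionSq_eq]
  calc _ ≤ ∑ x : Fin 4 → Fin n, (2 * leftAction W S (x 0) (x 1) (x 2) (x 3) ^ 2 +
        2 * leftAction W S (x 2) (x 3) (x 0) (x 1) ^ 2) := by
        refine Finset.sum_le_sum fun x _ => ?_
        nlinarith [sq_nonneg (leftAction W S (x 0) (x 1) (x 2) (x 3) -
          leftAction W S (x 2) (x 3) (x 0) (x 1))]
    _ ≤ _ := by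
        rw [Finset.sum_add_distrib, ← Finset.mul_sum, ← Finset.mul_sum, e]
        linarith

/-- `V_{ipjq} W_{pjkl} W_{iqkl}` for the symmetrization `V_{ijkl} = ½ (W_{iklj} + W_{ilkj})`. -/
lemma sum_formB (h : IsCurvatureTensor W) :
    ∑ x : Fin 6 → Fin n, (W (x 0) (x 2) (x 3) (x 1) + W (x 0) (x 3) (x 2) (x 1)) / 2 *
      (W (x 1) (x 2) (x 4) (x 5) * W (x 0) (x 3) (x 4) (x 5)) = -(3 / 4) * cubicA W := by
  have e1 := sum_rename (n := n) ![0, 2, 1, 3, 4, 5] (by decide) fun x =>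
    W (x 0) (x 2) (x 3) (x 1) * (W (x 1) (x 2) (x 4) (x 5) * W (x 0) (x 3) (x 4) (x 5))
  have e2 := sum_rename (n := n) ![0, 3, 1, 2, 4, 5] (by decide) fun x =>
    W (x 0) (x 1) (x 2) (x 3) * W (x 0) (x 1) (x 4) (x 5) * W (x 2) (x 3) (x 4) (x 5)
  rw [h.cubicA_eq] at e2
  dsimp at e1 e2
  have d1 : ∑ x : Fin 6 → Fin n, W (x 0) (x 2) (x 3) (x 1) *
        (W (x 1) (x 2) (x 4) (x 5) * W (x 0) (x 3) (x 4) (x 5)) +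
      ∑ x : Fin 6 → Fin n, W (x 0) (x 1) (x 3) (x 2) *
        (W (x 2) (x 1) (x 4) (x 5) * W (x 0) (x 3) (x 4) (x 5)) =
      -∑ x : Fin 6 → Fin n, W (x 0) (x 3) (x 1) (x 2) * W (x 0) (x 3) (x 4) (x 5) *
        W (x 1) (x 2) (x 4) (x 5) := by
    rw [← Finset.sum_add_distrib, ← Finset.sum_neg_distrib]
    refine Finset.sum_congr rfl fun x _ => ?_
    rw [h.antisymm (x 2) (x 1) (x 4) (x 5)]
    linear_combination (W (x 1) (x 2) (x 4) (x 5) * W (x 0) (x 3) (x 4) (x 5)) *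
      (h.bianchi (x 0) (x 2) (x 3) (x 1) - h.antisymm_right (x 0) (x 1) (x 2) (x 3))
  have d2 : 2 * ∑ x : Fin 6 → Fin n, (W (x 0) (x 2) (x 3) (x 1) + W (x 0) (x 3) (x 2) (x 1)) / 2 *
      (W (x 1) (x 2) (x 4) (x 5) * W (x 0) (x 3) (x 4) (x 5)) =
      ∑ x : Fin 6 → Fin n, W (x 0) (x 2) (x 3) (x 1) *
        (W (x 1) (x 2) (x 4) (x 5) * W (x 0) (x 3) (x 4) (x 5)) -
      ∑ x : Fin 6 → Fin n, W (x 0) (x 3) (x 1) (x 2) * W (x 0) (x 3) (x 4) (x 5) *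
        W (x 1) (x 2) (x 4) (x 5) := by
    rw [Finset.mul_sum, ← Finset.sum_sub_distrib]
    refine Finset.sum_congr rfl fun x _ => ?_
    rw [h.antisymm_right (x 0) (x 3) (x 2) (x 1)]
    ring
  linarith

/-- `V_{ipkq} W_{pjkl} W_{ijql}` for the symmetrization `V_{ijkl} = ½ (W_{iklj} + W_{ilkj})`. -/
lemma sum_formC (h : IsCurvatureTensor W) :
    ∑ x : Fin 6 → Fin n, (W (x 0) (x 2) (x 3) (x 1) + W (x 0) (x 3) (x 2) (x 1)) / 2 *
      (W (x 1) (x 4) (x 2) (x 5) * W (x 0) (x 4) (x 3) (x 5)) =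
      cubicB W / 2 - cubicA W / 4 := by
  have e1 := sum_rename (n := n) ![3, 1, 2, 0, 4, 5] (by decide) fun x =>
    W (x 0) (x 3) (x 2) (x 1) * (W (x 1) (x 4) (x 2) (x 5) * W (x 0) (x 4) (x 3) (x 5))
  have e2 := sum_rename (n := n) ![0, 2, 1, 3, 4, 5] (by decide) fun x =>
    W (x 0) (x 3) (x 2) (x 1) * (W (x 1) (x 4) (x 2) (x 5) * W (x 0) (x 3) (x 4) (x 5))
  have e3 := sum_rename (n := n) ![0, 3, 1, 2, 4, 5] (by decide) fun x =>
    W (x 0) (x 1) (x 2) (x 3) * W (x 0) (x 1) (x 4) (x 5) * W (x 2) (x 3) (x 4) (x 5)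
  have e4 := sum_rename (n := n) ![0, 2, 3, 1, 4, 5] (by decide) fun x =>
    W (x 0) (x 1) (x 2) (x 3) * W (x 0) (x 4) (x 2) (x 5) * W (x 1) (x 4) (x 3) (x 5)
  have e5 := sum_rename (n := n) ![0, 2, 1, 3, 4, 5] (by decide) fun x =>
    W (x 0) (x 2) (x 3) (x 1) * (W (x 0) (x 4) (x 3) (x 5) * W (x 2) (x 1) (x 4) (x 5))
  have e6 := sum_rename (n := n) ![3, 1, 2, 0, 4, 5] (by decide) fun x =>
    W (x 0) (x 3) (x 2) (x 1) * (W (x 0) (x 4) (x 3) (x 5) * W (x 2) (x 1) (x 4) (x 5))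
  rw [h.cubicA_eq] at e3
  dsimp at e1 e2 e3 e4 e5 e6
  have d1 : ∑ x : Fin 6 → Fin n, W (x 0) (x 3) (x 2) (x 1) * (W (x 1) (x 4) (x 2) (x 5) *
      W (x 0) (x 4) (x 3) (x 5)) +
      ∑ x : Fin 6 → Fin n, W (x 3) (x 0) (x 2) (x 1) * (W (x 1) (x 4) (x 2) (x 5) *
          W (x 3) (x 4) (x 0) (x 5)) =
      ∑ x : Fin 6 → Fin n, W (x 0) (x 3) (x 2) (x 1) * (W (x 1) (x 4) (x 2) (x 5) *
          W (x 0) (x 3) (x 4) (x 5)) := by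
    rw [← Finset.sum_add_distrib]
    refine Finset.sum_congr rfl fun x _ => ?_
    linear_combination W (x 0) (x 3) (x 2) (x 1) * W (x 1) (x 4) (x 2) (x 5) *
      h.sub_odd (x 0) (x 4) (x 3) (x 5) + W (x 1) (x 4) (x 2) (x 5) * W (x 3) (x 4) (x 0) (x 5) *
          h.antisymm (x 3) (x 0) (x 2) (x 1)
  have d2 : ∑ x : Fin 6 → Fin n, W (x 0) (x 3) (x 2) (x 1) * (W (x 1) (x 4) (x 2) (x 5) *
      W (x 0) (x 3) (x 4) (x 5)) +
      ∑ x : Fin 6 → Fin n, W (x 0) (x 3) (x 1) (x 2) * (W (x 2) (x 4) (x 1) (x 5) *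
          W (x 0) (x 3) (x 4) (x 5)) =
      -∑ x : Fin 6 → Fin n, W (x 0) (x 3) (x 1) (x 2) * W (x 0) (x 3) (x 4) (x 5) *
          W (x 1) (x 2) (x 4) (x 5) := by
    simp only [← Finset.sum_add_distrib, ← Finset.sum_neg_distrib]
    refine Finset.sum_congr rfl fun x _ => ?_
    linear_combination W (x 0) (x 3) (x 2) (x 1) * W (x 0) (x 3) (x 4) (x 5) *
      h.sub_odd (x 1) (x 4) (x 2) (x 5) + W (x 0) (x 3) (x 4) (x 5) * (W (x 2) (x 4) (x 1) (x 5) +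
          W (x 1) (x 2) (x 4) (x 5)) *
      h.antisymm_right (x 0) (x 3) (x 1) (x 2)
  have d3 : ∑ x : Fin 6 → Fin n, W (x 0) (x 2) (x 3) (x 1) * W (x 0) (x 4) (x 3) (x 5) *
      W (x 2) (x 4) (x 1) (x 5) -
      ∑ x : Fin 6 → Fin n, W (x 0) (x 2) (x 3) (x 1) * (W (x 1) (x 4) (x 2) (x 5) *
          W (x 0) (x 4) (x 3) (x 5)) =
      ∑ x : Fin 6 → Fin n, W (x 0) (x 2) (x 3) (x 1) * (W (x 0) (x 4) (x 3) (x 5) *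
          W (x 2) (x 1) (x 4) (x 5)) := by
    simp only [← Finset.sum_sub_distrib]
    refine Finset.sum_congr rfl fun x _ => ?_
    linear_combination W (x 0) (x 2) (x 3) (x 1) * W (x 0) (x 4) (x 3) (x 5) * h.sub_odd (x 2)
        (x 4) (x 1) (x 5)
  have d4 : ∑ x : Fin 6 → Fin n, W (x 0) (x 2) (x 3) (x 1) * (W (x 0) (x 4) (x 3) (x 5) *
      W (x 2) (x 1) (x 4) (x 5)) +
      ∑ x : Fin 6 → Fin n, W (x 0) (x 1) (x 3) (x 2) * (W (x 0) (x 4) (x 3) (x 5) *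
          W (x 1) (x 2) (x 4) (x 5)) =
      ∑ x : Fin 6 → Fin n, W (x 0) (x 3) (x 2) (x 1) * (W (x 0) (x 4) (x 3) (x 5) *
          W (x 2) (x 1) (x 4) (x 5)) := by
    rw [← Finset.sum_add_distrib]
    refine Finset.sum_congr rfl fun x _ => ?_
    linear_combination W (x 0) (x 4) (x 3) (x 5) * W (x 2) (x 1) (x 4) (x 5) *
      h.sub_even (x 0) (x 2) (x 3) (x 1) + W (x 0) (x 1) (x 3) (x 2) * W (x 0) (x 4) (x 3) (x 5) *
          h.antisymm (x 1) (x 2) (x 4) (x 5)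
  have d5 : ∑ x : Fin 6 → Fin n, W (x 0) (x 3) (x 2) (x 1) * (W (x 0) (x 4) (x 3) (x 5) *
      W (x 2) (x 1) (x 4) (x 5)) +
      ∑ x : Fin 6 → Fin n, W (x 3) (x 0) (x 2) (x 1) * (W (x 3) (x 4) (x 0) (x 5) *
          W (x 2) (x 1) (x 4) (x 5)) =
      ∑ x : Fin 6 → Fin n, W (x 0) (x 3) (x 1) (x 2) * W (x 0) (x 3) (x 4) (x 5) *
          W (x 1) (x 2) (x 4) (x 5) := by
    rw [← Finset.sum_add_distrib]
    refine Finset.sum_congr rfl fun x _ => ?_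
    linear_combination W (x 0) (x 3) (x 2) (x 1) * W (x 2) (x 1) (x 4) (x 5) *
      h.sub_odd (x 0) (x 4) (x 3) (x 5) + W (x 3) (x 4) (x 0) (x 5) * W (x 2) (x 1) (x 4) (x 5) *
          h.antisymm (x 3) (x 0) (x 2) (x 1) +
      W (x 0) (x 3) (x 4) (x 5) * W (x 2) (x 1) (x 4) (x 5) * h.antisymm_right (x 0) (x 3) (x 2)
          (x 1) -
      W (x 0) (x 3) (x 1) (x 2) * W (x 0) (x 3) (x 4) (x 5) * h.antisymm (x 2) (x 1) (x 4) (x 5)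
  have d6 : 2 * ∑ x : Fin 6 → Fin n, (W (x 0) (x 2) (x 3) (x 1) + W (x 0) (x 3) (x 2) (x 1)) / 2 *
      (W (x 1) (x 4) (x 2) (x 5) * W (x 0) (x 4) (x 3) (x 5)) =
      ∑ x : Fin 6 → Fin n, W (x 0) (x 2) (x 3) (x 1) * (W (x 1) (x 4) (x 2) (x 5) *
          W (x 0) (x 4) (x 3) (x 5)) +
      ∑ x : Fin 6 → Fin n, W (x 0) (x 3) (x 2) (x 1) * (W (x 1) (x 4) (x 2) (x 5) *
          W (x 0) (x 4) (x 3) (x 5)) := by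
    rw [Finset.mul_sum, ← Finset.sum_add_distrib]
    refine Finset.sum_congr rfl fun x _ => ?_
    ring
  rw [← cubicB] at e4
  linarith

end IsCurvatureTensor

/-! ### Orthonormal eigenbases of the Weyl part and power sums of the eigenvalues -/

/-- An orthonormal basis `φ` of the space of traceless symmetric two-tensors, consisting of
eigentensors of `φ ↦ W_{iklj} φ_{kl}` with eigenvalues `μ`. That `φ` spans is expressed by the
formula for the orthogonal projection onto that space. -/
structure IsEigenframe {n N : ℕ} (W : Fin n → Fin n → Fin n → Fin n → ℝ)
    (φ : Fin N → Fin n → Fin n → ℝ) (μ : Fin N → ℝ) : Prop where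
  symm : ∀ a i j, φ a i j = φ a j i
  trace : ∀ a, ∑ i, φ a i i = 0
  orthonormal : ∀ a b, ∑ i, ∑ j, φ a i j * φ b i j = if a = b then 1 else 0
  complete : ∀ i j k l, ∑ a, φ a i j * φ a k l =
    ((if i = k then 1 else 0) * (if j = l then 1 else 0) +
      (if i = l then 1 else 0) * (if j = k then 1 else 0)) / 2 -
      (if i = j then 1 else 0) * (if k = l then 1 else 0) / n
  eigen : ∀ a i j, ∑ k, ∑ l, W i k l j * φ a k l = μ a * φ a i j

namespace IsEigenframe

variable {n N : ℕ} {W : Fin n → Fin n → Fin n → Fin n → ℝ}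
  {φ : Fin N → Fin n → Fin n → ℝ} {μ : Fin N → ℝ}

lemma sum_sq (hφ : IsEigenframe W φ μ) (a : Fin N) : ∑ i, ∑ j, φ a i j ^ 2 = 1 := by
  simpa [sq] using hφ.orthonormal a a

/-- The spectral decomposition of the symmetrized Weyl tensor. -/
lemma sum_eigenvalue_mul (hφ : IsEigenframe W φ μ) (hW : IsWeylTensor W) (i j k l : Fin n) :
    ∑ a, μ a * (φ a i j * φ a k l) = (W i k l j + W i l k j) / 2 := by
  have h1 : ∀ a, μ a * (φ a i j * φ a k l) =
      ∑ p, ∑ q, W i p q j * (φ a p q * φ a k l) := by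
    intro a
    rw [← mul_assoc, ← hφ.eigen a i j, Finset.sum_mul]
    refine Finset.sum_congr rfl fun p _ => ?_
    rw [Finset.sum_mul]
    exact Finset.sum_congr rfl fun q _ => by ring
  have htr : ∑ p, W i p p j = 0 := by
    rw [← neg_eq_zero, ← hW.trace i j, ← Finset.sum_neg_distrib]
    exact Finset.sum_congr rfl fun p _ => (hW.antisymm_right i p j p).symm
  simp only [h1]
  rw [Finset.sum_comm]
  simp_rw [Finset.sum_comm (s := (Finset.univ : Finset (Fin N))), ← Finset.mul_sum,
    hφ.complete]
  have h2 : ∀ p q : Fin n, W i p q j * (((if p = k then 1 else 0) * (if q = l then 1 else 0) +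
      (if p = l then 1 else 0) * (if q = k then 1 else 0)) / 2 -
      (if p = q then 1 else 0) * (if k = l then 1 else 0) / n) =
      (if q = l then (if p = k then W i p q j / 2 else 0) else 0) +
      (if q = k then (if p = l then W i p q j / 2 else 0) else 0) -
      (if p = q then W i p q j * ((if k = l then 1 else 0) / n) else 0) := by
    intro p q
    split_ifs <;> ring
  simp only [h2, Finset.sum_add_distrib, Finset.sum_sub_distrib, Finset.sum_ite_eq',
    Finset.sum_ite_eq, Finset.mem_univ, if_true, ← Finset.sum_mul, htr]
  ring

lemma _root_.SecondKind.sum_mul_contraction {n N : ℕ} (c : Fin N → ℝ)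
    (P : Fin N → (Fin 6 → Fin n) → ℝ) (G : (Fin 6 → Fin n) → ℝ) :
    ∑ a, c a * ∑ x : Fin 6 → Fin n, P a x * G x =
      ∑ x : Fin 6 → Fin n, (∑ a, c a * P a x) * G x := by
  simp only [Finset.mul_sum]
  rw [Finset.sum_comm]
  refine Finset.sum_congr rfl fun x _ => ?_
  rw [Finset.sum_mul]
  exact Finset.sum_congr rfl fun a _ => by ring

/-- The squared norms of the derivation actions, weighted by the eigenvalues, add up to a combination
of the two cubic invariants. -/
lemma sum_eigenvalue_mul_actionSq (hφ : IsEigenframe W φ μ) (hW : IsWeylTensor W) :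
    ∑ a, μ a * actionSq W (φ a) = 4 * cubicB W - 5 * cubicA W := by
  have h1 : ∑ a, μ a * formA W (φ a) = 0 := by
    simp only [formA]
    simp only [sum_mul_contraction]
    simp only [hφ.sum_eigenvalue_mul hW, hW.self_left]
    have e := sum_rename (n := n) ![5, 1, 2, 3, 4, 0] (by decide) fun x =>
      (0 + W (x 0) (x 2) (x 0) (x 1)) / 2 *
        (W (x 1) (x 3) (x 4) (x 5) * W (x 2) (x 3) (x 4) (x 5))
    dsimp at e
    rw [← e, sum_fun_six fun l p q j k i => (0 + W i q i p) / 2 * (W p j k l * W q j k l)]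
    have htr : ∀ p q, ∑ i, W i q i p = 0 := by
      intro p q
      rw [← hW.trace q p]
      refine Finset.sum_congr rfl fun i _ => ?_
      rw [hW.antisymm, hW.antisymm_right, neg_neg]
    simp only [zero_add, ← Finset.sum_mul, ← Finset.sum_div, htr]
    simp
  have h2 : ∑ a, μ a * formB W (φ a) = -(3 / 4) * cubicA W := by
    simp only [formB]
    simp only [sum_mul_contraction]
    rw [← hW.sum_formB]
    simp only [hφ.sum_eigenvalue_mul hW]
  have h3 : ∑ a, μ a * formC W (φ a) = cubicB W / 2 - cubicA W / 4 := by
    simp only [formC]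
    simp only [sum_mul_contraction]
    rw [← hW.sum_formC]
    simp only [hφ.sum_eigenvalue_mul hW]
  have : ∀ a, μ a * actionSq W (φ a) = 4 * (μ a * formA W (φ a)) + 4 * (μ a * formB W (φ a)) +
      8 * (μ a * formC W (φ a)) := fun a => by rw [actionSq]; ring
  simp only [this, Finset.sum_add_distrib, ← Finset.mul_sum, h1, h2, h3]
  ring

lemma sum_eigenvalue_cube (hφ : IsEigenframe W φ μ) (hW : IsWeylTensor W) :
    ∑ a, μ a ^ 3 = cubicA W / 8 - cubicB W := by
  have h0 : ∀ a, μ a ^ 3 = μ a * ∑ x : Fin 6 → Fin n, φ a (x 1) (x 3) * φ a (x 4) (x 5) *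
      (W (x 0) (x 1) (x 3) (x 2) * W (x 0) (x 4) (x 5) (x 2)) := by
    intro a
    rw [sum_fun_six fun i k j l p q => φ a k l * φ a p q * (W i k l j * W i p q j)]
    have : μ a ^ 3 = μ a * ∑ i, ∑ j, (μ a * φ a i j) * (μ a * φ a i j) := by
      have e : ∀ i j, (μ a * φ a i j) * (μ a * φ a i j) = μ a ^ 2 * φ a i j ^ 2 := by
        intros; ring
      simp only [e, ← Finset.mul_sum, hφ.sum_sq]
      ring
    rw [this]
    congr 1
    refine Finset.sum_congr rfl fun i _ => ?_
    rw [Finset.sum_comm]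
    refine Finset.sum_congr rfl fun j _ => ?_
    rw [← hφ.eigen, Finset.sum_mul_sum]
    refine Finset.sum_congr rfl fun k _ => ?_
    simp only [Finset.sum_mul_sum]
    rw [Finset.sum_comm]
    refine Finset.sum_congr rfl fun l _ => Finset.sum_congr rfl fun p _ =>
      Finset.sum_congr rfl fun q _ => by ring
  simp only [h0]
  simp only [sum_mul_contraction]
  simp only [hφ.sum_eigenvalue_mul hW]
  have h1 := hW.sum_cubic₁
  have h2 := hW.sum_cubic₂
  have h3 : ∑ x : Fin 6 → Fin n, (W (x 1) (x 4) (x 5) (x 3) + W (x 1) (x 5) (x 4) (x 3)) / 2 *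
      (W (x 0) (x 1) (x 3) (x 2) * W (x 0) (x 4) (x 5) (x 2)) =
      (-cubicB W + (-cubicB W + cubicA W / 4)) / 2 := by
    rw [← h2, ← h1, ← Finset.sum_add_distrib, Finset.sum_div]
    exact Finset.sum_congr rfl fun x _ => by ring
  rw [h3]
  ring

end IsEigenframe

namespace IsCurvatureTensor

variable {n : ℕ} {W : Fin n → Fin n → Fin n → Fin n → ℝ}

/-- The contraction `W_{ijkl} W_{ikjl}` of a curvature tensor is half its squared norm. -/
lemma sum_mul_swap (h : IsCurvatureTensor W) :
    ∑ x : Fin 4 → Fin n, W (x 0) (x 1) (x 2) (x 3) * W (x 0) (x 2) (x 1) (x 3) =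
      normSq W / 2 := by
  have e1 := sum_rename (n := n) ![0, 2, 1, 3] (by decide) fun x => W (x 0) (x 1) (x 2) (x 3) ^ 2
  have e2 := sum_rename (n := n) ![0, 3, 1, 2] (by decide) fun x => W (x 0) (x 1) (x 2) (x 3) ^ 2
  dsimp at e1 e2
  rw [← normSq] at e1 e2
  have : ∑ x : Fin 4 → Fin n, W (x 0) (x 3) (x 1) (x 2) ^ 2 =
      ∑ x : Fin 4 → Fin n, W (x 0) (x 1) (x 2) (x 3) ^ 2 +
      ∑ x : Fin 4 → Fin n, W (x 0) (x 2) (x 1) (x 3) ^ 2 -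
      2 * ∑ x : Fin 4 → Fin n, W (x 0) (x 1) (x 2) (x 3) * W (x 0) (x 2) (x 1) (x 3) := by
    rw [Finset.mul_sum, ← Finset.sum_add_distrib, ← Finset.sum_sub_distrib]
    refine Finset.sum_congr rfl fun x _ => ?_
    rw [← neg_sq, ← h.sub_middle]
    ring
  rw [← normSq] at this
  linarith

end IsCurvatureTensor

namespace IsEigenframe

variable {n N : ℕ} {W : Fin n → Fin n → Fin n → Fin n → ℝ}
  {φ : Fin N → Fin n → Fin n → ℝ} {μ : Fin N → ℝ}

lemma sum_eigenvalue_sq (hφ : IsEigenframe W φ μ) (hW : IsWeylTensor W) :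
    ∑ a, μ a ^ 2 = 3 / 4 * normSq W := by
  have h0 : ∀ a, μ a ^ 2 = ∑ x : Fin 4 → Fin n, W (x 0) (x 1) (x 2) (x 3) *
      (μ a * (φ a (x 1) (x 2) * φ a (x 0) (x 3))) := by
    intro a
    rw [sum_fun_four]
    simp only [Matrix.cons_val]
    have : μ a ^ 2 = ∑ i, ∑ j, (μ a * φ a i j) * (μ a * φ a i j) := by
      have e : ∀ i j, (μ a * φ a i j) * (μ a * φ a i j) = μ a ^ 2 * φ a i j ^ 2 := by
        intros; ring
      simp only [e, ← Finset.mul_sum, hφ.sum_sq, mul_one]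
    rw [this]
    refine Finset.sum_congr rfl fun i _ => ?_
    rw [Finset.sum_congr rfl fun j _ => by rw [← hφ.eigen, Finset.sum_mul], Finset.sum_comm]
    refine Finset.sum_congr rfl fun k _ => ?_
    simp only [Finset.sum_mul]
    rw [Finset.sum_comm]
    refine Finset.sum_congr rfl fun l _ => Finset.sum_congr rfl fun j _ => ?_
    rw [hφ.eigen]
    ring
  simp only [h0]
  rw [Finset.sum_comm]
  simp only [← Finset.mul_sum, hφ.sum_eigenvalue_mul hW]
  have h1 := hW.sum_mul_swap
  have h2 : ∑ x : Fin 4 → Fin n, W (x 0) (x 1) (x 2) (x 3) *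
      ((W (x 1) (x 0) (x 3) (x 2) + W (x 1) (x 3) (x 0) (x 2)) / 2) =
      (normSq W + ∑ x : Fin 4 → Fin n, W (x 0) (x 1) (x 2) (x 3) *
        W (x 0) (x 2) (x 1) (x 3)) / 2 := by
    rw [normSq, ← Finset.sum_add_distrib, Finset.sum_div]
    refine Finset.sum_congr rfl fun x _ => ?_
    rw [hW.antisymm (x 1) (x 0), hW.antisymm_right (x 0) (x 1) (x 3), hW.pair (x 1) (x 3)]
    ring
  rw [h2, h1]
  ring

lemma sum_eigenvalue (hφ : IsEigenframe W φ μ) (hW : IsWeylTensor W) : ∑ a, μ a = 0 := by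
  have h0 : ∀ a, μ a = ∑ i, ∑ j, μ a * (φ a i j * φ a i j) := by
    intro a
    simp only [← Finset.mul_sum, ← sq, hφ.sum_sq, mul_one]
  rw [Finset.sum_congr rfl fun a _ => h0 a, Finset.sum_comm]
  refine Finset.sum_eq_zero fun i _ => ?_
  rw [Finset.sum_comm]
  simp only [hφ.sum_eigenvalue_mul hW, hW.self_left, zero_add, ← Finset.sum_div, hW.trace, zero_div]

/-- The number of elements of an eigenframe, from the trace of the projection formula. -/
lemma card_eq (hφ : IsEigenframe W φ μ) (hn : n ≠ 0) : (N : ℝ) = n * (n + 1) / 2 - 1 := by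
  have h0 : ∀ a, (1 : ℝ) = ∑ i, ∑ j, φ a i j * φ a i j := by
    intro a
    simp only [← sq, hφ.sum_sq]
  have h1 : (N : ℝ) = ∑ a : Fin N, (1 : ℝ) := by simp
  rw [h1, Finset.sum_congr rfl fun a _ => h0 a, Finset.sum_comm]
  have h2 : ∀ i : Fin n, ∑ a, ∑ j, φ a i j * φ a i j = (n + 1) / 2 - 1 / n := by
    intro i
    rw [Finset.sum_comm]
    simp only [hφ.complete, Finset.sum_sub_distrib, ← Finset.sum_div, Finset.sum_add_distrib]
    simp
  have : (n : ℝ) ≠ 0 := by exact_mod_cast hn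
  simp only [h2]
  simp
  field_simp

lemma _root_.SecondKind.sum_pairs {n : ℕ} (f : Fin n → Fin n → Fin n → Fin n → Fin n → Fin n → ℝ) :
    ∑ x : Fin 6 → Fin n, (if x 0 = x 1 then 1 else 0) * (if x 2 = x 3 then 1 else 0) *
      f (x 0) (x 1) (x 2) (x 3) (x 4) (x 5) =
    ∑ y : Fin 4 → Fin n, f (y 0) (y 0) (y 1) (y 1) (y 2) (y 3) := by
  rw [sum_fun_six fun a b c d p q => (if a = b then 1 else 0) * (if c = d then 1 else 0) *
    f a b c d p q, sum_fun_four]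
  simp only [mul_assoc, ← Finset.mul_sum]
  simp

lemma _root_.SecondKind.sum_triple {n : ℕ}
    (f : Fin n → Fin n → Fin n → Fin n → Fin n → Fin n → ℝ) :
    ∑ x : Fin 6 → Fin n, (if x 0 = x 1 then 1 else 0) * (if x 0 = x 2 then 1 else 0) *
      f (x 0) (x 1) (x 2) (x 3) (x 4) (x 5) =
    ∑ y : Fin 4 → Fin n, f (y 0) (y 0) (y 0) (y 1) (y 2) (y 3) := by
  rw [sum_fun_six fun a b c d p q => (if a = b then 1 else 0) * (if a = c then 1 else 0) *
    f a b c d p q, sum_fun_four]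
  simp only [mul_assoc, ← Finset.mul_sum]
  simp

lemma _root_.SecondKind.ite_eq_symm {n : ℕ} (i j : Fin n) :
    (if i = j then (1 : ℝ) else 0) = if j = i then 1 else 0 := by
  simp only [eq_comm]

lemma sum_formA (hφ : IsEigenframe W φ μ) :
    ∑ a, formA W (φ a) = ((n + 1) / 2 - 1 / n) * normSq W := by
  have h := fun P G => sum_mul_contraction (n := n) (fun _ : Fin N => 1) P G
  simp only [one_mul] at h
  have h1 : ∑ x : Fin 6 → Fin n, (if x 1 = x 2 then 1 else 0) *
      (W (x 1) (x 3) (x 4) (x 5) * W (x 2) (x 3) (x 4) (x 5)) = n * normSq W := by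
    rw [sum_fun_six fun a b c d p q => (if b = c then 1 else 0) * (W b d p q * W c d p q), normSq,
      sum_fun_four]
    simp only [← Finset.mul_sum]
    simp [sq]
  have h2 := sum_triple fun _ b c d p q : Fin n => W b d p q * W c d p q
  simp only [← sq] at h2
  rw [← normSq] at h2
  simp only [formA, h]
  have h3 : ∀ x : Fin 6 → Fin n, (((if x 0 = x 0 then 1 else 0) * (if x 1 = x 2 then 1 else 0) +
      (if x 0 = x 2 then 1 else 0) * (if x 1 = x 0 then 1 else 0)) / 2 -
      (if x 0 = x 1 then 1 else 0) * (if x 0 = x 2 then 1 else 0) / (n : ℝ)) *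
      (W (x 1) (x 3) (x 4) (x 5) * W (x 2) (x 3) (x 4) (x 5)) =
      (1 / 2) * ((if x 1 = x 2 then 1 else 0) *
        (W (x 1) (x 3) (x 4) (x 5) * W (x 2) (x 3) (x 4) (x 5))) +
      (1 / 2 - 1 / n) * ((if x 0 = x 1 then 1 else 0) * (if x 0 = x 2 then 1 else 0) *
        (W (x 1) (x 3) (x 4) (x 5) * W (x 2) (x 3) (x 4) (x 5))) := by
    intro x
    rw [if_pos rfl, ite_eq_symm (x 1) (x 0)]
    split_ifs <;> simp_all
    ring
  rw [Finset.sum_congr rfl fun x _ => (congrArg (· * _) (hφ.complete _ _ _ _)).trans (h3 x),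
      Finset.sum_add_distrib, ← Finset.mul_sum,
    ← Finset.mul_sum, h1, h2]
  ring

/-- The trace of a bilinear contraction `S_{ab} S_{cd} f_{abcdpq}` over the eigenframe. -/
lemma sum_contraction (hφ : IsEigenframe W φ μ)
    (f : Fin n → Fin n → Fin n → Fin n → Fin n → Fin n → ℝ) :
    ∑ a, ∑ x : Fin 6 → Fin n, φ a (x 0) (x 1) * φ a (x 2) (x 3) *
      f (x 0) (x 1) (x 2) (x 3) (x 4) (x 5) =
    (∑ y : Fin 4 → Fin n, f (y 0) (y 1) (y 0) (y 1) (y 2) (y 3) +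
      ∑ y : Fin 4 → Fin n, f (y 0) (y 1) (y 1) (y 0) (y 2) (y 3)) / 2 -
      (∑ y : Fin 4 → Fin n, f (y 0) (y 0) (y 1) (y 1) (y 2) (y 3)) / n := by
  have h := fun P G => sum_mul_contraction (n := n) (fun _ : Fin N => 1) P G
  simp only [one_mul] at h
  simp only [h]
  have e1 : ∑ x : Fin 6 → Fin n, (if x 0 = x 2 then 1 else 0) * (if x 1 = x 3 then 1 else 0) *
      f (x 0) (x 1) (x 2) (x 3) (x 4) (x 5) = _ :=
    sum_rename (n := n) ![0, 2, 1, 3, 4, 5] (by decide) fun x =>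
    (if x 0 = x 1 then 1 else 0) * (if x 2 = x 3 then 1 else 0) *
      f (x 0) (x 2) (x 1) (x 3) (x 4) (x 5)
  have e2 : ∑ x : Fin 6 → Fin n, (if x 0 = x 3 then 1 else 0) * (if x 1 = x 2 then 1 else 0) *
      f (x 0) (x 1) (x 2) (x 3) (x 4) (x 5) = _ :=
    sum_rename (n := n) ![0, 3, 1, 2, 4, 5] (by decide) fun x =>
    (if x 0 = x 1 then 1 else 0) * (if x 2 = x 3 then 1 else 0) *
      f (x 0) (x 2) (x 3) (x 1) (x 4) (x 5)
  have p1 := sum_pairs fun a c b d p q => f a b c d p q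
  have p2 := sum_pairs fun a d b c p q => f a b c d p q
  have p3 := sum_pairs f
  rw [← p1, ← p2, ← p3, ← e1, ← e2, ← Finset.sum_add_distrib, Finset.sum_div, Finset.sum_div,
    ← Finset.sum_sub_distrib]
  refine Finset.sum_congr rfl fun x _ => ?_
  rw [hφ.complete]
  ring

lemma sum_formB (hφ : IsEigenframe W φ μ) (hW : IsCurvatureTensor W) :
    ∑ a, formB W (φ a) = (-1 / 2 - 1 / n) * normSq W := by
  simp only [formB]
  rw [hφ.sum_contraction fun a b c d p q => W b c p q * W a d p q]
  have e1 : ∑ y : Fin 4 → Fin n, W (y 1) (y 0) (y 2) (y 3) * W (y 0) (y 1) (y 2) (y 3) =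
      -normSq W := by
    rw [normSq, ← Finset.sum_neg_distrib]
    refine Finset.sum_congr rfl fun y _ => ?_
    rw [hW.antisymm]
    ring
  simp only [e1, hW.self_left, ← sq]
  rw [← normSq]
  simp
  ring

lemma sum_formC (hφ : IsEigenframe W φ μ) (hW : IsWeylTensor W) :
    ∑ a, formC W (φ a) = (1 / 4 - 1 / n) * normSq W := by
  simp only [formC]
  rw [hφ.sum_contraction fun a b c d p q => W b p c q * W a p d q]
  have e1 : ∑ y : Fin 4 → Fin n, W (y 1) (y 2) (y 0) (y 3) * W (y 0) (y 2) (y 1) (y 3) =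
      normSq W / 2 := by
    have e := sum_rename (n := n) ![2, 0, 1, 3] (by decide) fun x =>
      W (x 0) (x 1) (x 2) (x 3) * W (x 0) (x 2) (x 1) (x 3)
    dsimp at e
    rw [← hW.sum_mul_swap, ← e]
    refine Finset.sum_congr rfl fun y _ => ?_
    rw [hW.antisymm (y 1), hW.antisymm (y 0)]
    ring
  have e2 : ∑ y : Fin 4 → Fin n, W (y 1) (y 2) (y 1) (y 3) * W (y 0) (y 2) (y 0) (y 3) = 0 := by
    have e := sum_rename (n := n) ![0, 2, 3, 1] (by decide) fun x =>
      W (x 3) (x 1) (x 3) (x 2) * W (x 0) (x 1) (x 0) (x 2)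
    dsimp at e
    rw [e, sum_fun_four]
    have htr : ∀ j l, ∑ i, W i j i l = 0 := by
      intro j l
      rw [← hW.trace j l]
      exact Finset.sum_congr rfl fun i _ => by rw [hW.antisymm, hW.antisymm_right, neg_neg]
    simp only [Matrix.cons_val, ← Finset.sum_mul, htr]
    simp
  have e3 : ∑ y : Fin 4 → Fin n, W (y 0) (y 2) (y 1) (y 3) * W (y 0) (y 2) (y 1) (y 3) =
      normSq W := by
    have e := sum_rename (n := n) ![0, 2, 1, 3] (by decide) fun x =>
      W (x 0) (x 1) (x 2) (x 3) ^ 2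
    dsimp at e
    rw [normSq, ← e]
    exact Finset.sum_congr rfl fun x _ => (sq _).symm
  rw [e1, e2, e3]
  ring

/-- A Casimir type identity: averaged over the eigenframe, the derivation action has norm
proportional to that of `W`. -/
lemma sum_actionSq (hφ : IsEigenframe W φ μ) (hW : IsWeylTensor W) (hn : n ≠ 0) :
    ∑ a, actionSq W (φ a) = (4 * N - 12) / n * normSq W := by
  have : (n : ℝ) ≠ 0 := by exact_mod_cast hn
  simp only [actionSq, Finset.sum_add_distrib, ← Finset.mul_sum, hφ.sum_formA,
    hφ.sum_formB hW.toIsCurvatureTensor, hφ.sum_formC hW, hφ.card_eq hn]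
  field_simp
  ring

end IsEigenframe

/-! ### The relation between the cubic invariants in dimension at most five -/

/-- The wedge product of two two-forms, up to normalization. -/
def wedge₄ {n : ℕ} (u v : Fin n → Fin n → ℝ) (a b c d : Fin n) : ℝ :=
  u a b * v c d - u a c * v b d + u a d * v b c + u b c * v a d - u b d * v a c + u c d * v a b

/-- The wedge product of three two-forms, up to normalization. -/
def wedge₆ {n : ℕ} (u v w : Fin n → Fin n → ℝ) (a b c d e f : Fin n) : ℝ :=
  w a b * wedge₄ u v c d e f - w a c * wedge₄ u v b d e f + w a d * wedge₄ u v b c e f -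
    w a e * wedge₄ u v b c d f + w a f * wedge₄ u v b c d e + w b c * wedge₄ u v a d e f -
    w b d * wedge₄ u v a c e f + w b e * wedge₄ u v a c d f - w b f * wedge₄ u v a c d e +
    w c d * wedge₄ u v a b e f - w c e * wedge₄ u v a b d f + w c f * wedge₄ u v a b d e +
    w d e * wedge₄ u v a b c f - w d f * wedge₄ u v a b c e + w e f * wedge₄ u v a b c d

/-- Six indices in a range of at most five cannot be distinct, so a six-form vanishes. -/
lemma wedge₆_eq_zero {n : ℕ} (hn : n ≤ 5) {u v w : Fin n → Fin n → ℝ}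
    (hu : ∀ i j, u i j = -u j i) (hv : ∀ i j, v i j = -v j i) (hw : ∀ i j, w i j = -w j i)
    (x : Fin 6 → Fin n) : wedge₆ u v w (x 0) (x 1) (x 2) (x 3) (x 4) (x 5) = 0 := by
  have hu' : u = fun i j => (u i j - u j i) / 2 := by
    ext i j
    linarith [hu i j]
  have hv' : v = fun i j => (v i j - v j i) / 2 := by
    ext i j
    linarith [hv i j]
  have hw' : w = fun i j => (w i j - w j i) / 2 := by
    ext i j
    linarith [hw i j]
  obtain ⟨i, j, hij, h⟩ : ∃ i j, i < j ∧ x i = x j := by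
    have : ¬Function.Injective x := fun h => by
      have := Fintype.card_le_of_injective x h
      simp at this
      omega
    rw [Function.Injective] at this
    push Not at this
    obtain ⟨i, j, h, hne⟩ := this
    rcases lt_or_gt_of_ne hne with h' | h'
    · exact ⟨i, j, h', h⟩
    · exact ⟨j, i, h', h.symm⟩
  rw [hu', hv', hw']
  clear hu' hv' hw' hu hv hw
  fin_cases i <;> fin_cases j <;> simp at hij h <;> simp only [wedge₆, wedge₄, h] <;> ring

/-- A sum vanishes if partial summation over one of the variables vanishes. -/
lemma sum_eq_zero_of_sum_update {n k : ℕ} (i : Fin k) {f : (Fin k → Fin n) → ℝ}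
    (h : ∀ x, ∑ t, f (Function.update x i t) = 0) : ∑ x, f x = 0 := by
  have hinv : Function.Involutive fun y : (Fin k → Fin n) × Fin n =>
      (Function.update y.1 i y.2, y.1 i) := by
    rintro ⟨x, t⟩
    simp
  have h1 : ∑ y : (Fin k → Fin n) × Fin n, f (Function.update y.1 i y.2) =
      ∑ y : (Fin k → Fin n) × Fin n, f y.1 :=
    Equiv.sum_comp hinv.toPerm fun y => f y.1
  rw [Fintype.sum_prod_type, Fintype.sum_prod_type, Finset.sum_eq_zero fun x _ => h x] at h1
  simp only [Finset.sum_const, Finset.card_univ, Fintype.card_fin, nsmul_eq_mul,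
    ← Finset.mul_sum] at h1
  rcases Nat.eq_zero_or_pos n with rfl | hn
  · have : IsEmpty (Fin k → Fin 0) := ⟨fun x => (x i).elim0⟩
    simp
  · have : (n : ℝ) ≠ 0 := by positivity
    simpa [this] using h1.symm

namespace IsWeylTensor

variable {n : ℕ} {W : Fin n → Fin n → Fin n → Fin n → ℝ}

lemma trace₁₃ (h : IsWeylTensor W) (j k : Fin n) : ∑ t, W t j t k = 0 := by
  rw [← h.trace j k]
  exact Finset.sum_congr rfl fun t _ => by rw [h.antisymm, h.antisymm_right, neg_neg]

lemma trace₁₄ (h : IsWeylTensor W) (j k : Fin n) : ∑ t, W t j k t = 0 := by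
  rw [← neg_eq_zero, ← h.trace j k, ← Finset.sum_neg_distrib]
  exact Finset.sum_congr rfl fun t _ => by rw [h.antisymm, neg_neg]

lemma trace₂₃ (h : IsWeylTensor W) (j k : Fin n) : ∑ t, W j t t k = 0 := by
  rw [← neg_eq_zero, ← h.trace j k, ← Finset.sum_neg_distrib]
  exact Finset.sum_congr rfl fun t _ => by rw [h.antisymm_right, neg_neg]

/-- A contraction of `W` in which one factor is traced vanishes. -/
lemma sum_trace_mul (i : Fin 6) {f g : (Fin 6 → Fin n) → ℝ}
    (hf : ∀ x, ∑ t, f (Function.update x i t) = 0) (hg : ∀ x t, g (Function.update x i t) = g x) :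
    ∑ x, f x * g x = 0 := by
  refine sum_eq_zero_of_sum_update i fun x => ?_
  simp only [hg, ← Finset.sum_mul, hf, zero_mul]

/-- In dimension at most five the six-form `W_{··ij} ∧ W_{··kl} ∧ W_{··pq}` vanishes. In its
contraction with `ijklpq` the terms containing a trace of `W` vanish, and the others are multiples of the two
cubic invariants. -/
lemma cubicA_eq_two_mul_cubicB (h : IsWeylTensor W) (hn : n ≤ 5) : cubicA W = 2 * cubicB W := by
  have key : ∑ x : Fin 6 → Fin n, wedge₆ (fun i j => W i j (x 0) (x 1))
      (fun i j => W i j (x 2) (x 3)) (fun i j => W i j (x 4) (x 5))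
      (x 0) (x 1) (x 2) (x 3) (x 4) (x 5) = 0 :=
    Finset.sum_eq_zero fun x _ => wedge₆_eq_zero hn (fun i j => h.antisymm i j _ _)
      (fun i j => h.antisymm i j _ _) (fun i j => h.antisymm i j _ _) x
  -- `tij`, `pij`, `qij`: a product vanishes if the slots `i` and `j` of its first, second or third
  -- factor are contracted with each other.
  have t13 (i j k : Fin 6) (g : (Fin 6 → Fin n) → ℝ) (hj : j ≠ i) (hk : k ≠ i)
      (hg : ∀ x t, g (Function.update x i t) = g x) :
      ∑ x : Fin 6 → Fin n, W (x i) (x j) (x i) (x k) * g x = 0 :=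
    sum_trace_mul i (fun x => by simp [hj, hk, h.trace₁₃]) hg
  have t14 (i j k : Fin 6) (g : (Fin 6 → Fin n) → ℝ) (hj : j ≠ i) (hk : k ≠ i)
      (hg : ∀ x t, g (Function.update x i t) = g x) :
      ∑ x : Fin 6 → Fin n, W (x i) (x j) (x k) (x i) * g x = 0 :=
    sum_trace_mul i (fun x => by simp [hj, hk, h.trace₁₄]) hg
  have t23 (i j k : Fin 6) (g : (Fin 6 → Fin n) → ℝ) (hj : j ≠ i) (hk : k ≠ i)
      (hg : ∀ x t, g (Function.update x i t) = g x) :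
      ∑ x : Fin 6 → Fin n, W (x j) (x i) (x i) (x k) * g x = 0 :=
    sum_trace_mul i (fun x => by simp [hj, hk, h.trace₂₃]) hg
  have t24 (i j k : Fin 6) (g : (Fin 6 → Fin n) → ℝ) (hj : j ≠ i) (hk : k ≠ i)
      (hg : ∀ x t, g (Function.update x i t) = g x) :
      ∑ x : Fin 6 → Fin n, W (x j) (x i) (x k) (x i) * g x = 0 :=
    sum_trace_mul i (fun x => by simp [hj, hk, h.trace]) hg
  have p13 (i j k : Fin 6) (f g : (Fin 6 → Fin n) → ℝ) (hj : j ≠ i) (hk : k ≠ i)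
      (hf : ∀ x t, f (Function.update x i t) = f x) (hg : ∀ x t, g (Function.update x i t) = g x) :
      ∑ x : Fin 6 → Fin n, f x * (W (x i) (x j) (x i) (x k) * g x) = 0 := by
    simpa only [mul_left_comm] using
      t13 i j k (fun x => f x * g x) hj hk fun x t => by rw [hf, hg]
  have q13 (i j k : Fin 6) (f g : (Fin 6 → Fin n) → ℝ) (hj : j ≠ i) (hk : k ≠ i)
      (hf : ∀ x t, f (Function.update x i t) = f x) (hg : ∀ x t, g (Function.update x i t) = g x) :
      ∑ x : Fin 6 → Fin n, f x * (g x * W (x i) (x j) (x i) (x k)) = 0 := by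
    simpa only [mul_comm] using p13 i j k f g hj hk hf hg
  have p14 (i j k : Fin 6) (f g : (Fin 6 → Fin n) → ℝ) (hj : j ≠ i) (hk : k ≠ i)
      (hf : ∀ x t, f (Function.update x i t) = f x) (hg : ∀ x t, g (Function.update x i t) = g x) :
      ∑ x : Fin 6 → Fin n, f x * (W (x i) (x j) (x k) (x i) * g x) = 0 := by
    simpa only [mul_left_comm] using
      t14 i j k (fun x => f x * g x) hj hk fun x t => by rw [hf, hg]
  have q14 (i j k : Fin 6) (f g : (Fin 6 → Fin n) → ℝ) (hj : j ≠ i) (hk : k ≠ i)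
      (hf : ∀ x t, f (Function.update x i t) = f x) (hg : ∀ x t, g (Function.update x i t) = g x) :
      ∑ x : Fin 6 → Fin n, f x * (g x * W (x i) (x j) (x k) (x i)) = 0 := by
    simpa only [mul_comm] using p14 i j k f g hj hk hf hg
  have p23 (i j k : Fin 6) (f g : (Fin 6 → Fin n) → ℝ) (hj : j ≠ i) (hk : k ≠ i)
      (hf : ∀ x t, f (Function.update x i t) = f x) (hg : ∀ x t, g (Function.update x i t) = g x) :
      ∑ x : Fin 6 → Fin n, f x * (W (x j) (x i) (x i) (x k) * g x) = 0 := by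
    simpa only [mul_left_comm] using
      t23 i j k (fun x => f x * g x) hj hk fun x t => by rw [hf, hg]
  have q23 (i j k : Fin 6) (f g : (Fin 6 → Fin n) → ℝ) (hj : j ≠ i) (hk : k ≠ i)
      (hf : ∀ x t, f (Function.update x i t) = f x) (hg : ∀ x t, g (Function.update x i t) = g x) :
      ∑ x : Fin 6 → Fin n, f x * (g x * W (x j) (x i) (x i) (x k)) = 0 := by
    simpa only [mul_comm] using p23 i j k f g hj hk hf hg
  have p24 (i j k : Fin 6) (f g : (Fin 6 → Fin n) → ℝ) (hj : j ≠ i) (hk : k ≠ i)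
      (hf : ∀ x t, f (Function.update x i t) = f x) (hg : ∀ x t, g (Function.update x i t) = g x) :
      ∑ x : Fin 6 → Fin n, f x * (W (x j) (x i) (x k) (x i) * g x) = 0 := by
    simpa only [mul_left_comm] using
      t24 i j k (fun x => f x * g x) hj hk fun x t => by rw [hf, hg]
  have q24 (i j k : Fin 6) (f g : (Fin 6 → Fin n) → ℝ) (hj : j ≠ i) (hk : k ≠ i)
      (hf : ∀ x t, f (Function.update x i t) = f x) (hg : ∀ x t, g (Function.update x i t) = g x) :
      ∑ x : Fin 6 → Fin n, f x * (g x * W (x j) (x i) (x k) (x i)) = 0 := by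
    simpa only [mul_comm] using p24 i j k f g hj hk hf hg
  simp only [wedge₆, wedge₄, Finset.sum_add_distrib, Finset.sum_sub_distrib, mul_add,
      mul_sub] at key
  simp (disch := first | decide | (intros; simp [Function.update_apply])) only
    [t13, t23, t24, p13, p14, q13, q14, q23, q24, add_zero, zero_add, sub_zero] at key
  clear t13 t14 t23 t24 p13 p14 p23 p24 q13 q14 q23 q24
  -- The remaining terms are two copies of `cubicA W` and eight copies of `± T`.
  set T := ∑ x : Fin 6 → Fin n, W (x 0) (x 2) (x 4) (x 5) * (W (x 3) (x 4) (x 0) (x 1) *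
      W (x 1) (x 5) (x 2) (x 3)) with hT
  have r2 : ∑ x : Fin 6 → Fin n, W (x 0) (x 2) (x 4) (x 5) * (W (x 3) (x 5) (x 0) (x 1) *
      W (x 1) (x 4) (x 2) (x 3)) = -T := by
    rw [hT, ← sum_rename ![0, 1, 2, 3, 5, 4] (by decide) fun x =>
      W (x 0) (x 2) (x 4) (x 5) * (W (x 3) (x 4) (x 0) (x 1) *
          W (x 1) (x 5) (x 2) (x 3)), ← Finset.sum_neg_distrib]
    refine Finset.sum_congr rfl fun x _ => ?_
    dsimp
    rw [h.antisymm_right (x 0) (x 2) (x 5) (x 4)]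
    ring
  have r3 : ∑ x : Fin 6 → Fin n, W (x 0) (x 3) (x 4) (x 5) * (W (x 2) (x 4) (x 0) (x 1) *
      W (x 1) (x 5) (x 2) (x 3)) = -T := by
    rw [hT, ← sum_rename ![0, 1, 3, 2, 4, 5] (by decide) fun x =>
      W (x 0) (x 2) (x 4) (x 5) * (W (x 3) (x 4) (x 0) (x 1) *
          W (x 1) (x 5) (x 2) (x 3)), ← Finset.sum_neg_distrib]
    refine Finset.sum_congr rfl fun x _ => ?_
    dsimp
    rw [h.antisymm_right (x 1) (x 5) (x 3) (x 2)]
    ring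
  have r4 : ∑ x : Fin 6 → Fin n, W (x 0) (x 3) (x 4) (x 5) * (W (x 2) (x 5) (x 0) (x 1) *
      W (x 1) (x 4) (x 2) (x 3)) = T := by
    rw [hT, ← sum_rename ![0, 1, 3, 2, 5, 4] (by decide) fun x =>
      W (x 0) (x 2) (x 4) (x 5) * (W (x 3) (x 4) (x 0) (x 1) * W (x 1) (x 5) (x 2) (x 3))]
    refine Finset.sum_congr rfl fun x _ => ?_
    dsimp
    rw [h.antisymm_right (x 0) (x 3) (x 5) (x 4),
      h.antisymm_right (x 1) (x 4) (x 3) (x 2)]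
    ring
  have r5 : ∑ x : Fin 6 → Fin n, W (x 1) (x 2) (x 4) (x 5) * (W (x 3) (x 4) (x 0) (x 1) *
      W (x 0) (x 5) (x 2) (x 3)) = -T := by
    rw [hT, ← sum_rename ![1, 0, 2, 3, 4, 5] (by decide) fun x =>
      W (x 0) (x 2) (x 4) (x 5) * (W (x 3) (x 4) (x 0) (x 1) *
          W (x 1) (x 5) (x 2) (x 3)), ← Finset.sum_neg_distrib]
    refine Finset.sum_congr rfl fun x _ => ?_
    dsimp
    rw [h.antisymm_right (x 3) (x 4) (x 1) (x 0)]
    ring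
  have r6 : ∑ x : Fin 6 → Fin n, W (x 1) (x 2) (x 4) (x 5) * (W (x 3) (x 5) (x 0) (x 1) *
      W (x 0) (x 4) (x 2) (x 3)) = T := by
    rw [hT, ← sum_rename ![1, 0, 2, 3, 5, 4] (by decide) fun x =>
      W (x 0) (x 2) (x 4) (x 5) * (W (x 3) (x 4) (x 0) (x 1) * W (x 1) (x 5) (x 2) (x 3))]
    refine Finset.sum_congr rfl fun x _ => ?_
    dsimp
    rw [h.antisymm_right (x 1) (x 2) (x 5) (x 4),
      h.antisymm_right (x 3) (x 5) (x 1) (x 0)]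
    ring
  have r7 : ∑ x : Fin 6 → Fin n, W (x 1) (x 3) (x 4) (x 5) * (W (x 2) (x 4) (x 0) (x 1) *
      W (x 0) (x 5) (x 2) (x 3)) = T := by
    rw [hT, ← sum_rename ![1, 0, 3, 2, 4, 5] (by decide) fun x =>
      W (x 0) (x 2) (x 4) (x 5) * (W (x 3) (x 4) (x 0) (x 1) * W (x 1) (x 5) (x 2) (x 3))]
    refine Finset.sum_congr rfl fun x _ => ?_
    dsimp
    rw [h.antisymm_right (x 2) (x 4) (x 1) (x 0),
      h.antisymm_right (x 0) (x 5) (x 3) (x 2)]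
    ring
  have r8 : ∑ x : Fin 6 → Fin n, W (x 1) (x 3) (x 4) (x 5) * (W (x 2) (x 5) (x 0) (x 1) *
      W (x 0) (x 4) (x 2) (x 3)) = -T := by
    rw [hT, ← sum_rename ![1, 0, 3, 2, 5, 4] (by decide) fun x =>
      W (x 0) (x 2) (x 4) (x 5) * (W (x 3) (x 4) (x 0) (x 1) *
          W (x 1) (x 5) (x 2) (x 3)), ← Finset.sum_neg_distrib]
    refine Finset.sum_congr rfl fun x _ => ?_
    dsimp
    rw [h.antisymm_right (x 1) (x 3) (x 5) (x 4),
      h.antisymm_right (x 2) (x 5) (x 1) (x 0),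
      h.antisymm_right (x 0) (x 4) (x 3) (x 2)]
    ring
  have hA₁ : ∑ x : Fin 6 → Fin n, W (x 0) (x 1) (x 4) (x 5) * (W (x 2) (x 3) (x 0) (x 1) *
      W (x 4) (x 5) (x 2) (x 3)) =
      cubicA W := by
    rw [cubicA, ← sum_rename ![0, 1, 4, 5, 2, 3] (by decide)]
    exact Finset.sum_congr rfl fun x _ => by dsimp; ring
  have hA₂ : ∑ x : Fin 6 → Fin n, W (x 2) (x 3) (x 4) (x 5) * (W (x 4) (x 5) (x 0) (x 1) *
      W (x 0) (x 1) (x 2) (x 3)) =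
      cubicA W := by
    rw [cubicA, ← sum_rename ![2, 3, 4, 5, 0, 1] (by decide)]
    exact Finset.sum_congr rfl fun x _ => by dsimp; ring
  have e1 := sum_rename (n := n) ![0, 2, 4, 5, 1, 3] (by decide) fun x =>
    W (x 0) (x 1) (x 2) (x 3) * W (x 0) (x 4) (x 2) (x 5) * W (x 1) (x 4) (x 3) (x 5)
  have e2 := sum_rename (n := n) ![0, 1, 5, 3, 4, 2] (by decide) fun x =>
    W (x 0) (x 2) (x 4) (x 5) * (W (x 0) (x 1) (x 4) (x 3) * W (x 2) (x 5) (x 3) (x 1))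
  have e3 := sum_rename (n := n) ![0, 3, 2, 1, 4, 5] (by decide) fun x =>
    W (x 0) (x 4) (x 2) (x 5) * (W (x 0) (x 1) (x 4) (x 3) * W (x 2) (x 5) (x 3) (x 1))
  have e4 := sum_rename (n := n) ![0, 4, 2, 5, 1, 3] (by decide) fun x =>
    W (x 0) (x 1) (x 2) (x 3) * W (x 0) (x 1) (x 4) (x 5) * W (x 2) (x 3) (x 4) (x 5)
  rw [h.cubicA_eq] at e4
  rw [← cubicB] at e1
  dsimp at e1 e2 e3 e4
  have d1 : T = ∑ x : Fin 6 → Fin n, W (x 0) (x 2) (x 4) (x 5) * W (x 0) (x 1) (x 4) (x 3) *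
      W (x 2) (x 1) (x 5) (x 3) +
      ∑ x : Fin 6 → Fin n, W (x 0) (x 2) (x 4) (x 5) * (W (x 0) (x 1) (x 4) (x 3) *
          W (x 2) (x 5) (x 3) (x 1)) := by
    rw [hT, ← Finset.sum_add_distrib]
    refine Finset.sum_congr rfl fun x _ => ?_
    rw [h.pair (x 3) (x 4) (x 0) (x 1), h.antisymm_right (x 0) (x 1) (x 3) (x 4), h.pair (x 1)
        (x 5) (x 2) (x 3)]
    linear_combination -(W (x 0) (x 2) (x 4) (x 5) * W (x 0) (x 1) (x 4) (x 3)) *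
      h.bianchi (x 2) (x 3) (x 1) (x 5)
  have d2 : ∑ x : Fin 6 → Fin n, W (x 0) (x 2) (x 4) (x 5) * (W (x 0) (x 1) (x 4) (x 3) *
      W (x 2) (x 5) (x 3) (x 1)) +
      ∑ x : Fin 6 → Fin n, W (x 0) (x 5) (x 4) (x 2) * (W (x 0) (x 1) (x 4) (x 3) *
          W (x 5) (x 2) (x 3) (x 1)) =
      ∑ x : Fin 6 → Fin n, W (x 0) (x 4) (x 2) (x 5) * (W (x 0) (x 1) (x 4) (x 3) *
          W (x 2) (x 5) (x 3) (x 1)) := by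
    rw [← Finset.sum_add_distrib]
    refine Finset.sum_congr rfl fun x _ => ?_
    rw [h.antisymm (x 5) (x 2) (x 3) (x 1)]
    linear_combination (W (x 0) (x 1) (x 4) (x 3) * W (x 2) (x 5) (x 3) (x 1)) * h.sub_even (x 0)
        (x 2) (x 4) (x 5)
  have d3 : ∑ x : Fin 6 → Fin n, W (x 0) (x 4) (x 2) (x 5) * (W (x 0) (x 1) (x 4) (x 3) *
      W (x 2) (x 5) (x 3) (x 1)) +
      ∑ x : Fin 6 → Fin n, W (x 0) (x 4) (x 2) (x 5) * (W (x 0) (x 3) (x 4) (x 1) *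
          W (x 2) (x 5) (x 1) (x 3)) =
      -∑ x : Fin 6 → Fin n, W (x 0) (x 4) (x 2) (x 5) * W (x 0) (x 4) (x 1) (x 3) *
          W (x 2) (x 5) (x 1) (x 3) := by
    rw [← Finset.sum_add_distrib, ← Finset.sum_neg_distrib]
    refine Finset.sum_congr rfl fun x _ => ?_
    rw [h.antisymm_right (x 2) (x 5) (x 3) (x 1)]
    linear_combination -(W (x 0) (x 4) (x 2) (x 5) * W (x 2) (x 5) (x 1) (x 3)) * h.sub_even (x 0)
        (x 1) (x 4) (x 3)
  linarith

end IsWeylTensor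

/-! ### Bounds for single eigenvalues of the Weyl part -/

/-- The quartic contraction `P_{il} P_{jk} Q_{ik} Q_{jl}`; for symmetric `P` and `Q` it is the trace
of `P Q P Q`. -/
def quartic {n : ℕ} (P Q : Fin n → Fin n → ℝ) : ℝ :=
  ∑ x : Fin 4 → Fin n, (P (x 0) (x 3) * P (x 1) (x 2)) * (Q (x 0) (x 2) * Q (x 1) (x 3))

/-- The Cauchy-Schwarz inequality for `W` and the test tensor
`Y_{ijkl} = ∑ₐ cₐ (P^a_{il} P^a_{jk} - P^a_{ik} P^a_{jl})`. -/
lemma IsCurvatureTensor.sq_sum_le {n m : ℕ} {W : Fin n → Fin n → Fin n → Fin n → ℝ}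
    (hW : IsCurvatureTensor W) (c : Fin m → ℝ) (P : Fin m → Fin n → Fin n → ℝ) :
    (∑ a, c a * ∑ x : Fin 4 → Fin n, W (x 0) (x 1) (x 2) (x 3) *
      (P a (x 0) (x 3) * P a (x 1) (x 2))) ^ 2 ≤
    normSq W / 2 * ∑ a, ∑ b, c a * c b *
      ((∑ i, ∑ j, P a i j * P b i j) ^ 2 - quartic (P a) (P b)) := by
  set Z : (Fin 4 → Fin n) → ℝ := fun x => ∑ a, c a * (P a (x 0) (x 3) * P a (x 1) (x 2)) with hZ
  set Z' : (Fin 4 → Fin n) → ℝ := fun x => ∑ a, c a * (P a (x 0) (x 2) * P a (x 1) (x 3)) with hZ'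
  set L := ∑ a, c a * ∑ x : Fin 4 → Fin n, W (x 0) (x 1) (x 2) (x 3) *
      (P a (x 0) (x 3) * P a (x 1) (x 2)) with hL
  have h1 : ∑ x : Fin 4 → Fin n, W (x 0) (x 1) (x 2) (x 3) * Z x = L := by
    simp only [hZ, hL, Finset.mul_sum]
    rw [Finset.sum_comm]
    exact Finset.sum_congr rfl fun a _ => Finset.sum_congr rfl fun x _ => by ring
  have h2 : ∑ x : Fin 4 → Fin n, W (x 0) (x 1) (x 2) (x 3) * Z' x = -L := by
    rw [← h1, ← Finset.sum_neg_distrib, ← sum_rename ![0, 1, 3, 2] (by decide)]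
    refine Finset.sum_congr rfl fun x _ => ?_
    simp only [hZ, hZ']
    dsimp
    rw [hW.antisymm_right (x 0) (x 1) (x 3) (x 2)]
    ring
  have h3 : ∑ x, Z x ^ 2 = ∑ a, ∑ b, c a * c b * (∑ i, ∑ j, P a i j * P b i j) ^ 2 := by
    simp only [hZ, sq, Finset.sum_mul_sum]
    rw [Finset.sum_comm]
    refine Finset.sum_congr rfl fun a _ => ?_
    rw [Finset.sum_comm]
    refine Finset.sum_congr rfl fun b _ => ?_
    rw [← sum_rename ![0, 1, 3, 2] (by decide), sum_fun_four]
    simp only [Finset.mul_sum]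
    refine Finset.sum_congr rfl fun i _ => Finset.sum_congr rfl fun j _ =>
      Finset.sum_congr rfl fun k _ => Finset.sum_congr rfl fun l _ => ?_
    dsimp
    ring
  have h4 : ∑ x, Z' x ^ 2 = ∑ x, Z x ^ 2 := by
    rw [← sum_rename ![0, 1, 3, 2] (by decide)]
    rfl
  have h5 : ∑ x, Z x * Z' x = ∑ a, ∑ b, c a * c b * quartic (P a) (P b) := by
    simp only [hZ, hZ', Finset.sum_mul_sum, quartic]
    simp only [Finset.mul_sum]
    rw [Finset.sum_comm]
    refine Finset.sum_congr rfl fun a _ => ?_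
    rw [Finset.sum_comm]
    exact Finset.sum_congr rfl fun b _ => Finset.sum_congr rfl fun x _ => by ring
  have hcs := Finset.sum_mul_sq_le_sq_mul_sq (Finset.univ : Finset (Fin 4 → Fin n))
    (fun x => W (x 0) (x 1) (x 2) (x 3)) (fun x => Z x - Z' x)
  have h6 : ∑ x : Fin 4 → Fin n, (Z x - Z' x) ^ 2 =
      2 * ∑ x, Z x ^ 2 - 2 * ∑ x, Z x * Z' x := by
    simp only [sub_sq, Finset.sum_add_distrib, Finset.sum_sub_distrib, h4, mul_assoc,
      ← Finset.mul_sum]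
    ring
  simp only [mul_sub, Finset.sum_sub_distrib, h1, h2, h6, h3, h5] at hcs ⊢
  rw [← normSq] at hcs
  linarith

/-- The quadratic form of the quartic contraction is nonnegative on coefficients of equal sign:
it equals `|x A² - y B²|² + x y |A B + B A|²`. -/
lemma quartic_form_nonneg {n : ℕ} {A B : Fin n → Fin n → ℝ} (hA : ∀ i j, A i j = A j i)
    (hB : ∀ i j, B i j = B j i) {x y : ℝ} (hxy : 0 ≤ x * y) :
    0 ≤ x ^ 2 * quartic A A + 2 * (x * y) * quartic A B + y ^ 2 * quartic B B := by
  set M : Matrix (Fin n) (Fin n) ℝ := Matrix.of A with hM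
  set K : Matrix (Fin n) (Fin n) ℝ := Matrix.of B with hK
  have hq : ∀ P Q : Fin n → Fin n → ℝ, (∀ i j, P i j = P j i) → (∀ i j, Q i j = Q j i) →
      quartic P Q = (Matrix.of P * Matrix.of Q * (Matrix.of P * Matrix.of Q)).trace := by
    intro P Q hP hQ
    rw [quartic, ← sum_rename ![0, 1, 3, 2] (by decide), sum_fun_four, Matrix.trace]
    refine Finset.sum_congr rfl fun i _ => ?_
    rw [Matrix.diag_apply, Matrix.mul_apply]
    refine Finset.sum_congr rfl fun j _ => ?_
    rw [Matrix.mul_apply, Matrix.mul_apply, Finset.sum_mul_sum]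
    refine Finset.sum_congr rfl fun k _ => Finset.sum_congr rfl fun l _ => ?_
    simp only [Matrix.of_apply, Matrix.cons_val]
    rw [hQ k j, hQ l i]
    ring
  have hMt : M.transpose = M := by ext i j; exact hA j i
  have hKt : K.transpose = K := by ext i j; exact hB j i
  have hpos : ∀ X : Matrix (Fin n) (Fin n) ℝ, X.transpose = X → 0 ≤ (X * X).trace := by
    intro X hX
    have := (Matrix.posSemidef_conjTranspose_mul_self X).trace_nonneg
    rwa [Matrix.conjTranspose_eq_transpose_of_trivial, hX] at this
  have h1 := hpos (x • (M * M) - y • (K * K)) (by simp [Matrix.transpose_mul, hMt, hKt])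
  have h2 := hpos (M * K + K * M) (by simp [Matrix.transpose_mul, hMt, hKt, add_comm])
  have c1 : (K * M * (K * M)).trace = (M * K * (M * K)).trace := by
    rw [Matrix.mul_assoc, Matrix.trace_mul_comm]
    simp only [Matrix.mul_assoc]
  have c2 : (K * M * (M * K)).trace = (M * M * (K * K)).trace := by
    rw [Matrix.mul_assoc, Matrix.trace_mul_comm]
    simp only [Matrix.mul_assoc]
  have c3 : (M * K * (K * M)).trace = (M * M * (K * K)).trace := by
    rw [← Matrix.mul_assoc, Matrix.trace_mul_comm]
    simp only [Matrix.mul_assoc]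
  have c4 : (K * K * (M * M)).trace = (M * M * (K * K)).trace := Matrix.trace_mul_comm _ _
  rw [hq A A hA hA, hq A B hA hB, hq B B hB hB, ← hM, ← hK]
  simp only [mul_add, add_mul, sub_mul, mul_sub, Matrix.trace_add, Matrix.trace_sub,
    Matrix.smul_mul, Matrix.mul_smul, Matrix.trace_smul, smul_eq_mul, c1, c2, c3, c4] at h1 h2
  nlinarith [mul_nonneg hxy h2]

/-- The quartic contraction of a symmetric unit two-tensor is at least `1 / n`. -/
lemma one_div_le_quartic_self {n : ℕ} {A : Fin n → Fin n → ℝ} (hA : ∀ i j, A i j = A j i)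
    (h₁ : ∑ i, ∑ j, A i j ^ 2 = 1) : 1 / (n : ℝ) ≤ quartic A A := by
  have h2 : ∑ i, (∑ j, A i j ^ 2) ^ 2 ≤ quartic A A := by
    have e : quartic A A = ∑ i, ∑ j, (∑ k, A i k * A j k) ^ 2 := by
      rw [quartic, ← sum_rename ![0, 1, 3, 2] (by decide), sum_fun_four]
      refine Finset.sum_congr rfl fun i _ => Finset.sum_congr rfl fun j _ => ?_
      rw [sq, Finset.sum_mul_sum]
      refine Finset.sum_congr rfl fun k _ => Finset.sum_congr rfl fun l _ => ?_
      dsimp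
      ring
    rw [e]
    refine Finset.sum_le_sum fun i _ => ?_
    simp only [sq (A i _)]
    exact Finset.single_le_sum (f := fun j => (∑ k, A i k * A j k) ^ 2)
      (fun j _ => sq_nonneg _) (Finset.mem_univ i)
  have h3 := sq_sum_le_card_mul_sum_sq (s := (Finset.univ : Finset (Fin n)))
    (f := fun i => ∑ j, A i j ^ 2)
  rw [h₁] at h3
  simp only [Finset.card_univ, Fintype.card_fin] at h3
  rcases Nat.eq_zero_or_pos n with rfl | hn
  · simp at h₁
  · rw [div_le_iff₀ (by positivity)]
    nlinarith

namespace IsEigenframe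

variable {n N : ℕ} {W : Fin n → Fin n → Fin n → Fin n → ℝ}
  {φ : Fin N → Fin n → Fin n → ℝ} {μ : Fin N → ℝ}

/-- The metric in components with respect to an orthonormal basis. -/
def _root_.SecondKind.delta (n : ℕ) (i j : Fin n) : ℝ := if i = j then 1 else 0

lemma sum_mul_self (hφ : IsEigenframe W φ μ) (a : Fin N) :
    ∑ x : Fin 4 → Fin n, W (x 0) (x 1) (x 2) (x 3) * (φ a (x 0) (x 3) * φ a (x 1) (x 2)) =
      μ a := by
  have : μ a = ∑ i, ∑ j, μ a * φ a i j * φ a i j := by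
    simp only [mul_assoc, ← Finset.mul_sum, ← sq, hφ.sum_sq, mul_one]
  rw [this, ← sum_rename ![0, 2, 3, 1] (by decide), sum_fun_four]
  refine Finset.sum_congr rfl fun i _ => Finset.sum_congr rfl fun j _ => ?_
  rw [← hφ.eigen, Finset.sum_mul]
  refine Finset.sum_congr rfl fun k _ => ?_
  rw [Finset.sum_mul]
  exact Finset.sum_congr rfl fun l _ => by dsimp; ring

lemma _root_.SecondKind.IsWeylTensor.sum_mul_one (hW : IsWeylTensor W) :
    ∑ x : Fin 4 → Fin n, W (x 0) (x 1) (x 2) (x 3) *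
      (delta n (x 0) (x 3) * delta n (x 1) (x 2)) =
      0 := by
  rw [sum_fun_four]
  simp only [Matrix.cons_val]
  simp only [delta, mul_ite, mul_one, mul_zero, Finset.sum_ite_irrel, Finset.sum_const_zero,
    Finset.sum_ite_eq, Finset.mem_univ, if_true, hW.trace₂₃]

lemma quartic_one (hφ : IsEigenframe W φ μ) (a : Fin N) :
    quartic (φ a) (delta n) = 1 := by
  rw [quartic, sum_fun_four, ← hφ.sum_sq a]
  simp only [Matrix.cons_val]
  simp only [delta, sq, mul_ite, mul_one, mul_zero, Finset.sum_ite_eq, Finset.mem_univ, if_true]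
  exact Finset.sum_congr rfl fun i _ => Finset.sum_congr rfl fun j _ => by rw [hφ.symm a j i]

lemma _root_.SecondKind.quartic_comm {n : ℕ} (P Q : Fin n → Fin n → ℝ) :
    quartic P Q = quartic Q P := by
  rw [quartic, ← sum_rename ![0, 1, 3, 2] (by decide)]
  exact Finset.sum_congr rfl fun x _ => by dsimp; ring

lemma _root_.SecondKind.quartic_one_one {n : ℕ} :
    quartic (delta n) (delta n) = n := by
  rw [quartic, sum_fun_four]
  simp only [Matrix.cons_val]
  simp only [delta, mul_ite, mul_one, mul_zero, Finset.sum_ite_eq, Finset.sum_ite_eq',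
    Finset.mem_univ, if_true, Finset.sum_const, Finset.card_univ, Fintype.card_fin, nsmul_eq_mul]

lemma sum_mul_one (hφ : IsEigenframe W φ μ) (a : Fin N) :
    ∑ i, ∑ j, φ a i j * delta n i j = 0 := by
  simp [delta, hφ.trace]

lemma _root_.SecondKind.sum_one_mul_one {n : ℕ} :
    ∑ i, ∑ j, delta n i j * delta n i j = n := by
  simp [delta]

/-- A bound for two eigenvalues, from the test tensor built from the two eigentensors and a multiple
of the metric. -/
lemma sq_add_le (hφ : IsEigenframe W φ μ) (hW : IsWeylTensor W) (hn : 2 ≤ n) {a b : Fin N}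
    (hab : a ≠ b) {x y : ℝ} (hxy : 0 ≤ x * y) :
    (x * μ a + y * μ b) ^ 2 ≤ 2 / 3 * (∑ a, μ a ^ 2) *
      (x ^ 2 + y ^ 2 - (x + y) ^ 2 / (n * (n - 1))) := by
  have hn' : (2 : ℝ) ≤ n := by exact_mod_cast hn
  have h := hW.sq_sum_le ![x, y, (x + y) / (n * (n - 1))]
    ![φ a, φ b, delta n]
  simp only [Fin.sum_univ_three, Matrix.cons_val, hφ.sum_mul_self, hW.sum_mul_one] at h
  have o1 : ∀ a, ∑ i, ∑ j, delta n i j * φ a i j = 0 := by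
    intro a
    simpa only [mul_comm] using hφ.sum_mul_one a
  -- The coefficient of the metric makes the full trace of the test tensor vanish.
  simp only [hφ.orthonormal, if_pos, if_neg hab, if_neg hab.symm, hφ.sum_mul_one, o1,
    quartic_comm (delta n) (φ _), hφ.quartic_one, quartic_one_one, sum_one_mul_one,
        quartic_comm (φ b) (φ a)] at h
  have hq := quartic_form_nonneg (hφ.symm a) (hφ.symm b) hxy
  rw [hφ.sum_eigenvalue_sq hW]
  have hN : 0 ≤ normSq W := by
    rw [normSq]
    positivity
  refine le_trans (le_of_eq_of_le ?_ h) ?_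
  · ring
  have : 2 / 3 * (3 / 4 * normSq W) = normSq W / 2 := by ring
  rw [this]
  refine mul_le_mul_of_nonneg_left ?_ (by positivity)
  have : (n : ℝ) - 1 ≠ 0 := by linarith
  have : (n : ℝ) ≠ 0 := by linarith
  have e : (x + y) ^ 2 / (n * (n - 1)) =
      2 * ((x + y) / (n * (n - 1))) * (x + y) -
      ((x + y) / (n * (n - 1))) ^ 2 * (n ^ 2 - n) := by
    field_simp
    ring
  rw [e]
  nlinarith

/-- A bound for a single eigenvalue; it is better than `sq_add_le` with `y = 0`, as it uses that the
quartic trace is at least `1 / n`. -/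
lemma sq_le (hφ : IsEigenframe W φ μ) (hW : IsWeylTensor W) (hn : 2 ≤ n) (a : Fin N) :
    μ a ^ 2 ≤ 2 / 3 * ((n - 2) / (n - 1)) * ∑ a, μ a ^ 2 := by
  have hn' : (2 : ℝ) ≤ n := by exact_mod_cast hn
  have h := hW.sq_sum_le ![1, 1 / (n * (n - 1) : ℝ)]
    ![φ a, delta n]
  simp only [Fin.sum_univ_two, Matrix.cons_val, hφ.sum_mul_self, hW.sum_mul_one] at h
  have o1 : ∀ a, ∑ i, ∑ j, delta n i j * φ a i j = 0 := by
    intro a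
    simpa only [mul_comm] using hφ.sum_mul_one a
  simp only [hφ.orthonormal, if_pos, hφ.sum_mul_one, o1,
    quartic_comm (delta n) (φ _), hφ.quartic_one, quartic_one_one, sum_one_mul_one] at h
  have hq := one_div_le_quartic_self (hφ.symm a) (hφ.sum_sq a)
  rw [hφ.sum_eigenvalue_sq hW]
  have hN : 0 ≤ normSq W := by
    rw [normSq]
    positivity
  refine le_trans (le_of_eq_of_le ?_ h) ?_
  · ring
  have : 2 / 3 * (((n : ℝ) - 2) / (n - 1)) * (3 / 4 * normSq W) =
      normSq W / 2 * ((n - 2) / (n - 1)) := by ring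
  rw [this]
  refine mul_le_mul_of_nonneg_left ?_ (by positivity)
  have : (n : ℝ) - 1 ≠ 0 := by linarith
  have : (n : ℝ) ≠ 0 := by linarith
  have e : ((n : ℝ) - 2) / (n - 1) =
      1 - 1 / n - 2 * (1 / (n * (n - 1))) + (1 / (n * (n - 1))) ^ 2 * (n ^ 2 - n) := by
    field_simp
    ring
  rw [e]
  nlinarith

end IsEigenframe

/-! ### Inequalities for power sums of ordered real numbers -/

section PowerSums

variable {N : ℕ} {μ : Fin N → ℝ} {a b : Fin N}

/-- If the sum of numbers vanishes and their two smallest members `x ≤ y` satisfy `x + y ≥ -2 s`,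
then the sum of cubes is at least `-2 s` times the sum of squares. For `y ≥ 0` this is a comparison
of `m³ - (x + y) m²` with its tangent at `y`. -/
lemma sum_cube_add_nonneg (h₀ : ∑ c, μ c = 0) (hx : μ a ≤ μ b)
    (hy : ∀ c, c ≠ a → μ b ≤ μ c) {s : ℝ} (hs : -2 * s ≤ μ a + μ b) :
    0 ≤ ∑ c, μ c ^ 3 + 2 * s * ∑ c, μ c ^ 2 ∧
      (∑ c, μ c ^ 3 + 2 * s * ∑ c, μ c ^ 2 = 0 → ∃ y, ∀ c, c ≠ a → μ c = y) := by
  have hle : ∀ c, μ a ≤ μ c := fun c => by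
    by_cases h : c = a
    · rw [h]
    · exact hx.trans (hy c h)
  rcases lt_or_ge (μ b) 0 with hb | hb
  · have e : ∑ c, μ c ^ 3 + 2 * s * ∑ c, μ c ^ 2 = ∑ c, μ c ^ 2 * (μ c + 2 * s) := by
      rw [Finset.mul_sum, ← Finset.sum_add_distrib]
      exact Finset.sum_congr rfl fun c _ => by ring
    have hp : ∀ c, 0 < μ c + 2 * s := fun c => by linarith [hle c]
    have hnn : ∀ c ∈ Finset.univ, 0 ≤ μ c ^ 2 * (μ c + 2 * s) := fun c _ =>
      mul_nonneg (sq_nonneg _) (hp c).le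
    rw [e]
    refine ⟨Finset.sum_nonneg hnn, fun h => ⟨0, fun c _ => ?_⟩⟩
    have := (Finset.sum_eq_zero_iff_of_nonneg hnn).1 h c (Finset.mem_univ c)
    rcases mul_eq_zero.1 this with h | h
    · exact pow_eq_zero_iff two_ne_zero |>.1 h
    · exact absurd h (hp c).ne'
  · set x := μ a with hxdef
    set y := μ b with hydef
    set t : Fin N → ℝ := fun c => (μ c - y) ^ 2 * (μ c + y - x) with ht
    have hN : (N : ℝ) = ∑ _c : Fin N, (1 : ℝ) := by simp
    have e : ∑ c, μ c ^ 3 - (x + y) * ∑ c, μ c ^ 2 = ∑ c, t c + N * (y ^ 2 * (x - y)) := by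
      have : ∀ c, t c = μ c ^ 3 - (x + y) * μ c ^ 2 + (2 * x * y - y ^ 2) * μ c
          + y ^ 2 * (y - x) * 1 := fun c => by
        simp only [ht]
        ring
      simp only [this, Finset.sum_add_distrib, Finset.sum_sub_distrib, ← Finset.mul_sum, h₀, ← hN]
      ring
    have htn : ∀ c, 0 ≤ t c := fun c =>
      mul_nonneg (sq_nonneg _) (by linarith [hle c])
    have hN0 : x + (N - 1) * y ≤ 0 := by
      rw [← h₀, ← Finset.add_sum_erase _ _ (Finset.mem_univ a), ← hxdef]
      have : ∑ c ∈ Finset.univ.erase a, y ≤ ∑ c ∈ Finset.univ.erase a, μ c :=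
        Finset.sum_le_sum fun c hc => hy c (Finset.ne_of_mem_erase hc)
      rw [Finset.sum_const, Finset.card_erase_of_mem (Finset.mem_univ a), Finset.card_univ,
        Fintype.card_fin, nsmul_eq_mul, Nat.cast_sub (by have := a.2; omega)] at this
      push_cast at this
      linarith
    have hta : t a + N * (y ^ 2 * (x - y)) = y * ((x - y) * (x + (N - 1) * y)) := by
      simp only [ht, ← hxdef]
      ring
    have hpos : 0 ≤ y * ((x - y) * (x + (N - 1) * y)) :=
      mul_nonneg hb (mul_nonneg_of_nonpos_of_nonpos (by linarith) hN0)
    have hE : 0 ≤ (2 * s + (x + y)) * ∑ c, μ c ^ 2 :=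
      mul_nonneg (by linarith) (Finset.sum_nonneg fun c _ => sq_nonneg _)
    rw [← Finset.add_sum_erase _ t (Finset.mem_univ a)] at e
    have hrest : 0 ≤ ∑ c ∈ Finset.univ.erase a, t c := Finset.sum_nonneg fun c _ => htn c
    refine ⟨by linarith, fun h => ⟨y, fun c hc => ?_⟩⟩
    have hz : ∑ c ∈ Finset.univ.erase a, t c = 0 := by linarith
    have := (Finset.sum_eq_zero_iff_of_nonneg fun c _ => htn c).1 hz c
      (Finset.mem_erase.2 ⟨hc, Finset.mem_univ c⟩)
    rcases mul_eq_zero.1 this with h | h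
    · linarith [pow_eq_zero_iff two_ne_zero |>.1 h]
    · linarith [hy c hc]

/-- Numbers with vanishing sum, the two smallest of which have nonnegative sum, all vanish. -/
lemma eq_zero_of_add_nonneg (hab : a ≠ b) (hN : 3 ≤ N) (h₀ : ∑ c, μ c = 0) (hx : μ a ≤ μ b)
    (hy : ∀ c, c ≠ a → μ b ≤ μ c) (hs : 0 ≤ μ a + μ b) (c : Fin N) : μ c = 0 := by
  rw [← Finset.add_sum_erase _ _ (Finset.mem_univ a), ← Finset.add_sum_erase _ _
    (Finset.mem_erase.2 ⟨hab.symm, Finset.mem_univ b⟩)] at h₀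
  have hb : 0 ≤ μ b := by linarith
  have hnn : ∀ c ∈ (Finset.univ.erase a).erase b, 0 ≤ μ c := fun c hc =>
    hb.trans (hy c (Finset.ne_of_mem_erase (Finset.mem_of_mem_erase hc)))
  have h1 := Finset.sum_nonneg hnn
  have hz := (Finset.sum_eq_zero_iff_of_nonneg hnn).1 (by linarith)
  obtain ⟨d, hd⟩ : ((Finset.univ.erase a).erase b : Finset (Fin N)).Nonempty := by
    rw [← Finset.card_pos, Finset.card_erase_of_mem (Finset.mem_erase.2 ⟨hab.symm,
        Finset.mem_univ b⟩),
      Finset.card_erase_of_mem (Finset.mem_univ a), Finset.card_univ, Fintype.card_fin]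
    omega
  have hb0 : μ b = 0 :=
    le_antisymm (hz d hd ▸ hy d (Finset.ne_of_mem_erase (Finset.mem_of_mem_erase hd))) hb
  by_cases h : c = a
  · rw [h]
    linarith
  by_cases h' : c = b
  · rw [h', hb0]
  exact hz c (Finset.mem_erase.2 ⟨h', Finset.mem_erase.2 ⟨h, Finset.mem_univ c⟩⟩)

/-- The sum of cubes is nonnegative if all numbers but one are nonnegative and the square of the
exceptional one is at most half of the sum of squares. -/
lemma sum_cube_nonneg (h₀ : ∑ c, μ c = 0) (hb : ∀ c, c ≠ a → 0 ≤ μ c)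
    (h : μ a ^ 2 ≤ 1 / 2 * ∑ c, μ c ^ 2) : 0 ≤ ∑ c, μ c ^ 3 := by
  have hcs : (∑ c ∈ Finset.univ.erase a, μ c ^ 2) ^ 2 ≤
      (∑ c ∈ Finset.univ.erase a, μ c) * ∑ c ∈ Finset.univ.erase a, μ c ^ 3 :=
    Finset.sum_sq_le_sum_mul_sum_of_sq_le_mul _ (fun c hc => hb c (Finset.ne_of_mem_erase hc))
      (fun c hc => pow_nonneg (hb c (Finset.ne_of_mem_erase hc)) 3) fun c _ => le_of_eq (by ring)
  have h3 : 0 ≤ ∑ c ∈ Finset.univ.erase a, μ c ^ 3 :=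
    Finset.sum_nonneg fun c hc => pow_nonneg (hb c (Finset.ne_of_mem_erase hc)) 3
  have h1 : 0 ≤ ∑ c ∈ Finset.univ.erase a, μ c :=
    Finset.sum_nonneg fun c hc => hb c (Finset.ne_of_mem_erase hc)
  rw [← Finset.add_sum_erase _ _ (Finset.mem_univ a)] at h₀ h ⊢
  set p := ∑ c ∈ Finset.univ.erase a, μ c
  set q := ∑ c ∈ Finset.univ.erase a, μ c ^ 2
  set r := ∑ c ∈ Finset.univ.erase a, μ c ^ 3
  have hp : μ a = -p := by linarith
  rw [hp] at h ⊢
  have hq : p ^ 2 ≤ q := by linarith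
  rcases eq_or_lt_of_le h1 with h1 | h1
  · rw [← h1]
    linarith
  · have : p ^ 2 * p ^ 2 ≤ p * r := le_trans (by nlinarith [sq_nonneg p]) hcs
    have : p ^ 3 ≤ r := le_of_mul_le_mul_left (by linarith [pow_succ p 3]) h1
    linarith [Odd.neg_pow (by decide : Odd 3) p]

/-- A lower bound for the sum of cubes when the two smallest numbers are negative: sum the
inequalities `(m - y) (m - z)² ≥ 0` over the remaining numbers `m`, where `y` is the second
smallest. The parameter `z` is free and is best taken near the average of the remaining ones. -/
lemma le_sum_cube (hab : a ≠ b) (h₀ : ∑ c, μ c = 0)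
    (hy : ∀ c, c ≠ a → μ b ≤ μ c) (z : ℝ) :
    μ a ^ 3 + μ b ^ 3 + (μ b + 2 * z) * (∑ c, μ c ^ 2 - μ a ^ 2 - μ b ^ 2)
      + (z ^ 2 + 2 * μ b * z) * (μ a + μ b) + (N - 2) * (μ b * z ^ 2) ≤ ∑ c, μ c ^ 3 := by
  have hb : b ∈ Finset.univ.erase a := Finset.mem_erase.2 ⟨hab.symm, Finset.mem_univ b⟩
  have hc : ((((Finset.univ : Finset (Fin N)).erase a).erase b).card : ℝ) = N - 2 := by
    have h2 : 2 ≤ N := by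
      have h1 := a.2
      have h2 := b.2
      have h3 : (a : ℕ) ≠ b := fun h => hab (Fin.ext h)
      omega
    rw [Finset.card_erase_of_mem hb, Finset.card_erase_of_mem (Finset.mem_univ a),
      Finset.card_univ, Fintype.card_fin, Nat.sub_sub, Nat.cast_sub h2]
    norm_num
  have hs : 0 ≤ ∑ c ∈ (Finset.univ.erase a).erase b, (μ c - μ b) * (μ c - z) ^ 2 :=
    Finset.sum_nonneg fun c hc => mul_nonneg (sub_nonneg.2
      (hy c (Finset.ne_of_mem_erase (Finset.mem_of_mem_erase hc)))) (sq_nonneg _)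
  have e : ∀ c, (μ c - μ b) * (μ c - z) ^ 2 = μ c ^ 3 - (μ b + 2 * z) * μ c ^ 2
      + (z ^ 2 + 2 * μ b * z) * μ c - μ b * z ^ 2 := fun c => by ring
  simp only [e, Finset.sum_add_distrib, Finset.sum_sub_distrib, ← Finset.mul_sum,
    Finset.sum_const, nsmul_eq_mul, hc] at hs
  rw [← Finset.add_sum_erase _ _ (Finset.mem_univ a), ← Finset.add_sum_erase _ _ hb] at h₀
  rw [← Finset.add_sum_erase _ _ (Finset.mem_univ a), ← Finset.add_sum_erase _ _ hb,
    ← Finset.add_sum_erase _ (fun c => μ c ^ 3) (Finset.mem_univ a),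
    ← Finset.add_sum_erase _ (fun c => μ c ^ 3) hb]
  have : ∑ c ∈ (Finset.univ.erase a).erase b, μ c = -(μ a + μ b) := by linarith
  rw [this] at hs
  linarith

/-- The numerical inequality behind the estimate in dimension four. The two smallest eigenvalues are
`-X ≤ -Y < 0`, the squares of the others have sum `E`, the hypotheses are the bounds `sq_add_le` and
`sq_le`, and the quantity comes from `le_sum_cube` with `z = (X + Y) / 5` and `N - 2 = 7`. -/
lemma four_pos {X Y E : ℝ} (hY : 0 < Y) (hXY : Y ≤ X)
    (h₁ : (X ^ 2 + Y ^ 2) ^ 2 ≤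
      2 / 3 * (X ^ 2 + Y ^ 2 + E) * (X ^ 2 + Y ^ 2 - (X + Y) ^ 2 / 12))
    (h₂ : X ^ 2 ≤ 4 / 9 * (X ^ 2 + Y ^ 2 + E)) :
    0 < 1 / 3 * (X + Y) * (X ^ 2 + Y ^ 2 + E) - X ^ 3 - Y ^ 3
      + (2 * (1 / 5 * (X + Y)) - Y) * E
      + ((1 / 5 * (X + Y)) ^ 2 - 2 * Y * (1 / 5 * (X + Y))) * (-(X + Y))
      - 7 * (Y * (1 / 5 * (X + Y)) ^ 2) := by
  -- By homogeneity the inequality is one in `d` and `e`, where `X, Y = r (1 ± d)`, `E = r² e`.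
  obtain ⟨r, hr⟩ : ∃ r, r = (X + Y) / 2 := ⟨_, rfl⟩
  have hr0 : 0 < r := by linarith
  obtain ⟨d, hd⟩ : ∃ d, X = r * (1 + d) := ⟨X / r - 1, by field_simp; ring⟩
  obtain ⟨e, he⟩ : ∃ e, E = r ^ 2 * e := ⟨E / r ^ 2, by field_simp⟩
  have hYd : Y = r * (1 - d) := by linarith
  subst hd he hYd
  have hd0 : 0 ≤ d := by
    by_contra! h
    nlinarith
  have hd1 : d < 1 := by
    by_contra! h
    nlinarith
  clear hY hXY hr
  have h₁' : (2 + 2 * d ^ 2) ^ 2 ≤ 2 / 3 * (2 + 2 * d ^ 2 + e) * (2 + 2 * d ^ 2 - 1 / 3) := by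
    refine le_of_mul_le_mul_left ?_ (pow_pos hr0 4)
    linarith
  have h₂' : (1 + d) ^ 2 ≤ 4 / 9 * (2 + 2 * d ^ 2 + e) := by
    refine le_of_mul_le_mul_left ?_ (pow_pos hr0 2)
    linarith
  have h3 : 8 / 5 ≤ e := by
    by_contra! h
    nlinarith [sq_nonneg d, mul_nonneg (sq_nonneg d) (sq_nonneg d)]
  have key : 0 < 2 / 3 * (2 + 2 * d ^ 2) - 2 - 6 * d ^ 2 + (7 / 15 + d) * e
      - (4 / 25 - 4 / 5 * (1 - d)) * 2 - 28 / 25 * (1 - d) := by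
    rcases le_total d (3 / 10) with h | h
    · nlinarith
    · have h4 : 1 / 4 + 9 / 2 * d + 1 / 4 * d ^ 2 ≤ e := by linarith
      nlinarith [mul_le_mul_of_nonneg_left h4 (by linarith : 0 ≤ 7 / 15 + d),
          pow_pos (lt_of_lt_of_le (by norm_num) h : 0 < d) 3]
  have := mul_pos (pow_pos hr0 3) key
  linarith

/-- The analogue of `four_pos` in dimension five, with `z = 27 (X + Y) / 200` and `N - 2 = 12`. -/
lemma five_pos {X Y E : ℝ} (hY : 0 < Y) (hXY : Y ≤ X)
    (h₁ : (X ^ 2 + Y ^ 2) ^ 2 ≤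
      2 / 3 * (X ^ 2 + Y ^ 2 + E) * (X ^ 2 + Y ^ 2 - (X + Y) ^ 2 / 20))
    (h₂ : X ^ 2 ≤ 1 / 2 * (X ^ 2 + Y ^ 2 + E)) :
    0 < 2 / 5 * (X + Y) * (X ^ 2 + Y ^ 2 + E) - X ^ 3 - Y ^ 3
      + (2 * (27 / 200 * (X + Y)) - Y) * E
      + ((27 / 200 * (X + Y)) ^ 2 - 2 * Y * (27 / 200 * (X + Y))) * (-(X + Y))
      - 12 * (Y * (27 / 200 * (X + Y)) ^ 2) := by
  -- By homogeneity the inequality is one in `d` and `e`, where `X, Y = r (1 ± d)`, `E = r² e`.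
  obtain ⟨r, hr⟩ : ∃ r, r = (X + Y) / 2 := ⟨_, rfl⟩
  have hr0 : 0 < r := by linarith
  obtain ⟨d, hd⟩ : ∃ d, X = r * (1 + d) := ⟨X / r - 1, by field_simp; ring⟩
  obtain ⟨e, he⟩ : ∃ e, E = r ^ 2 * e := ⟨E / r ^ 2, by field_simp⟩
  have hYd : Y = r * (1 - d) := by linarith
  subst hd he hYd
  have hd0 : 0 ≤ d := by
    by_contra! h
    nlinarith
  have hd1 : d < 1 := by
    by_contra! h
    nlinarith
  clear hY hXY hr
  have h₁' : (2 + 2 * d ^ 2) ^ 2 ≤ 2 / 3 * (2 + 2 * d ^ 2 + e) * (2 + 2 * d ^ 2 - 1 / 5) := by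
    refine le_of_mul_le_mul_left ?_ (pow_pos hr0 4)
    linarith
  have h₂' : (1 + d) ^ 2 ≤ 1 / 2 * (2 + 2 * d ^ 2 + e) := by
    refine le_of_mul_le_mul_left ?_ (pow_pos hr0 2)
    linarith
  have h3 : 4 / 3 + 9 / 10 * d ^ 2 ≤ e := by
    by_contra! h
    have h5 : (2 + 2 * d ^ 2 + e) * (2 + 2 * d ^ 2 - 1 / 5) ≤
        (2 + 2 * d ^ 2 + (4 / 3 + 9 / 10 * d ^ 2)) * (2 + 2 * d ^ 2 - 1 / 5) :=
      mul_le_mul_of_nonneg_right (by linarith) (by nlinarith [sq_nonneg d])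
    have h6 : 2 + 2 * d ^ 2 + e < 2 + 2 * d ^ 2 + (4 / 3 + 9 / 10 * d ^ 2) := by linarith
    have h7 := mul_lt_mul_of_pos_right h6 (by nlinarith [sq_nonneg d] : 0 < 2 + 2 * d ^ 2 - 1 / 5)
    nlinarith [sq_nonneg d, mul_nonneg (sq_nonneg d) (sq_nonneg d)]
  have key : 0 < 4 / 5 * (2 + 2 * d ^ 2) - 2 - 6 * d ^ 2 + (17 / 50 + d) * e
      - (729 / 10000 - 27 / 50 * (1 - d)) * 2 - 12 * (729 / 10000) * (1 - d) := by
    rcases le_total d (7 / 20) with h | h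
    · have h5 := mul_le_mul_of_nonneg_left h3 (by linarith : 0 ≤ 17 / 50 + d)
      have h6 := pow_nonneg hd0 3
      nlinarith
    · have h4 : 4 * d ≤ e := by linarith
      have h5 := mul_le_mul_of_nonneg_left h4 (by linarith : 0 ≤ 17 / 50 + d)
      nlinarith
  have := mul_pos (pow_pos hr0 3) key
  linarith

end PowerSums

/-! ### The algebraic form of the theorem -/

lemma cast_secondKindDim {n : ℕ} (hn : n ≠ 0) :
    (secondKindDim n : ℝ) = n * (n + 1) / 2 - 1 := by
  obtain ⟨m, rfl⟩ := Nat.exists_eq_succ_of_ne_zero hn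
  have h : 2 ∣ m * (m + 3) := by
    rcases Nat.even_or_odd m with h | h
    · exact h.two_dvd.mul_right _
    · exact (h.add_odd (by decide : Odd 3)).two_dvd.mul_left _
  have e : secondKindDim (m + 1) = m * (m + 3) / 2 := rfl
  rw [Nat.succ_eq_add_one, e, Nat.cast_div h (by norm_num)]
  push_cast
  ring

namespace IsEigenframe

variable {n N : ℕ} {W : Fin n → Fin n → Fin n → Fin n → ℝ}
  {φ : Fin N → Fin n → Fin n → ℝ} {μ : Fin N → ℝ} {a b : Fin N}

/-- All eigenvalues but one being equal is only possible for the zero tensor, by the bound for a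
single eigenvalue. -/
lemma eq_zero_of_forall_ne_eq (hφ : IsEigenframe W φ μ) (hW : IsWeylTensor W) (hn : 4 ≤ n) {y : ℝ}
    (h : ∀ c, c ≠ a → μ c = y) (c : Fin N) : μ c = 0 := by
  have hn' : (4 : ℝ) ≤ n := by exact_mod_cast hn
  have hN := hφ.card_eq (by omega : n ≠ 0)
  have h0 := hφ.sum_eigenvalue hW
  have h2 := hφ.sq_le hW (by omega) a
  have hc : (((Finset.univ : Finset (Fin N)).erase a).card : ℝ) = N - 1 := by
    have := a.2
    rw [Finset.card_erase_of_mem (Finset.mem_univ a), Finset.card_univ, Fintype.card_fin,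
      Nat.cast_sub (by omega)]
    norm_num
  rw [← Finset.add_sum_erase _ _ (Finset.mem_univ a), Finset.sum_congr rfl fun c hc =>
    h c (Finset.ne_of_mem_erase hc), Finset.sum_const, nsmul_eq_mul, hc] at h0
  rw [← Finset.add_sum_erase _ _ (Finset.mem_univ a), Finset.sum_congr rfl fun c hc =>
    congrArg (· ^ 2) (h c (Finset.ne_of_mem_erase hc)), Finset.sum_const, nsmul_eq_mul, hc] at h2
  have hx : μ a = -((N - 1) * y) := by linarith
  rw [hx] at h2
  have hN1 : (9 : ℝ) ≤ N := by
    rw [hN]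
    nlinarith
  have hq : ((n : ℝ) - 2) / (n - 1) ≤ 1 := by
    rw [div_le_one (by linarith)]
    linarith
  have h3 : (-((N - 1) * y)) ^ 2 ≤ 2 / 3 * ((-((N - 1) * y)) ^ 2 + (N - 1) * y ^ 2) := by
    refine h2.trans (mul_le_mul_of_nonneg_right (by linarith) ?_)
    have : (0 : ℝ) ≤ N - 1 := by linarith
    positivity
  have hy : y = 0 := by
    by_contra hy
    have hy2 : 0 < ((N : ℝ) - 1) * y ^ 2 := mul_pos (by linarith) (by positivity)
    nlinarith [mul_pos hy2 (by linarith : (0 : ℝ) < N - 3)]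
  by_cases hca : c = a
  · rw [hca, hx, hy]
    ring
  · rw [h c hca, hy]

/-- The estimate in dimension at least eight: three times the cubic form is
`∑ μ_c |φ_c · W|² + 16 ∑ μ_c³ + 6 (n - 1) l |W|²`. The first sum is at least `-s` times its total
weight, since no weight exceeds half of the total, and the second is estimated by
`sum_cube_add_nonneg`. The number `s` is chosen such that the three bounds add up to zero. -/
lemma nonneg_of_eight_le (hφ : IsEigenframe W φ μ) (hW : IsWeylTensor W) (hn : 8 ≤ n)
    (hx : μ a ≤ μ b) (hy : ∀ c, c ≠ a → μ b ≤ μ c) {l s : ℝ}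
    (hsl : 2 * (N + 6 * n - 3) * s = 3 * n * (n - 1) * l) (hs : -2 * s ≤ μ a + μ b) :
    0 ≤ 2 * (n - 1) * l * normSq W - cubicA W - 4 * cubicB W ∧
      (2 * (n - 1) * l * normSq W - cubicA W - 4 * cubicB W = 0 → ∀ c, μ c = 0) := by
  have hn' : (8 : ℝ) ≤ n := by exact_mod_cast hn
  have hN := hφ.card_eq (by omega : n ≠ 0)
  have h0 := hφ.sum_eigenvalue hW
  have h2 := hφ.sum_eigenvalue_sq hW
  have h3 := hφ.sum_eigenvalue_cube hW
  have h4 := hφ.sum_eigenvalue_mul_actionSq hW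
  have h5 := hφ.sum_actionSq hW (by omega)
  have hW0 : 0 ≤ normSq W := by
    rw [normSq]
    positivity
  obtain ⟨hF, hF'⟩ := sum_cube_add_nonneg h0 hx hy hs
  set T := ∑ c, actionSq W (φ c) with hT
  have hT0 : 0 ≤ T := Finset.sum_nonneg fun c _ => hW.toIsCurvatureTensor.actionSq_nonneg (φ c)
  -- This is where `8 ≤ n` enters.
  have hwa : actionSq W (φ a) ≤ T / 2 := by
    refine (hW.toIsCurvatureTensor.actionSq_le (hφ.sum_sq a)).trans ?_
    rw [h5, hN]
    have : (16 : ℝ) ≤ (4 * (n * (n + 1) / 2 - 1) - 12) / n := by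
      rw [le_div_iff₀ (by linarith)]
      nlinarith
    nlinarith
  have hw : -s * T ≤ ∑ c, μ c * actionSq W (φ c) := by
    have e1 : μ b * T - (μ b - μ a) * actionSq W (φ a) ≤ ∑ c, μ c * actionSq W (φ c) := by
      have : ∑ c, (μ c - μ b) * actionSq W (φ c) ≥ (μ a - μ b) * actionSq W (φ a) := by
        rw [← Finset.add_sum_erase _ _ (Finset.mem_univ a)]
        have := Finset.sum_nonneg (s := Finset.univ.erase a)
          (f := fun c => (μ c - μ b) * actionSq W (φ c)) fun c hc =>
            mul_nonneg (sub_nonneg.2 (hy c (Finset.ne_of_mem_erase hc)))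
              (hW.toIsCurvatureTensor.actionSq_nonneg (φ c))
        linarith
      simp only [sub_mul, Finset.sum_sub_distrib, ← Finset.mul_sum] at this
      linarith
    nlinarith [mul_le_mul_of_nonneg_left hwa (sub_nonneg.2 hx)]
  have key : s * T + 32 * s * (3 / 4 * normSq W) = 6 * (n - 1) * l * normSq W := by
    have hn0 : (n : ℝ) ≠ 0 := by linarith
    have : s * T + 32 * s * (3 / 4 * normSq W) =
        (2 * (N + 6 * n - 3) * s) * (2 / n * normSq W) := by
      rw [h5]
      field_simp
      ring
    rw [this, hsl]
    field_simp
    ring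
  rw [h2] at hF hF'
  rw [h3] at hF hF'
  refine ⟨by linarith, fun h => ?_⟩
  obtain ⟨y, hy⟩ := hF' (by linarith)
  exact hφ.eq_zero_of_forall_ne_eq hW (by omega) hy

/-- Positivity of the combination of power sums that the cubic form amounts to in dimension four,
where the two cubic invariants are proportional. -/
lemma pos_of_four (hφ : IsEigenframe W φ μ) (hW : IsWeylTensor W) (hn : n = 4)
    (hab : a ≠ b) (hx : μ a ≤ μ b) (hy : ∀ c, c ≠ a → μ b ≤ μ c) {l : ℝ} (hl : 0 < l)
    (hs : -3 * l ≤ μ a + μ b) (hE : 0 < ∑ c, μ c ^ 2) :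
    0 < l * ∑ c, μ c ^ 2 + ∑ c, μ c ^ 3 := by
  have hN := hφ.card_eq (by omega : n ≠ 0)
  have h0 := hφ.sum_eigenvalue hW
  have h1 := hφ.sq_le hW (by omega) a
  subst hn
  norm_num at hN h1
  rcases le_or_gt 0 (μ b) with hb | hb
  · have := sum_cube_nonneg h0 (fun c hc => hb.trans (hy c hc)) (by linarith)
    positivity
  · have h2 := hφ.sq_add_le hW (by norm_num) hab
      (mul_nonneg_of_nonpos_of_nonpos (hx.trans hb.le) hb.le)
    have h3 := le_sum_cube hab h0 hy (-(1 / 5 * (μ a + μ b)))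
    norm_num at h2
    have := four_pos (neg_pos.2 hb) (neg_le_neg hx) (E := ∑ c, μ c ^ 2 - μ a ^ 2 - μ b ^ 2)
      (by ring_nf at h2 ⊢; linarith) (by ring_nf at h1 ⊢; linarith)
    rw [hN] at h3
    have h4 : 1 / 3 * (-(μ a + μ b)) * ∑ c, μ c ^ 2 ≤ l * ∑ c, μ c ^ 2 :=
      mul_le_mul_of_nonneg_right (by linarith) hE.le
    ring_nf at this h3 h4 ⊢
    linarith

/-- The analogue of `pos_of_four` in dimension five. -/
lemma pos_of_five (hφ : IsEigenframe W φ μ) (hW : IsWeylTensor W) (hn : n = 5)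
    (hab : a ≠ b) (hx : μ a ≤ μ b) (hy : ∀ c, c ≠ a → μ b ≤ μ c) {l : ℝ} (hl : 0 < l)
    (hs : -(10 / 3) * l ≤ μ a + μ b) (hE : 0 < ∑ c, μ c ^ 2) :
    0 < 4 / 3 * l * ∑ c, μ c ^ 2 + ∑ c, μ c ^ 3 := by
  have hN := hφ.card_eq (by omega : n ≠ 0)
  have h0 := hφ.sum_eigenvalue hW
  have h1 := hφ.sq_le hW (by omega) a
  subst hn
  norm_num at hN h1
  rcases le_or_gt 0 (μ b) with hb | hb
  · have := sum_cube_nonneg h0 (fun c hc => hb.trans (hy c hc)) (by linarith)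
    positivity
  · have h2 := hφ.sq_add_le hW (by norm_num) hab
      (mul_nonneg_of_nonpos_of_nonpos (hx.trans hb.le) hb.le)
    have h3 := le_sum_cube hab h0 hy (-(27 / 200 * (μ a + μ b)))
    norm_num at h2
    have := five_pos (neg_pos.2 hb) (neg_le_neg hx) (E := ∑ c, μ c ^ 2 - μ a ^ 2 - μ b ^ 2)
      (by ring_nf at h2 ⊢; linarith) (by ring_nf at h1 ⊢; linarith)
    rw [hN] at h3
    have h4 : 2 / 5 * (-(μ a + μ b)) * ∑ c, μ c ^ 2 ≤ 4 / 3 * l * ∑ c, μ c ^ 2 :=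
      mul_le_mul_of_nonneg_right (by linarith) hE.le
    ring_nf at this h3 h4 ⊢
    linarith

/-- The sign of the cubic form that `⟨ΔR, R⟩` amounts to, under the cone condition. -/
lemma nonneg_of_cone (hφ : IsEigenframe W φ μ) (hW : IsWeylTensor W)
    (hn : n = 4 ∨ n = 5 ∨ 8 ≤ n)
    (hab : a ≠ b) (hx : μ a ≤ μ b) (hy : ∀ c, c ≠ a → μ b ≤ μ c) {l : ℝ}
    (hs : -2 * (1 + coneConstant n) * l ≤ μ a + μ b) :
    0 ≤ 2 * (n - 1) * l * normSq W - cubicA W - 4 * cubicB W ∧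
      (2 * (n - 1) * l * normSq W - cubicA W - 4 * cubicB W = 0 → ∀ c, μ c = 0) := by
  by_cases h8 : 8 ≤ n
  · have hn' : (8 : ℝ) ≤ n := by exact_mod_cast h8
    have hN := hφ.card_eq (by omega : n ≠ 0)
    refine hφ.nonneg_of_eight_le hW h8 hx hy (s := (1 + coneConstant n) * l) ?_ (by linarith)
    have h : (n : ℝ) * (n + 1) / 2 - 1 + 6 * n - 3 ≠ 0 := by nlinarith
    rw [coneConstant, if_neg (by omega), if_neg (by omega), hN, cast_secondKindDim (by omega)]
    have e : ∀ u v : ℝ, v ≠ 0 → 2 * v * ((1 + u / v) * l) = 2 * (v + u) * l := by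
      intro u v hv
      field_simp
    rw [e _ _ h]
    ring
  have hn5 : n ≤ 5 := by omega
  have hn4 : 4 ≤ n := by omega
  have h0 := hφ.sum_eigenvalue hW
  have h2 := hφ.sum_eigenvalue_sq hW
  have h3 := hφ.sum_eigenvalue_cube hW
  have hAB := hW.cubicA_eq_two_mul_cubicB hn5
  have hN := hφ.card_eq (by omega : n ≠ 0)
  have e : 2 * (n - 1) * l * normSq W - cubicA W - 4 * cubicB W =
      8 * ((n - 1) / 3 * l * ∑ c, μ c ^ 2 + ∑ c, μ c ^ 3) := by
    rw [h2, h3]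
    linarith
  have hE : 0 ≤ ∑ c, μ c ^ 2 := Finset.sum_nonneg fun c _ => sq_nonneg _
  have hzero : ∑ c, μ c ^ 2 = 0 → ∀ c, μ c = 0 := fun h c => by
    have := (Finset.sum_eq_zero_iff_of_nonneg fun c _ => sq_nonneg (μ c)).1 h c (Finset.mem_univ c)
    exact pow_eq_zero_iff two_ne_zero |>.1 this
  rw [e]
  by_cases hE0 : ∑ c, μ c ^ 2 = 0
  · have := hzero hE0
    simp [this]
  have hE' := lt_of_le_of_ne hE (Ne.symm hE0)
  have hcc : 0 ≤ 1 + coneConstant n := by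
    rcases hn with rfl | rfl | h
    · norm_num [coneConstant]
    · norm_num [coneConstant]
    · omega
  -- For `l ≤ 0` the cone condition forces all eigenvalues to vanish.
  have hl : 0 < l := by
    by_contra! hl
    refine hE0 (Finset.sum_eq_zero fun c _ => ?_)
    have hN3 : 3 ≤ N := by
      have hn' : (4 : ℝ) ≤ n := by exact_mod_cast hn4
      have : (3 : ℝ) ≤ N := by
        rw [hN]
        nlinarith
      exact_mod_cast this
    rw [eq_zero_of_add_nonneg hab hN3 h0 hx hy (by nlinarith) c]
    norm_num
  suffices h : 0 < ((n : ℝ) - 1) / 3 * l * ∑ c, μ c ^ 2 + ∑ c, μ c ^ 3 from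
    ⟨by positivity, fun h' => by linarith⟩
  rcases hn with h | h | h
  · have h' : ((n : ℝ) - 1) / 3 * l = l := by
      rw [h]
      norm_num
    rw [h']
    refine hφ.pos_of_four hW h hab hx hy hl (le_of_eq_of_le ?_ hs) hE'
    rw [h, coneConstant, if_pos rfl]
    ring
  · have h' : ((n : ℝ) - 1) / 3 * l = 4 / 3 * l := by
      rw [h]
      norm_num
    rw [h']
    refine hφ.pos_of_five hW h hab hx hy hl (le_of_eq_of_le ?_ hs) hE'
    rw [h, coneConstant, if_neg (by norm_num), if_pos rfl]
    ring
  · omega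

end IsEigenframe

/-! ### Eigentensors of the curvature operator of the second kind -/

variable {n : ℕ}

/-- The inner product `⟨φ, ψ⟩ = ∑ φᵢⱼ ψᵢⱼ` on traceless symmetric two-tensors. -/
@[reducible]
def tracelessSymCore (n : ℕ) : InnerProductSpace.Core ℝ (tracelessSym n) where
  inner φ ψ := ∑ i, ∑ j, φ.1 i j * ψ.1 i j
  conj_inner_symm φ ψ := by simp [mul_comm]
  re_inner_nonneg φ := by
    simp only [RCLike.re_to_real]
    exact Finset.sum_nonneg fun i _ => Finset.sum_nonneg fun j _ => mul_self_nonneg _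
  add_left φ ψ χ := by
    simp [add_mul, Finset.sum_add_distrib]
  smul_left φ ψ c := by
    simp [Finset.mul_sum, mul_assoc]
  definite φ h := by
    have h1 := (Finset.sum_eq_zero_iff_of_nonneg fun i _ =>
      Finset.sum_nonneg fun j _ => mul_self_nonneg (φ.1 i j)).1 h
    apply Subtype.ext
    ext i j
    have h2 := (Finset.sum_eq_zero_iff_of_nonneg fun j _ => mul_self_nonneg (φ.1 i j)).1
      (h1 i (Finset.mem_univ i)) j (Finset.mem_univ j)
    exact mul_self_eq_zero.1 h2

/-- The spectral theorem on `S²₀`, with eigenvalues in increasing order. -/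
lemma exists_eigenbasis (T : tracelessSym n →ₗ[ℝ] tracelessSym n)
    (hT : ∀ φ ψ, ∑ i, ∑ j, (T φ).1 i j * ψ.1 i j = ∑ i, ∑ j, φ.1 i j * (T ψ).1 i j) :
    ∃ (N : ℕ) (φ : Fin N → tracelessSym n) (ν : Fin N → ℝ), Monotone ν ∧
      (∀ a b, ∑ i, ∑ j, (φ a).1 i j * (φ b).1 i j = if a = b then 1 else 0) ∧
      (∀ v : tracelessSym n, v = ∑ a, (∑ i, ∑ j, (φ a).1 i j * v.1 i j) • φ a) ∧
      (∀ a, T (φ a) = ν a • φ a) ∧ T.charpoly.roots.sort (· ≤ ·) = List.ofFn ν := by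
  let : NormedAddCommGroup (tracelessSym n) :=
    @InnerProductSpace.Core.toNormedAddCommGroup ℝ _ _ _ _ (tracelessSymCore n)
  let : InnerProductSpace ℝ (tracelessSym n) :=
    InnerProductSpace.ofCore (tracelessSymCore n).toCore
  have hin : ∀ φ ψ : tracelessSym n, inner ℝ φ ψ = ∑ i, ∑ j, φ.1 i j * ψ.1 i j := fun _ _ => rfl
  have hs : T.IsSymmetric := fun φ ψ => hT φ ψ
  have hr : Monotone fun a => hs.eigenvalues rfl (Fin.rev a) := fun a b h =>
    hs.eigenvalues_antitone rfl (Fin.rev_le_rev.2 h)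
  refine ⟨_, fun a => hs.eigenvectorBasis rfl (Fin.rev a), fun a => hs.eigenvalues rfl (Fin.rev a),
    hr, fun a b => ?_, fun v => ?_, fun a => ?_, ?_⟩
  · rw [← hin, orthonormal_iff_ite.1 (hs.eigenvectorBasis rfl).orthonormal]
    simp
  · conv_lhs => rw [← (hs.eigenvectorBasis rfl).sum_repr' v]
    exact (Equiv.sum_comp Fin.revPerm fun a =>
      inner ℝ (hs.eigenvectorBasis rfl a) v • hs.eigenvectorBasis rfl a).symm
  · exact hs.apply_eigenvectorBasis rfl _
  · have h1 : T.charpoly.roots =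
      (List.ofFn fun a => hs.eigenvalues rfl (Fin.rev a) : Multiset ℝ) := by
      rw [hs.roots_charpoly_eq_eigenvalues rfl, ← Fin.univ_val_map]
      conv_lhs => rw [← Multiset.map_univ_val_equiv Fin.revPerm, Multiset.map_map]
      rfl
    rw [h1, Multiset.coe_sort]
    refine List.mergeSort_of_pairwise ?_
    simp_rw [decide_eq_true_eq, ← List.sortedLE_iff_pairwise]
    exact hr.sortedLE_ofFn

lemma sum_mul_traceless {φ : tracelessSym n} (k l : Fin n) :
    ∑ i, ∑ j, φ.1 i j * (tracelessProj n (Matrix.single k l 1)).1 i j = φ.1 k l := by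
  have hs : ∀ i j, φ.1 i j = φ.1 j i := fun i j => φ.2.1.apply j i
  have ht : ∑ i, φ.1 i i = 0 := φ.2.2
  have e : ∀ i j, φ.1 i j * (tracelessProj n (Matrix.single k l 1)).1 i j =
      1 / 2 * (if k = i ∧ l = j then φ.1 i j else 0) + 1 / 2 * (if k = j ∧ l =
          i then φ.1 i j else 0)
        - (Matrix.single k l (1 : ℝ)).trace / n * (if i = j then φ.1 i j else 0) := by
    intro i j
    simp only [tracelessProj, LinearMap.coe_mk, AddHom.coe_mk, Matrix.sub_apply, Matrix.smul_apply,
      Matrix.add_apply, Matrix.transpose_apply, Matrix.single_apply, Matrix.one_apply, smul_eq_mul]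
    split_ifs <;> ring
  simp only [e, Finset.sum_add_distrib, Finset.sum_sub_distrib, ← Finset.mul_sum, ite_and,
    Finset.sum_ite_irrel, Finset.sum_const_zero, Finset.sum_ite_eq, Finset.mem_univ, if_true, ht]
  rw [hs l k]
  ring

lemma tracelessProj_of_mem {φ : Matrix (Fin n) (Fin n) ℝ} (h : φ ∈ tracelessSym n) :
    tracelessProj n φ = ⟨φ, h⟩ := by
  apply Subtype.ext
  change (1 / 2 : ℝ) • (φ + φ.transpose) - (φ.trace / n) • (1 : Matrix (Fin n) (Fin n) ℝ) = φ
  rw [h.1.eq, h.2, ← two_smul ℝ φ, smul_smul]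
  norm_num

section Einstein

variable {R : (Fin 4 → Fin n) → ℝ} {ρ : ℝ}

/-- The operator `R̄` of an Einstein curvature tensor preserves `S²₀`. -/
lemma barOperator_mem (hR : IsCurvatureTensor fun i j k l => R ![i, j, k, l])
    (hric : ∀ i k, ∑ j, R ![i, j, k, j] = ρ * delta n i k) (φ : tracelessSym n) :
    barOperator R φ.1 ∈ tracelessSym n := by
  have hs : ∀ i j, φ.1 i j = φ.1 j i := fun i j => φ.2.1.apply j i
  constructor
  · ext i j
    change ∑ k, ∑ l, R ![j, k, l, i] * φ.1 k l = ∑ k, ∑ l, R ![i, k, l, j] * φ.1 k l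
    rw [Finset.sum_comm]
    refine Finset.sum_congr rfl fun k _ => Finset.sum_congr rfl fun l _ => ?_
    rw [hs l k]
    congr 1
    have h1 := hR.antisymm j l k i
    have h2 := hR.pair l j k i
    have h3 := hR.antisymm k i l j
    linarith
  · change ∑ i, ∑ k, ∑ l, R ![i, k, l, i] * φ.1 k l = 0
    have h1 : ∀ i k l, R ![i, k, l, i] * φ.1 k l = -(R ![k, i, l, i] * φ.1 k l) := by
      intro i k l
      have := hR.antisymm i k l i
      rw [this]
      ring
    simp only [h1, Finset.sum_neg_distrib]
    rw [Finset.sum_comm]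
    have h2 : ∀ k, ∑ i, ∑ l, R ![k, i, l, i] * φ.1 k l = ρ * φ.1 k k := by
      intro k
      rw [Finset.sum_comm]
      simp only [← Finset.sum_mul, hric, delta]
      simp
    simp only [h2, ← Finset.mul_sum]
    have ht : ∑ i, φ.1 i i = 0 := φ.2.2
    rw [ht]
    simp

lemma secondKindOperator_apply (hR : IsCurvatureTensor fun i j k l => R ![i, j, k, l])
    (hric : ∀ i k, ∑ j, R ![i, j, k, j] = ρ * delta n i k) (φ : tracelessSym n) (i j : Fin n) :
    (secondKindOperator R φ).1 i j = ∑ k, ∑ l, R ![i, k, l, j] * φ.1 k l := by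
  change (tracelessProj n (barOperator R φ.1)).1 i j = _
  rw [tracelessProj_of_mem (barOperator_mem hR hric φ)]
  rfl

/-- The Weyl part of an Einstein curvature tensor with Ricci curvature `(n - 1) m`. -/
def weylPart (R : (Fin 4 → Fin n) → ℝ) (m : ℝ) (i j k l : Fin n) : ℝ :=
  R ![i, j, k, l] - m * (delta n i k * delta n j l - delta n i l * delta n j k)

lemma delta_comm (i j : Fin n) : delta n i j = delta n j i := by
  simp only [delta, eq_comm]

lemma sum_delta_mul (i : Fin n) (f : Fin n → ℝ) : ∑ j, delta n i j * f j = f i := by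
  simp [delta]

lemma isWeylTensor_weylPart (hR : IsCurvatureTensor fun i j k l => R ![i, j, k, l]) {m : ℝ}
    (hric : ∀ i k, ∑ j, R ![i, j, k, j] = (n - 1) * m * delta n i k) :
    IsWeylTensor (weylPart R m) where
  antisymm i j k l := by
    have := hR.antisymm i j k l
    simp only [weylPart] at this ⊢
    rw [this]
    ring
  pair i j k l := by
    have := hR.pair i j k l
    simp only [weylPart] at this ⊢
    rw [this, delta_comm i k, delta_comm j l, delta_comm i l, delta_comm j k]
    ring
  bianchi i j k l := by
    have := hR.bianchi i j k l
    simp only [weylPart] at this ⊢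
    rw [delta_comm k j, delta_comm l j, delta_comm l k]
    linarith
  trace i k := by
    have h2 : ∑ j, delta n j j = n := by simp [delta]
    have h3 : ∑ j, delta n i j * delta n j k = delta n i k := sum_delta_mul i _
    simp only [weylPart, Finset.sum_sub_distrib, ← Finset.mul_sum, hric, h2, h3]
    ring

/-- The eigenvalues of the curvature operator of the second kind of an Einstein curvature tensor,
with their mean subtracted, belong to an eigenframe of the Weyl part. -/
lemma exists_isEigenframe (hn : 2 ≤ n) (hR : IsCurvatureTensor fun i j k l => R ![i, j, k, l])
    (hric : ∀ i k, ∑ j, R ![i, j, k, j] = ρ * delta n i k) :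
    IsWeylTensor (weylPart R (secondKindMean R)) ∧ ρ = (n - 1) * secondKindMean R ∧
    (Monotone fun a : Fin (secondKindDim n) => secondKindEigenvalue R a) ∧
    ∃ φ : Fin (secondKindDim n) → Fin n → Fin n → ℝ, IsEigenframe (weylPart R (secondKindMean R)) φ
      fun a => secondKindEigenvalue R a - secondKindMean R := by
  have hn' : (2 : ℝ) ≤ n := by exact_mod_cast hn
  set m : ℝ := ρ / (n - 1) with hm
  have hρ : ρ = (n - 1) * m := by
    rw [hm]
    field_simp [(by linarith : (n : ℝ) - 1 ≠ 0)]
  have hW := isWeylTensor_weylPart hR (m := m) (by rw [← hρ]; exact hric)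
  obtain ⟨N, φ, ν, hν, ho, hsp, hT, hroots⟩ := exists_eigenbasis (secondKindOperator R) (by
    intro φ ψ
    simp only [secondKindOperator_apply hR hric, Finset.sum_mul, Finset.mul_sum]
    have h1 : ∀ i j, ∑ k, ∑ l, R ![i, k, l, j] * φ.1 k l * ψ.1 i j =
        ∑ k, ∑ l, φ.1 k l * (R ![k, i, j, l] * ψ.1 i j) := by
      intro i j
      refine Finset.sum_congr rfl fun k _ => Finset.sum_congr rfl fun l _ => ?_
      have h1 := hR.antisymm i k l j
      have h2 := hR.antisymm_right k i l j
      rw [h1, h2]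
      ring
    simp only [h1]
    have e := sum_rename ![2, 3, 0, 1] (by decide) fun x : Fin 4 → Fin n =>
      φ.1 (x 0) (x 1) * (R ![x 0, x 2, x 3, x 1] * ψ.1 (x 2) (x 3))
    rw [sum_fun_four, sum_fun_four] at e
    exact e)
  have hs : ∀ a i j, (φ a).1 i j = (φ a).1 j i := fun a i j => (φ a).2.1.apply j i
  have ht : ∀ a, ∑ i, (φ a).1 i i = 0 := fun a => (φ a).2.2
  have hφ : IsEigenframe (weylPart R m) (fun a => (φ a).1) fun a => ν a - m :=
    { symm := hs
      trace := ht
      orthonormal := ho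
      complete := fun i j k l => by
        have h := congrArg (fun v : tracelessSym n => v.1 i j)
          (hsp (tracelessProj n (Matrix.single k l 1)))
        simp only [sum_mul_traceless] at h
        rw [Submodule.coe_sum, Matrix.sum_apply] at h
        simp only [Submodule.coe_smul, Matrix.smul_apply, smul_eq_mul] at h
        rw [Finset.sum_congr rfl fun a _ => mul_comm _ _, ← h]
        simp only [tracelessProj, LinearMap.coe_mk, AddHom.coe_mk, Matrix.sub_apply,
          Matrix.smul_apply, Matrix.add_apply, Matrix.transpose_apply, Matrix.single_apply,
          Matrix.one_apply, smul_eq_mul]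
        have h1 : (Matrix.single k l (1 : ℝ)).trace = if k = l then 1 else 0 := by
          by_cases hkl : k = l
          · rw [hkl, Matrix.trace_single_eq_same, if_pos rfl]
          · rw [Matrix.trace_single_eq_of_ne _ _ _ hkl, if_neg hkl]
        have h2 : ∀ a b c d : Fin n, (if a = b ∧ c = d then (1 : ℝ) else 0) =
            (if b = a then 1 else 0) * if d = c then 1 else 0 := by
          intro a b c d
          by_cases h3 : a = b
          · simp [h3, eq_comm]
          · simp [h3, Ne.symm h3]
        rw [h1, h2, h2]
        ring
      eigen := fun a i j => by
        have h := congrArg (fun v : tracelessSym n => v.1 i j) (hT a)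
        simp only [secondKindOperator_apply hR hric, Submodule.coe_smul, Matrix.smul_apply,
          smul_eq_mul] at h
        have h1 : ∑ k, ∑ l, delta n i l * delta n k j * (φ a).1 k l = (φ a).1 i j := by
          rw [Finset.sum_comm, hs a i j]
          simp only [mul_assoc, ← Finset.mul_sum]
          rw [sum_delta_mul]
          simp only [delta_comm _ j]
          rw [sum_delta_mul]
        have h2 : ∑ k, ∑ l, delta n i j * delta n k l * (φ a).1 k l = 0 := by
          simp only [mul_assoc, ← Finset.mul_sum, sum_delta_mul, ht, mul_zero]
        simp only [weylPart, sub_mul, mul_sub, Finset.sum_sub_distrib, h, mul_assoc m,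
          ← Finset.mul_sum, h1, h2]
        ring }
  have hNn : N = secondKindDim n := by
    have h1 := hφ.card_eq (by omega)
    rw [← cast_secondKindDim (by omega)] at h1
    exact_mod_cast h1
  subst hNn
  have hν' : ∀ a : Fin (secondKindDim n), secondKindEigenvalue R a = ν a := by
    intro a
    rw [secondKindEigenvalue, hroots, List.getD_eq_getElem _ _ (by simp)]
    simp
  have hmean : secondKindMean R = m := by
    have h1 := hφ.sum_eigenvalue hW
    have hN0 : (secondKindDim n : ℝ) ≠ 0 := by
      rw [cast_secondKindDim (by omega)]
      nlinarith
    rw [secondKindMean, Finset.sum_range fun j => secondKindEigenvalue R j, div_eq_iff hN0]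
    simp only [hν', Finset.sum_sub_distrib, Finset.sum_const, Finset.card_univ, Fintype.card_fin,
      nsmul_eq_mul] at h1 ⊢
    linarith
  rw [hmean]
  refine ⟨hW, hρ, ?_, fun a => (φ a).1, ?_⟩
  · simpa only [hν'] using hν
  · simpa only [hν'] using hφ

end Einstein

/-! ### Cubic invariants of an Einstein curvature tensor and of its Weyl part -/

variable {n : ℕ} {X Y Z W : Fin n → Fin n → Fin n → Fin n → ℝ}

/-- The curvature tensor of the unit sphere. -/
def sphereTensor (n : ℕ) (i j k l : Fin n) : ℝ :=
  delta n i k * delta n j l - delta n i l * delta n j k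

/-- The inner product of two four-index arrays. -/
def pairing (X Y : Fin n → Fin n → Fin n → Fin n → ℝ) : ℝ :=
  ∑ x : Fin 4 → Fin n, X (x 0) (x 1) (x 2) (x 3) * Y (x 0) (x 1) (x 2) (x 3)

/-- The trilinear form with `cubicA W = trilinearA W W W`. -/
def trilinearA (X Y Z : Fin n → Fin n → Fin n → Fin n → ℝ) : ℝ :=
  ∑ x : Fin 6 → Fin n, X (x 0) (x 1) (x 2) (x 3) * Y (x 2) (x 3) (x 4) (x 5) *
    Z (x 4) (x 5) (x 0) (x 1)

/-- The trilinear form with `cubicB W = trilinearB W W W`. -/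
def trilinearB (X Y Z : Fin n → Fin n → Fin n → Fin n → ℝ) : ℝ :=
  ∑ x : Fin 6 → Fin n, X (x 0) (x 1) (x 2) (x 3) * Y (x 0) (x 4) (x 2) (x 5) *
    Z (x 1) (x 4) (x 3) (x 5)

lemma trilinearA_rotate : trilinearA X Y Z = trilinearA Y Z X := by
  rw [trilinearA, ← sum_rename ![4, 5, 0, 1, 2, 3] (by decide)]
  exact Finset.sum_congr rfl fun x _ => by dsimp; ring

lemma trilinearB_swap_left (hZ : IsCurvatureTensor Z) : trilinearB X Y Z = trilinearB Y X Z := by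
  rw [trilinearB, ← sum_rename ![0, 4, 2, 5, 1, 3] (by decide)]
  refine Finset.sum_congr rfl fun x _ => ?_
  dsimp
  rw [hZ.antisymm (x 4), hZ.antisymm_right (x 1)]
  ring

lemma trilinearB_swap_right (hX : IsCurvatureTensor X) : trilinearB X Y Z = trilinearB X Z Y := by
  rw [trilinearB, ← sum_rename ![1, 0, 3, 2, 4, 5] (by decide)]
  refine Finset.sum_congr rfl fun x _ => ?_
  dsimp
  rw [hX.antisymm (x 1), hX.antisymm_right (x 0)]
  ring

lemma trilinearA_sphere (hZ : IsCurvatureTensor Z) :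
    trilinearA (sphereTensor n) Y Z = 2 * pairing Y Z := by
  have h : ∀ k l p q : Fin n, ∑ i, ∑ j, sphereTensor n i j k l * Y k l p q * Z p q i j =
      2 * (Y k l p q * Z k l p q) := by
    intro k l p q
    have e : ∀ i j, sphereTensor n i j k l * Y k l p q * Z p q i j =
      Y k l p q * (delta n k i * (delta n l j * Z p q i j))
        - Y k l p q * (delta n l i * (delta n k j * Z p q i j)) := fun i j => by
      rw [sphereTensor, delta_comm i k, delta_comm j l, delta_comm i l, delta_comm j k]
      ring
    simp only [e, Finset.sum_sub_distrib, ← Finset.mul_sum, sum_delta_mul]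
    rw [hZ.antisymm_right p q l k, hZ.pair p q k l]
    ring
  rw [trilinearA, ← sum_rename ![4, 5, 0, 1, 2, 3] (by decide), pairing, sum_fun_four,
    Finset.mul_sum]
  dsimp
  rw [sum_fun_six fun a b c d p q => sphereTensor n p q a b * Y a b c d * Z c d p q]
  simp only [Finset.mul_sum, ← h]

lemma trilinearB_sphere (hY : IsCurvatureTensor Y) :
    trilinearB (sphereTensor n) Y Z = ∑ p, ∑ q, (∑ i, Y p i q i) * (∑ j, Z j p j q)
      - ∑ x : Fin 4 → Fin n, Y (x 0) (x 1) (x 2) (x 3) * Z (x 2) (x 1) (x 0) (x 3) := by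
  have h : ∀ i k p q : Fin n, ∑ j, ∑ l, sphereTensor n i j k l * Y i p k q * Z j p l q =
      ∑ j, delta n i k * (Y p i q k * Z j p j q) - Y i p k q * Z k p i q := by
    intro i k p q
    have e : ∀ j l, sphereTensor n i j k l * Y i p k q * Z j p l q =
      (delta n i k * Y i p k q) * (delta n j l * Z j p l q)
        - Y i p k q * (delta n k j * (delta n i l * Z j p l q)) := fun j l => by
      rw [sphereTensor, delta_comm k j]
      ring
    simp only [e, Finset.sum_sub_distrib, ← Finset.mul_sum, sum_delta_mul]
    rw [hY.antisymm i p k q, hY.antisymm_right p i k q]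
    ring
  rw [trilinearB, ← sum_rename ![0, 4, 2, 5, 1, 3] (by decide)]
  dsimp
  rw [sum_fun_six fun a b c d p q => sphereTensor n a p c q * Y a b c d * Z p b q d]
  have e : ∀ a b c d : Fin n, ∑ e, ∑ f, sphereTensor n a e c f * Y a b c d * Z e b f d =
      ∑ j, delta n a c * (Y b a d c * Z j b j d) - Y a b c d * Z c b a d := fun a b c d => h a c b d
  trans ∑ a, ∑ b, ∑ c, ∑ d, (∑ j, delta n a c * (Y b a d c * Z j b j d) - Y a b c d * Z c b a d)
  · exact Finset.sum_congr rfl fun a _ => Finset.sum_congr rfl fun b _ =>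
      Finset.sum_congr rfl fun c _ => Finset.sum_congr rfl fun d _ => e a b c d
  rw [sum_fun_four]
  simp only [Finset.sum_sub_distrib]
  congr 1
  rw [Finset.sum_comm]
  refine Finset.sum_congr rfl fun p _ => ?_
  have e2 : ∀ a, ∑ c, ∑ d, ∑ j, delta n a c * (Y p a d c * Z j p j d) =
      ∑ d, Y p a d a * ∑ j, Z j p j d := by
    intro a
    simp only [← Finset.mul_sum, sum_delta_mul]
  rw [Finset.sum_congr rfl fun a _ => e2 a, Finset.sum_comm]
  exact Finset.sum_congr rfl fun d _ => by rw [Finset.sum_mul]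

/-- By the first Bianchi identity the contraction `Y_{ipkq} Z_{kpiq}` is half of the inner
product. -/
lemma sum_mul_crossed (hY : IsCurvatureTensor Y) (hZ : IsCurvatureTensor Z) :
    ∑ x : Fin 4 → Fin n, Y (x 0) (x 1) (x 2) (x 3) * Z (x 2) (x 1) (x 0) (x 3) =
      1 / 2 * pairing Y Z := by
  set s := ∑ x : Fin 4 → Fin n, Y (x 0) (x 1) (x 2) (x 3) * Z (x 2) (x 1) (x 0) (x 3) with hs
  have h1 : ∑ x : Fin 4 → Fin n, Y (x 0) (x 1) (x 2) (x 3) * Z (x 0) (x 2) (x 3) (x 1) = -s := by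
    rw [hs, ← Finset.sum_neg_distrib, ← sum_rename ![0, 1, 3, 2] (by decide)]
    refine Finset.sum_congr rfl fun x _ => ?_
    dsimp
    rw [hY.antisymm_right, hZ.pair (x 0)]
    ring
  have h2 : ∑ x : Fin 4 → Fin n, Y (x 0) (x 1) (x 2) (x 3) * Z (x 0) (x 3) (x 1) (x 2) = -s := by
    rw [hs, ← Finset.sum_neg_distrib]
    refine Finset.sum_congr rfl fun x _ => ?_
    rw [hZ.antisymm_right, hZ.pair (x 0)]
    ring
  have h3 : pairing Y Z + ∑ x : Fin 4 → Fin n, Y (x 0) (x 1) (x 2) (x 3) * Z (x 0) (x 2) (x 3) (x 1)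
      + ∑ x : Fin 4 → Fin n, Y (x 0) (x 1) (x 2) (x 3) * Z (x 0) (x 3) (x 1) (x 2) = 0 := by
    rw [pairing, ← Finset.sum_add_distrib, ← Finset.sum_add_distrib]
    refine Finset.sum_eq_zero fun x _ => ?_
    rw [← mul_add, ← mul_add, hZ.bianchi, mul_zero]
  linarith

lemma pairing_comm : pairing X Y = pairing Y X :=
  Finset.sum_congr rfl fun _ _ => mul_comm _ _

lemma pairing_sphere (hX : IsCurvatureTensor X) :
    pairing (sphereTensor n) X = 2 * ∑ i, ∑ j, X i j i j := by
  have h : ∀ i j, ∑ k, ∑ l, sphereTensor n i j k l * X i j k l = 2 * X i j i j := by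
    intro i j
    have e : ∀ k l, sphereTensor n i j k l * X i j k l = delta n i k * (delta n j l * X i j k l)
        - delta n j k * (delta n i l * X i j k l) := fun k l => by
      rw [sphereTensor]
      ring
    simp only [e, Finset.sum_sub_distrib, ← Finset.mul_sum, sum_delta_mul]
    rw [hX.antisymm_right i j j i]
    ring
  rw [pairing, sum_fun_four]
  simp only [Finset.mul_sum, ← h]
  rfl

lemma isCurvatureTensor_sphereTensor : IsCurvatureTensor (sphereTensor n) where
  antisymm i j k l := by
    simp only [sphereTensor]
    ring
  pair i j k l := by
    simp only [sphereTensor]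
    rw [delta_comm k i, delta_comm l j, delta_comm k j, delta_comm l i]
    ring
  bianchi i j k l := by
    simp only [sphereTensor]
    rw [delta_comm k j, delta_comm l k, delta_comm l j]
    ring

/-- The combination of invariants of an Einstein curvature tensor `R` that equals `⟨ΔR, R⟩`,
in terms of the Weyl part of `R`. -/
lemma cubic_eq_weyl {R : (Fin 4 → Fin n) → ℝ} {m : ℝ}
    (hR : IsCurvatureTensor fun i j k l => R ![i, j, k, l])
    (hric : ∀ i k, ∑ j, R ![i, j, k, j] = (n - 1) * m * delta n i k) :
    2 * ((n - 1) * m) * normSq (fun i j k l => R ![i, j, k, l])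
        - cubicA (fun i j k l => R ![i, j, k, l]) - 4 * cubicB (fun i j k l => R ![i, j, k, l]) =
      2 * (n - 1) * m * normSq (weylPart R m) - cubicA (weylPart R m)
        - 4 * cubicB (weylPart R m) := by
  have hW := isWeylTensor_weylPart hR hric
  have hWc := hW.toIsCurvatureTensor
  have hG := isCurvatureTensor_sphereTensor (n := n)
  set W := weylPart R m with hWdef
  set Q : Fin n → Fin n → Fin n → Fin n → ℝ := fun i j k l => R ![i, j, k, l] with hQ
  have e : ∀ i j k l, Q i j k l = m * sphereTensor n i j k l + W i j k l := fun i j k l => by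
    simp only [hQ, hWdef, weylPart, sphereTensor]
    ring
  have hGW : pairing (sphereTensor n) W = 0 := by
    rw [pairing_sphere hWc]
    simp [hW.trace]
  have hGQ : pairing (sphereTensor n) Q = 2 * (n * ((n - 1) * m)) := by
    rw [pairing_sphere hR]
    simp only [hQ, hric]
    simp [delta]
  have pl : ∀ Y, pairing Q Y = m * pairing (sphereTensor n) Y + pairing W Y := fun Y => by
    simp only [pairing, e, add_mul, Finset.sum_add_distrib, Finset.mul_sum, mul_assoc]
  have al : ∀ Y Z, trilinearA Q Y Z = m * trilinearA (sphereTensor n) Y Z + trilinearA W Y Z :=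
    fun Y Z => by
      simp only [trilinearA, e, add_mul, Finset.sum_add_distrib, Finset.mul_sum, mul_assoc]
  have bl : ∀ Y Z, trilinearB Q Y Z = m * trilinearB (sphereTensor n) Y Z + trilinearB W Y Z :=
    fun Y Z => by
      simp only [trilinearB, e, add_mul, Finset.sum_add_distrib, Finset.mul_sum, mul_assoc]
  have nW : normSq W = pairing W W := Finset.sum_congr rfl fun x _ => sq _
  have nQ : normSq Q = pairing Q Q := Finset.sum_congr rfl fun x _ => sq _
  have pQW : pairing W Q = pairing W W := by
    rw [pairing_comm, pl, hGW]
    ring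
  have pQQ : pairing Q Q = pairing W W + 2 * n * (n - 1) * m ^ 2 := by
    rw [pl, hGQ, pQW]
    ring
  have hA : cubicA Q = m * (2 * pairing Q Q) + m * (2 * pairing W W) + m * (2 * pairing W W)
      + cubicA W := by
    have h1 : trilinearA W Q Q = m * (2 * pairing W W) + trilinearA W W Q := by
      rw [trilinearA_rotate, al, trilinearA_sphere hWc, pairing_comm, pQW, trilinearA_rotate,
        trilinearA_rotate]
    have h2 : trilinearA W W Q = m * (2 * pairing W W) + trilinearA W W W := by
      rw [trilinearA_rotate, trilinearA_rotate, al, trilinearA_sphere hWc]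
    have h3 : cubicA Q = trilinearA Q Q Q := rfl
    have h4 : cubicA W = trilinearA W W W := rfl
    rw [h3, al, trilinearA_sphere hR, h1, h2, h4]
    ring
  have hric' : ∀ p q, ∑ j, Q j p j q = (n - 1) * m * delta n p q := by
    intro p q
    rw [← hric]
    refine Finset.sum_congr rfl fun j _ => ?_
    rw [hR.antisymm j p, hR.antisymm_right p j, neg_neg]
  have hB : cubicB Q = m * (n * ((n - 1) * m) ^ 2 - 1 / 2 * pairing Q Q)
      - m * (1 / 2 * pairing W W) - m * (1 / 2 * pairing W W) + cubicB W := by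
    have h1 : trilinearB (sphereTensor n) Q Q = n * ((n - 1) * m) ^ 2 - 1 / 2 * pairing Q Q := by
      rw [trilinearB_sphere hR, sum_mul_crossed hR hR]
      simp only [hric']
      simp only [hQ, hric]
      congr 1
      simp only [delta, mul_ite, mul_one, mul_zero, Finset.sum_ite_eq, Finset.mem_univ, if_true,
        Finset.sum_const, Finset.card_univ, Fintype.card_fin, nsmul_eq_mul]
      ring
    have h2 : trilinearB (sphereTensor n) W Q = -(1 / 2 * pairing W W) := by
      rw [trilinearB_sphere hWc, sum_mul_crossed hWc hR, pQW]
      simp [hW.trace]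
    have h3 : trilinearB (sphereTensor n) W W = -(1 / 2 * pairing W W) := by
      rw [trilinearB_sphere hWc, sum_mul_crossed hWc hWc]
      simp [hW.trace]
    have h4 : cubicB Q = trilinearB Q Q Q := rfl
    have h5 : cubicB W = trilinearB W W W := rfl
    rw [h4, bl, h1, trilinearB_swap_left hR, bl, h2, trilinearB_swap_right hWc,
      trilinearB_swap_left hWc, bl, h3, h5]
    ring
  rw [hA, hB, nW, nQ, pQQ]
  ring

/-- The pointwise form of the theorem, for an algebraic Einstein curvature tensor `R` and the
combination of its invariants that equals `⟨ΔR, R⟩`. -/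
theorem cone_estimate {R : (Fin 4 → Fin n) → ℝ} {ρ L : ℝ} (hn : n = 4 ∨ n = 5 ∨ 8 ≤ n)
    (hR : IsCurvatureTensor fun i j k l => R ![i, j, k, l])
    (hric : ∀ i k, ∑ j, R ![i, j, k, j] = ρ * delta n i k)
    (hcone : ConeCondition R)
    (hL : L = 2 * ρ * normSq (fun i j k l => R ![i, j, k, l])
      - cubicA (fun i j k l => R ![i, j, k, l]) - 4 * cubicB (fun i j k l => R ![i, j, k, l])) :
    0 ≤ L ∧
      (L = 0 ↔
        (∀ j < secondKindDim n, secondKindEigenvalue R j = secondKindMean R) ∨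
          (secondKindEigenvalue R 0 = -((2 * ((secondKindDim n : ℝ) - 1) * coneConstant n
              + secondKindDim n) / ((secondKindDim n : ℝ) - 2)) * secondKindMean R ∧
            ∀ j, 1 ≤ j → j < secondKindDim n → secondKindEigenvalue R j =
              ((secondKindDim n : ℝ) + 2 * coneConstant n) / ((secondKindDim n : ℝ) - 2)
                * secondKindMean R)) := by
  have hn4 : 4 ≤ n := by omega
  have hn' : (4 : ℝ) ≤ n := by exact_mod_cast hn4
  obtain ⟨hW, hρ, hmono, φ, hφ⟩ := exists_isEigenframe (by omega) hR hric
  rw [hρ, cubic_eq_weyl hR (by rw [← hρ]; exact hric)] at hL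
  set m := secondKindMean R with hm
  set W := weylPart R m with hWdef
  have hN : 2 < secondKindDim n := by
    have h := cast_secondKindDim (n := n) (by omega)
    have : (2 : ℝ) < secondKindDim n := by
      rw [h]
      nlinarith
    exact_mod_cast this
  let a : Fin (secondKindDim n) := ⟨0, by omega⟩
  let b : Fin (secondKindDim n) := ⟨1, by omega⟩
  have hab : a ≠ b := by simp [a, b]
  have hx : secondKindEigenvalue R a - m ≤ secondKindEigenvalue R b - m :=
    sub_le_sub_right (hmono (Fin.mk_le_mk.2 zero_le_one)) m
  have hy : ∀ c, c ≠ a → secondKindEigenvalue R b - m ≤ secondKindEigenvalue R c - m := by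
    intro c hc
    refine sub_le_sub_right (hmono ?_) m
    rw [Fin.le_def]
    have : (c : ℕ) ≠ 0 := fun h => hc (Fin.ext h)
    change 1 ≤ (c : ℕ)
    omega
  have hs : -2 * (1 + coneConstant n) * m ≤
      (secondKindEigenvalue R a - m) + (secondKindEigenvalue R b - m) := by
    have h1 : secondKindEigenvalue R 0 + secondKindEigenvalue R 1 ≥ -2 * coneConstant n * m := hcone
    have h2 : secondKindEigenvalue R a = secondKindEigenvalue R 0 := rfl
    have h3 : secondKindEigenvalue R b = secondKindEigenvalue R 1 := rfl
    linarith
  obtain ⟨h1, h2⟩ := hφ.nonneg_of_cone hW hn hab hx hy hs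
  rw [← hL] at h1 h2
  have h3 : (∀ c : Fin (secondKindDim n), secondKindEigenvalue R c - m = 0) → L = 0 := by
    intro h
    have h4 := hφ.sum_eigenvalue_sq hW
    simp only [h] at h4
    norm_num at h4
    have h5 : ∀ x : Fin 4 → Fin n, W (x 0) (x 1) (x 2) (x 3) = 0 := fun x => by
      have := (Finset.sum_eq_zero_iff_of_nonneg fun x _ => sq_nonneg _).1 h4 x (Finset.mem_univ x)
      exact pow_eq_zero_iff two_ne_zero |>.1 this
    have h6 : ∀ i j k l, W i j k l = 0 := fun i j k l => h5 ![i, j, k, l]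
    rw [hL]
    simp [normSq, cubicA, cubicB, h6]
  refine ⟨h1, fun h => Or.inl fun j hj => ?_, ?_⟩
  · linarith [h2 h ⟨j, hj⟩]
  · rintro (h | ⟨-, h⟩)
    · exact h3 fun c => by rw [h c c.2, sub_self]
    · -- All eigenvalues but the first being equal forces all of them to be equal.
      refine h3 (hφ.eq_zero_of_forall_ne_eq hW hn4 (a := a)
        (y := (secondKindDim n + 2 * coneConstant n) / (secondKindDim n - 2) * m -
            m) fun c hc => ?_)
      have : (c : ℕ) ≠ 0 := fun h => hc (Fin.ext h)
      rw [h c (by omega) c.2]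

/-! ### Tensor calculus over an algebra with commuting derivations -/

section Action

variable {n k : ℕ} {𝒜 : Type*} [CommRing 𝒜]

/-- The derivation action of a matrix on `(0,k)`-tensors. -/
def act (M : Matrix (Fin n) (Fin n) 𝒜) (T : (Fin k → Fin n) → 𝒜) (I : Fin k → Fin n) : 𝒜 :=
  ∑ s, ∑ p, M p (I s) * T (Function.update I s p)

lemma act_sub_left (M K : Matrix (Fin n) (Fin n) 𝒜) (T : (Fin k → Fin n) → 𝒜) :
    act (M - K) T = act M T - act K T := by
  ext I
  simp [act, sub_mul]

lemma act_add_left (M K : Matrix (Fin n) (Fin n) 𝒜) (T : (Fin k → Fin n) → 𝒜) :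
    act (M + K) T = act M T + act K T := by
  ext I
  simp [act, add_mul, Finset.sum_add_distrib]

lemma act_sub_right (M : Matrix (Fin n) (Fin n) 𝒜) (T S : (Fin k → Fin n) → 𝒜) :
    act M (T - S) = act M T - act M S := by
  ext I
  simp [act, mul_sub]

/-- The action is an anti-homomorphism of Lie algebras: in the commutator, terms acting on two
different slots cancel. -/
lemma act_act_sub (M K : Matrix (Fin n) (Fin n) 𝒜) (T : (Fin k → Fin n) → 𝒜) (I : Fin k → Fin n) :
    act M (act K T) I - act K (act M T) I = act (K * M - M * K) T I := by
  have h1 : ∀ M K : Matrix (Fin n) (Fin n) 𝒜, act M (act K T) I =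
      act (K * M) T I + ∑ s, ∑ t, if t = s then 0 else ∑ p, ∑ q,
        M p (I s) * K q (I t) * T (Function.update (Function.update I s p) t q) := by
    intro M K
    simp only [act]
    rw [← Finset.sum_add_distrib]
    refine Finset.sum_congr rfl fun s _ => ?_
    have h2 : ∀ p, ∑ t, ∑ q, K q (Function.update I s p t) *
        T (Function.update (Function.update I s p) t q) =
        ∑ q, K q p * T (Function.update I s q) + ∑ t, if t = s then 0 else
          ∑ q, K q (I t) * T (Function.update (Function.update I s p) t q) := by
      intro p
      rw [← Finset.add_sum_erase _ _ (Finset.mem_univ s)]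
      congr 1
      · simp
      · rw [← Finset.add_sum_erase (a := s) _ (fun t => if t = s then (0 : 𝒜) else _)
          (Finset.mem_univ s), if_pos rfl, zero_add]
        refine Finset.sum_congr rfl fun t ht => ?_
        have := Finset.ne_of_mem_erase ht
        simp [this]
    simp only [h2, mul_add, Finset.sum_add_distrib]
    congr 1
    · simp only [Matrix.mul_apply, Finset.mul_sum, Finset.sum_mul]
      rw [Finset.sum_comm]
      exact Finset.sum_congr rfl fun p _ => Finset.sum_congr rfl fun q _ => by ring
    · simp only [Finset.mul_sum]
      rw [Finset.sum_comm]
      refine Finset.sum_congr rfl fun t _ => ?_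
      by_cases h : t = s
      · simp [h]
      · simp [h, Finset.mul_sum, mul_assoc]
  rw [h1, h1, act_sub_left, Pi.sub_apply]
  have h3 : (∑ s, ∑ t, if t = s then 0 else ∑ p, ∑ q,
        M p (I s) * K q (I t) * T (Function.update (Function.update I s p) t q)) =
      ∑ s, ∑ t, if t = s then 0 else ∑ p, ∑ q,
        K p (I s) * M q (I t) * T (Function.update (Function.update I s p) t q) := by
    rw [Finset.sum_comm]
    refine Finset.sum_congr rfl fun s _ => Finset.sum_congr rfl fun t _ => ?_
    by_cases h : t = s
    · simp [h]
    · rw [if_neg h, if_neg (Ne.symm h), Finset.sum_comm]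
      refine Finset.sum_congr rfl fun p _ => Finset.sum_congr rfl fun q _ => ?_
      rw [Function.update_comm h]
      ring
  rw [h3]
  ring

lemma act_cons (M : Matrix (Fin n) (Fin n) 𝒜) (T : (Fin (k + 1) → Fin n) → 𝒜) (b : Fin n)
    (I : Fin k → Fin n) : act M T (Fin.cons b I) = ∑ p, M p b * T (Fin.cons p I)
      + act M (fun J => T (Fin.cons b J)) I := by
  rw [act, Fin.sum_univ_succ]
  simp only [Fin.cons_zero, Fin.cons_succ, Fin.update_cons_zero, act, ← Fin.cons_update]

lemma act_sum {ι : Type*} [Fintype ι] (M : Matrix (Fin n) (Fin n) 𝒜) (c : ι → 𝒜)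
    (T : ι → (Fin k → Fin n) → 𝒜) (I : Fin k → Fin n) :
    act M (fun J => ∑ i, c i * T i J) I = ∑ i, c i * act M (T i) I := by
  simp only [act, Finset.mul_sum]
  have : ∀ s, ∑ p, ∑ i, M p (I s) * (c i * T i (Function.update I s p)) =
      ∑ i, ∑ p, c i * (M p (I s) * T i (Function.update I s p)) := by
    intro s
    rw [Finset.sum_comm]
    exact Finset.sum_congr rfl fun i _ => Finset.sum_congr rfl fun p _ => by ring
  simp only [this]
  rw [Finset.sum_comm]

/-- Contraction of the first two slots with the matrix `h`. -/
def contractWith (h : Matrix (Fin n) (Fin n) 𝒜)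
    (T : (Fin (k + 2) → Fin n) → 𝒜) (I : Fin k → Fin n) : 𝒜 :=
  ∑ a, ∑ b, h a b * T (Fin.cons a (Fin.cons b I))

end Action

/-- A metric over a commutative algebra with commuting derivations `D i`, such as the algebra of
smooth functions on a domain of `ℝⁿ` with the partial derivatives: a symmetric matrix `g` with
inverse `h`. -/
structure MetricAlgebra (n : ℕ) (𝒜 : Type*) [CommRing 𝒜] [Algebra ℝ 𝒜] where
  /-- The derivations. -/
  D : Fin n → Derivation ℝ 𝒜 𝒜
  D_comm : ∀ i j f, D i (D j f) = D j (D i f)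
  /-- The metric. -/
  g : Matrix (Fin n) (Fin n) 𝒜
  /-- The inverse metric. -/
  h : Matrix (Fin n) (Fin n) 𝒜
  g_symm : ∀ i j, g i j = g j i
  g_mul_h : g * h = 1

namespace MetricAlgebra

variable {n k : ℕ} {𝒜 : Type*} [CommRing 𝒜] [Algebra ℝ 𝒜] (G : MetricAlgebra n 𝒜)

lemma h_mul_g : G.h * G.g = 1 := mul_eq_one_comm.1 G.g_mul_h

/-- The entrywise derivative of a matrix. -/
noncomputable def dMat (a : Fin n) (M : Matrix (Fin n) (Fin n) 𝒜) : Matrix (Fin n) (Fin n) 𝒜 :=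
  Matrix.of fun i j => G.D a (M i j)

lemma dMat_add (a : Fin n) (M K : Matrix (Fin n) (Fin n) 𝒜) :
    G.dMat a (M + K) = G.dMat a M + G.dMat a K := by
  ext i j
  simp [dMat]

lemma dMat_sub (a : Fin n) (M K : Matrix (Fin n) (Fin n) 𝒜) :
    G.dMat a (M - K) = G.dMat a M - G.dMat a K := by
  ext i j
  simp [dMat]

lemma dMat_mul (a : Fin n) (M K : Matrix (Fin n) (Fin n) 𝒜) :
    G.dMat a (M * K) = G.dMat a M * K + M * G.dMat a K := by
  ext i j
  simp only [dMat, Matrix.of_apply, Matrix.mul_apply, map_sum, Derivation.leibniz, smul_eq_mul,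
    Matrix.add_apply, ← Finset.sum_add_distrib]
  exact Finset.sum_congr rfl fun p _ => by ring

lemma dMat_comm (a b : Fin n) (M : Matrix (Fin n) (Fin n) 𝒜) :
    G.dMat a (G.dMat b M) = G.dMat b (G.dMat a M) := by
  ext i j
  exact G.D_comm a b _

lemma dMat_one (a : Fin n) : G.dMat a 1 = 0 := by
  ext i j
  simp only [dMat, Matrix.of_apply, Matrix.one_apply]
  split_ifs <;> simp

/-- The Christoffel symbols `Γᵖₐᵢ` as matrices: `Γ a p i`. -/
noncomputable def Γ (a : Fin n) : Matrix (Fin n) (Fin n) 𝒜 := Matrix.of fun p i =>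
  algebraMap ℝ 𝒜 (1 / 2) *
    ∑ l, G.h p l * (G.D a (G.g i l) + G.D i (G.g a l) - G.D l (G.g a i))

lemma Γ_symm (a i p : Fin n) : G.Γ a p i = G.Γ i p a := by
  simp only [Γ, Matrix.of_apply]
  congr 1
  refine Finset.sum_congr rfl fun l _ => ?_
  rw [G.g_symm a i]
  ring

lemma algebraMap_half_mul_two (x : 𝒜) : algebraMap ℝ 𝒜 (1 / 2) * (2 * x) = x := by
  rw [← mul_assoc]
  have : algebraMap ℝ 𝒜 (1 / 2) * 2 = 1 := by
    rw [← map_ofNat (algebraMap ℝ 𝒜) 2, ← map_mul]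
    norm_num
  rw [this, one_mul]

lemma eq_zero_of_two_mul {x : 𝒜} (h : 2 * x = 0) : x = 0 := by
  rw [← algebraMap_half_mul_two x, h, mul_zero]

/-- The Christoffel symbols with lowered index. -/
lemma g_mul_Γ (a k i : Fin n) : (G.g * G.Γ a) k i =
    algebraMap ℝ 𝒜 (1 / 2) * (G.D a (G.g i k) + G.D i (G.g a k) - G.D k (G.g a i)) := by
  have h1 : G.Γ a = algebraMap ℝ 𝒜 (1 / 2) • (G.h * Matrix.of fun l i =>
      (G.D a (G.g i l) + G.D i (G.g a l) - G.D l (G.g a i))) := by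
    ext p i
    simp [Γ, Matrix.mul_apply]
  rw [h1, Matrix.mul_smul, ← Matrix.mul_assoc, G.g_mul_h, Matrix.one_mul]
  rfl

lemma dMat_g (a : Fin n) : G.dMat a G.g = (G.Γ a).transpose * G.g + G.g * G.Γ a := by
  have hg : G.g.transpose = G.g := by ext i j; exact G.g_symm j i
  have h1 : (G.Γ a).transpose * G.g = (G.g * G.Γ a).transpose := by
    rw [Matrix.transpose_mul, hg]
  ext k i
  rw [h1, Matrix.add_apply, Matrix.transpose_apply, g_mul_Γ, g_mul_Γ, dMat, Matrix.of_apply,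
    ← mul_add, G.g_symm k i, G.g_symm a i, G.g_symm a k]
  conv_lhs => rw [← algebraMap_half_mul_two (G.D a (G.g i k))]
  congr 1
  rw [G.g_symm k a]
  ring

lemma dMat_h (a : Fin n) : G.dMat a G.h = -(G.h * (G.Γ a).transpose + G.Γ a * G.h) := by
  have h1 := congrArg (G.dMat a) G.g_mul_h
  rw [dMat_mul, dMat_one, dMat_g] at h1
  have h2 : G.h * (G.g * G.dMat a G.h) = G.dMat a G.h := by
    rw [← Matrix.mul_assoc, G.h_mul_g, Matrix.one_mul]
  have h3 : G.g * G.dMat a G.h = -(((G.Γ a).transpose * G.g + G.g * G.Γ a) * G.h) :=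
    eq_neg_of_add_eq_zero_right h1
  rw [← h2, h3, Matrix.mul_neg, Matrix.add_mul, Matrix.mul_add, Matrix.mul_assoc _ G.g,
    G.g_mul_h, Matrix.mul_one, Matrix.mul_assoc G.g, ← Matrix.mul_assoc G.h G.g, G.h_mul_g,
    Matrix.one_mul]

/-- The covariant derivative `∇ₐ T` of a `(0,k)`-tensor in the coordinate direction `a`. -/
noncomputable def nab (a : Fin n) (T : (Fin k → Fin n) → 𝒜) (I : Fin k → Fin n) : 𝒜 :=
  G.D a (T I) - act (G.Γ a) T I

/-- The covariant derivative `∇T`, with the direction of differentiation as first index. -/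
noncomputable def cov (T : (Fin k → Fin n) → 𝒜) (I : Fin (k + 1) → Fin n) : 𝒜 :=
    G.nab (I 0) T (Fin.tail I)

lemma D_act (a : Fin n) (M : Matrix (Fin n) (Fin n) 𝒜) (T : (Fin k → Fin n) → 𝒜)
    (I : Fin k → Fin n) :
    G.D a (act M T I) = act (G.dMat a M) T I + act M (fun J => G.D a (T J)) I := by
  simp only [act, map_sum, Derivation.leibniz, smul_eq_mul, dMat, Matrix.of_apply,
    ← Finset.sum_add_distrib]
  exact Finset.sum_congr rfl fun s _ => Finset.sum_congr rfl fun p _ => by ring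

/-- The curvature `∂ₐΓ_b - ∂_bΓₐ + [Γₐ, Γ_b]` as a matrix, with upper index the row. -/
noncomputable def K (a b : Fin n) : Matrix (Fin n) (Fin n) 𝒜 :=
  G.dMat a (G.Γ b) - G.dMat b (G.Γ a) + (G.Γ a * G.Γ b - G.Γ b * G.Γ a)

lemma K_antisymm (a b : Fin n) : G.K a b = -G.K b a := by
  simp only [K]
  abel

/-- The Ricci identity. -/
lemma nab_nab_sub (a b : Fin n) (T : (Fin k → Fin n) → 𝒜) (I : Fin k → Fin n) :
    G.nab a (G.nab b T) I - G.nab b (G.nab a T) I = -act (G.K a b) T I := by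
  have e : ∀ a b, G.nab a (G.nab b T) I = G.D a (G.D b (T I)) - act (G.dMat a (G.Γ b)) T I
      - act (G.Γ b) (fun J => G.D a (T J)) I - act (G.Γ a) (fun J => G.D b (T J)) I
      + act (G.Γ a) (act (G.Γ b) T) I := by
    intro a b
    have : G.nab b T = (fun J => G.D b (T J)) - act (G.Γ b) T := rfl
    rw [this, nab, act_sub_right, Pi.sub_apply, Pi.sub_apply, map_sub, D_act]
    ring
  rw [e a b, e b a, G.D_comm a b, K, act_add_left, act_sub_left, Pi.add_apply, Pi.sub_apply]
  have h := act_act_sub (G.Γ b) (G.Γ a) T I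
  linear_combination -h

lemma cov_cons (T : (Fin k → Fin n) → 𝒜) (a : Fin n) (I : Fin k → Fin n) :
    G.cov T (Fin.cons a I) = G.nab a T I := by
  simp [cov]

lemma nab_cov_cons (T : (Fin k → Fin n) → 𝒜) (a b : Fin n) (I : Fin k → Fin n) :
    G.nab a (G.cov T) (Fin.cons b I) =
      G.nab a (G.nab b T) I - ∑ p, G.Γ a p b * G.nab p T I := by
  rw [nab, act_cons]
  simp only [cov_cons]
  have : G.nab a (G.nab b T) I =
    G.D a (G.nab b T I) - act (G.Γ a) (fun J => G.nab b T J) I := rfl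
  rw [this]
  ring

/-- The Ricci identity for the second covariant derivative. -/
lemma cov_cov_sub (T : (Fin k → Fin n) → 𝒜) (a b : Fin n) (I : Fin k → Fin n) :
    G.cov (G.cov T) (Fin.cons a (Fin.cons b I)) - G.cov (G.cov T) (Fin.cons b (Fin.cons a I)) =
      -act (G.K a b) T I := by
  rw [cov_cons, cov_cons, nab_cov_cons, nab_cov_cons, ← nab_nab_sub]
  simp only [G.Γ_symm a b]
  ring

lemma nab_add (a : Fin n) (T S : (Fin k → Fin n) → 𝒜) :
    G.nab a (T + S) = G.nab a T + G.nab a S := by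
  ext I
  simp [nab, act, mul_add, Finset.sum_add_distrib]
  ring

lemma nab_zero (a : Fin n) : G.nab a (0 : (Fin k → Fin n) → 𝒜) = 0 := by
  ext I
  simp [nab, act]

lemma nab_neg (a : Fin n) (T : (Fin k → Fin n) → 𝒜) : G.nab a (-T) = -G.nab a T := by
  ext I
  simp [nab, act]
  ring

lemma nab_smul (a : Fin n) (c : ℝ) (T : (Fin k → Fin n) → 𝒜) :
    G.nab a (c • T) = c • G.nab a T := by
  ext I
  simp only [nab, act, Pi.smul_apply, Derivation.map_smul, mul_smul_comm, ← Finset.smul_sum,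
      smul_sub]

/-- Permuting the slots of a tensor commutes with covariant differentiation. -/
lemma nab_perm (a : Fin n) (σ : Fin k ≃ Fin k) (T : (Fin k → Fin n) → 𝒜) (I : Fin k → Fin n) :
    G.nab a (fun J => T (J ∘ σ)) I = G.nab a T (I ∘ σ) := by
  simp only [nab, act]
  congr 1
  rw [← Equiv.sum_comp σ]
  refine Finset.sum_congr rfl fun s _ => Finset.sum_congr rfl fun p _ => ?_
  rw [Function.comp_apply]
  congr 2
  ext t
  by_cases h : t = s
  · simp [h]
  · simp [h]

/-- Metric contraction commutes with covariant differentiation. -/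
lemma nab_contract (m : Fin n) (T : (Fin (k + 2) → Fin n) → 𝒜) (I : Fin k → Fin n) :
    G.nab m (contractWith G.h T) I = contractWith G.h (G.nab m T) I := by
  have h1 : ∀ a b, G.D m (G.h a b) =
      -(∑ p, G.h a p * G.Γ m b p + ∑ p, G.Γ m a p * G.h p b) := by
    intro a b
    have := congrFun (congrFun (G.dMat_h m) a) b
    simpa [dMat, Matrix.mul_apply] using this
  have h2 : ∑ a, ∑ b, (∑ p, G.h a p * G.Γ m b p) * T (Fin.cons a (Fin.cons b I)) =
      ∑ a, ∑ b, G.h a b * ∑ p, G.Γ m p b * T (Fin.cons a (Fin.cons p I)) := by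
    refine Finset.sum_congr rfl fun a _ => ?_
    simp only [Finset.sum_mul, Finset.mul_sum]
    rw [Finset.sum_comm]
    exact Finset.sum_congr rfl fun p _ => Finset.sum_congr rfl fun q _ => by ring
  have h3 : ∑ a, ∑ b, (∑ p, G.Γ m a p * G.h p b) * T (Fin.cons a (Fin.cons b I)) =
      ∑ a, ∑ b, G.h a b * ∑ p, G.Γ m p a * T (Fin.cons p (Fin.cons b I)) := by
    rw [Finset.sum_comm]
    conv_rhs => rw [Finset.sum_comm]
    refine Finset.sum_congr rfl fun b _ => ?_
    simp only [Finset.sum_mul, Finset.mul_sum]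
    rw [Finset.sum_comm]
    exact Finset.sum_congr rfl fun p _ => Finset.sum_congr rfl fun q _ => by ring
  have h4 : act (G.Γ m) (contractWith G.h T) I =
      ∑ a, ∑ b, G.h a b * act (G.Γ m) (fun J => T (Fin.cons a (Fin.cons b J))) I := by
    have : contractWith G.h T = fun J => ∑ a, 1 * ∑ b, G.h a b * T (Fin.cons a (Fin.cons b J)) := by
      ext J
      simp only [contractWith, one_mul]
    rw [this, act_sum]
    refine Finset.sum_congr rfl fun a _ => ?_
    rw [act_sum, one_mul]
  have h5 : ∀ a b, G.nab m T (Fin.cons a (Fin.cons b I)) =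
      G.D m (T (Fin.cons a (Fin.cons b I))) - act (G.Γ m) T (Fin.cons a (Fin.cons b I)) :=
    fun _ _ => rfl
  rw [nab, h4]
  simp only [contractWith, h5, act_cons, map_sum, Derivation.leibniz, smul_eq_mul, h1,
    mul_sub, mul_add, mul_neg, Finset.sum_add_distrib, Finset.sum_sub_distrib,
        Finset.sum_neg_distrib]
  simp only [mul_comm (T _)]
  rw [h2, h3]
  ring

end MetricAlgebra

/-! ### The curvature tensor of a metric algebra -/

section Action

variable {n : ℕ} {𝒜 : Type*} [CommRing 𝒜]

lemma update_two (a b p : Fin n) :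
    Function.update ![a, b] 0 p = ![p, b] ∧ Function.update ![a, b] 1 p = ![a, p] := by
  constructor <;> ext t <;> fin_cases t <;> rfl

lemma act_two (M : Matrix (Fin n) (Fin n) 𝒜) (T : (Fin 2 → Fin n) → 𝒜) (a b : Fin n) :
    act M T ![a, b] = ∑ p, M p a * T ![p, b] + ∑ p, M p b * T ![a, p] := by
  simp only [act, Fin.sum_univ_two, (update_two a b _).1, (update_two a b _).2]
  rfl

lemma act_four (M : Matrix (Fin n) (Fin n) 𝒜) (T : (Fin 4 → Fin n) → 𝒜) (a b c d : Fin n) :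
    act M T ![a, b, c, d] = ∑ p, M p a * T ![p, b, c, d] + ∑ p, M p b * T ![a, p, c, d]
      + ∑ p, M p c * T ![a, b, p, d] + ∑ p, M p d * T ![a, b, c, p] := by
  have h0 : ∀ p, Function.update ![a, b, c, d] 0 p = ![p, b, c, d] := fun p => by
    ext t; fin_cases t <;> rfl
  have h1 : ∀ p, Function.update ![a, b, c, d] 1 p = ![a, p, c, d] := fun p => by
    ext t; fin_cases t <;> rfl
  have h2 : ∀ p, Function.update ![a, b, c, d] 2 p = ![a, b, p, d] := fun p => by
    ext t; fin_cases t <;> rfl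
  have h3 : ∀ p, Function.update ![a, b, c, d] 3 p = ![a, b, c, p] := fun p => by
    ext t; fin_cases t <;> rfl
  simp only [act, Fin.sum_univ_four, h0, h1, h2, h3]
  rfl

end Action

namespace MetricAlgebra

variable {n : ℕ} {𝒜 : Type*} [CommRing 𝒜] [Algebra ℝ 𝒜] (G : MetricAlgebra n 𝒜)

/-- The metric as a `(0,2)`-tensor. -/
def metric (J : Fin 2 → Fin n) : 𝒜 := G.g (J 0) (J 1)

/-- The Riemann curvature tensor with all indices lowered. The last pair of indices is that of the
endomorphism `K`. -/
noncomputable def Rm (J : Fin 4 → Fin n) : 𝒜 := (G.g * G.K (J 0) (J 1)) (J 2) (J 3)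

lemma eq_vec_two {α : Type*} (J : Fin 2 → α) : J = ![J 0, J 1] := by
  ext t; fin_cases t <;> rfl

lemma eq_vec_four {α : Type*} (J : Fin 4 → α) : J = ![J 0, J 1, J 2, J 3] := by
  ext t; fin_cases t <;> rfl

lemma nab_metric (a : Fin n) : G.nab a G.metric = 0 := by
  ext J
  rw [eq_vec_two J, nab, act_two]
  have h := congrFun (congrFun (G.dMat_g a) (J 0)) (J 1)
  simp only [dMat, Matrix.of_apply, Matrix.add_apply, Matrix.mul_apply, Matrix.transpose_apply] at h
  simp only [metric, Matrix.cons_val, h, mul_comm (G.g _ _), Pi.zero_apply]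
  ring

lemma Rm_antisymm (a b k l : Fin n) : G.Rm ![a, b, k, l] = -G.Rm ![b, a, k, l] := by
  simp only [Rm, Matrix.cons_val]
  rw [G.K_antisymm a b, Matrix.mul_neg, Matrix.neg_apply]

lemma Rm_antisymm_right (a b k l : Fin n) : G.Rm ![a, b, k, l] = -G.Rm ![a, b, l, k] := by
  have h := G.nab_nab_sub a b G.metric ![k, l]
  rw [nab_metric, nab_metric, nab_zero, nab_zero, act_two] at h
  simp only [metric, Matrix.cons_val, Pi.zero_apply, sub_zero] at h
  simp only [Rm, Matrix.cons_val, Matrix.mul_apply]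
  have h1 : ∀ k l, ∑ p, G.g k p * G.K a b p l = ∑ p, G.K a b p l * G.g k p := fun k l =>
    Finset.sum_congr rfl fun p _ => mul_comm _ _
  rw [h1, h1]
  simp only [G.g_symm _ l] at h ⊢
  linear_combination h

lemma Rm_bianchi (a b c k : Fin n) :
    G.Rm ![a, b, k, c] + G.Rm ![b, c, k, a] + G.Rm ![c, a, k, b] = 0 := by
  have h : ∀ p, G.K a b p c + G.K b c p a + G.K c a p b = 0 := by
    intro p
    simp only [K, dMat, Matrix.add_apply, Matrix.sub_apply, Matrix.of_apply, Matrix.mul_apply,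
      G.Γ_symm b a, G.Γ_symm c a, G.Γ_symm c b]
    ring
  simp only [Rm, Matrix.cons_val, Matrix.mul_apply]
  rw [← Finset.sum_add_distrib, ← Finset.sum_add_distrib]
  refine Finset.sum_eq_zero fun p _ => ?_
  rw [← mul_add, ← mul_add, h, mul_zero]

lemma Rm_pair (a b c d : Fin n) : G.Rm ![a, b, c, d] = G.Rm ![c, d, a, b] := by
  have h1 := G.Rm_bianchi a b d c
  have h2 := G.Rm_bianchi a b c d
  have h3 := G.Rm_bianchi b c d a
  have h4 := G.Rm_bianchi a c d b
  rw [G.Rm_antisymm b d, G.Rm_antisymm_right d b, G.Rm_antisymm_right d a c b] at h1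
  rw [G.Rm_antisymm_right a b d c, G.Rm_antisymm_right b c d a, G.Rm_antisymm c a,
    G.Rm_antisymm_right a c d b] at h2
  rw [G.Rm_antisymm_right c d b a] at h4
  refine sub_eq_zero.1 (eq_zero_of_two_mul ?_)
  linear_combination h1 - h2 - h3 + h4

/-- The second Bianchi identity. -/
lemma nab_Rm_bianchi (a b c k l : Fin n) :
    G.nab a G.Rm ![b, c, k, l] + G.nab b G.Rm ![c, a, k, l] + G.nab c G.Rm ![a, b, k, l] = 0 := by
  have hK : ∀ a b c, G.nab a G.Rm ![b, c, k, l] =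
      (G.g * (G.dMat a (G.K b c) + (G.Γ a * G.K b c - G.K b c * G.Γ a))) k l
      - ∑ p, G.Γ a p b * G.Rm ![p, c, k, l] - ∑ p, G.Γ a p c * G.Rm ![b, p, k, l] := by
    intro a b c
    rw [nab, act_four]
    have h1 : G.D a (G.Rm ![b, c, k, l]) = G.dMat a (G.g * G.K b c) k l := rfl
    have h2 : ∑ p, G.Γ a p k * G.Rm ![b, c, p, l] = ((G.Γ a).transpose * (G.g * G.K b c)) k l := by
      simp [Matrix.mul_apply, Rm]
    have h3 : ∑ p, G.Γ a p l * G.Rm ![b, c, k, p] = (G.g * G.K b c * G.Γ a) k l := by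
      rw [Matrix.mul_apply]
      exact Finset.sum_congr rfl fun p _ => mul_comm _ _
    rw [h1, h2, h3, dMat_mul, dMat_g]
    simp only [Matrix.add_mul, Matrix.mul_add, Matrix.mul_sub, Matrix.add_apply, Matrix.sub_apply,
      Matrix.mul_assoc]
    ring
  have hJ : (G.dMat a (G.K b c) + (G.Γ a * G.K b c - G.K b c * G.Γ a))
      + (G.dMat b (G.K c a) + (G.Γ b * G.K c a - G.K c a * G.Γ b))
      + (G.dMat c (G.K a b) + (G.Γ c * G.K a b - G.K a b * G.Γ c)) = 0 := by
    simp only [K, dMat_add, dMat_sub, dMat_mul, G.dMat_comm b a, G.dMat_comm c a, G.dMat_comm c b]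
    noncomm_ring
  have hg : (G.g * (G.dMat a (G.K b c) + (G.Γ a * G.K b c - G.K b c * G.Γ a))) k l
      + (G.g * (G.dMat b (G.K c a) + (G.Γ b * G.K c a - G.K c a * G.Γ b))) k l
      + (G.g * (G.dMat c (G.K a b) + (G.Γ c * G.K a b - G.K a b * G.Γ c))) k l = 0 := by
    rw [← Matrix.add_apply, ← Matrix.add_apply, ← Matrix.mul_add, ← Matrix.mul_add, hJ]
    simp
  have h : ∀ a b c, ∑ p, G.Γ a p c * G.Rm ![b, p, k, l] = -∑ p, G.Γ c p a * G.Rm ![p, b, k, l] := by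
    intro a b c
    rw [← Finset.sum_neg_distrib]
    refine Finset.sum_congr rfl fun p _ => ?_
    rw [G.Γ_symm a c, G.Rm_antisymm b p]
    ring
  rw [hK, hK, hK, h a b c, h b c a, h c a b]
  linear_combination hg

lemma nab_Rm_antisymm (m a b k l : Fin n) :
    G.nab m G.Rm ![a, b, k, l] = -G.nab m G.Rm ![b, a, k, l] := by
  have h : (fun J => G.Rm (J ∘ Equiv.ofBijective ![1, 0, 2, 3] (by decide))) = -G.Rm := by
    ext J
    rw [Pi.neg_apply]
    conv_rhs => rw [eq_vec_four J]
    rw [← G.Rm_antisymm, eq_vec_four (J ∘ _)]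
    rfl
  have h2 := G.nab_perm m (Equiv.ofBijective ![1, 0, 2, 3] (by decide)) G.Rm ![b, a, k, l]
  rw [h, nab_neg, Pi.neg_apply] at h2
  rw [h2]
  congr 1
  ext t
  fin_cases t <;> rfl

lemma nab_Rm_pair (m a b k l : Fin n) :
    G.nab m G.Rm ![a, b, k, l] = G.nab m G.Rm ![k, l, a, b] := by
  have h : (fun J => G.Rm (J ∘ Equiv.ofBijective ![2, 3, 0, 1] (by decide))) = G.Rm := by
    ext J
    conv_rhs => rw [eq_vec_four J]
    rw [← G.Rm_pair, eq_vec_four (J ∘ _)]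
    rfl
  have h2 := G.nab_perm m (Equiv.ofBijective ![2, 3, 0, 1] (by decide)) G.Rm ![a, b, k, l]
  rw [h] at h2
  rw [h2]
  congr 1
  ext t
  fin_cases t <;> rfl

lemma cov_cov_Rm_antisymm (p q a b k l : Fin n) :
    G.cov (G.cov G.Rm) ![p, q, a, b, k, l] = -G.cov (G.cov G.Rm) ![p, q, b, a, k, l] := by
  have h : (fun J => G.cov G.Rm (J ∘ Equiv.ofBijective ![0, 2, 1, 3, 4] (by decide))) =
      -G.cov G.Rm := by
    ext J
    have e : (Fin.tail (J ∘ Equiv.ofBijective ![0, 2, 1, 3, 4] (by decide))) =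
        ![J 2, J 1, J 3, J 4] := by
      ext t; fin_cases t <;> rfl
    have e' : Fin.tail J = ![J 1, J 2, J 3, J 4] := by
      ext t; fin_cases t <;> rfl
    rw [Pi.neg_apply, cov, cov, e, e', ← G.nab_Rm_antisymm]
    rfl
  have h2 := G.nab_perm p (Equiv.ofBijective ![0, 2, 1, 3, 4] (by decide)) (G.cov G.Rm)
    ![q, b, a, k, l]
  rw [h, nab_neg, Pi.neg_apply] at h2
  change G.cov (G.cov G.Rm) (Fin.cons p ![q, a, b, k, l]) =
    -G.cov (G.cov G.Rm) (Fin.cons p ![q, b, a, k, l])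
  rw [cov_cons, cov_cons, h2]
  congr 1
  ext t
  fin_cases t <;> rfl

/-- The covariant derivative of the second Bianchi identity. -/
lemma cov_cov_Rm_bianchi (p a b c k l : Fin n) :
    G.cov (G.cov G.Rm) ![p, a, b, c, k, l] + G.cov (G.cov G.Rm) ![p, b, c, a, k, l]
      + G.cov (G.cov G.Rm) ![p, c, a, b, k, l] = 0 := by
  let σ : Fin 5 ≃ Fin 5 := Equiv.ofBijective ![1, 2, 0, 3, 4] (by decide)
  let τ : Fin 5 ≃ Fin 5 := Equiv.ofBijective ![2, 0, 1, 3, 4] (by decide)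
  have h : G.cov G.Rm + (fun J => G.cov G.Rm (J ∘ σ)) + (fun J => G.cov G.Rm (J ∘ τ)) = 0 := by
    ext J
    have e0 : Fin.tail J = ![J 1, J 2, J 3, J 4] := by
      ext t; fin_cases t <;> rfl
    have e1 : Fin.tail (J ∘ σ) = ![J 2, J 0, J 3, J 4] := by
      ext t; fin_cases t <;> rfl
    have e2 : Fin.tail (J ∘ τ) = ![J 0, J 1, J 3, J 4] := by
      ext t; fin_cases t <;> rfl
    rw [Pi.add_apply, Pi.add_apply, cov, cov, cov, e0, e1, e2]
    exact G.nab_Rm_bianchi (J 0) (J 1) (J 2) (J 3) (J 4)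
  have h2 : G.nab p (G.cov G.Rm + (fun J => G.cov G.Rm (J ∘ σ))
      + (fun J => G.cov G.Rm (J ∘ τ))) ![a, b, c, k, l] = 0 := by
    rw [h, nab_zero]
    rfl
  rw [nab_add, nab_add, Pi.add_apply, Pi.add_apply, nab_perm, nab_perm] at h2
  have e1 : ![a, b, c, k, l] ∘ σ = ![b, c, a, k, l] := by
    ext t; fin_cases t <;> rfl
  have e2 : ![a, b, c, k, l] ∘ τ = ![c, a, b, k, l] := by
    ext t; fin_cases t <;> rfl
  rw [e1, e2, ← cov_cons, ← cov_cons, ← cov_cons] at h2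
  exact h2

/-- The Einstein condition `Ric = ρ g`. -/
def IsEinstein (ρ : ℝ) : Prop :=
  ∀ i k, ∑ j, ∑ l, G.h j l * G.Rm ![i, j, k, l] = algebraMap ℝ 𝒜 ρ * G.g i k

variable {G} {ρ : ℝ}

lemma sum_h_mul_nab_Rm (hG : G.IsEinstein ρ) (m l j : Fin n) :
    ∑ a, ∑ b, G.h a b * G.nab m G.Rm ![l, a, j, b] = 0 := by
  let σ : Fin 4 ≃ Fin 4 := Equiv.ofBijective ![2, 0, 3, 1] (by decide)
  have h1 : contractWith G.h (fun J => G.Rm (J ∘ σ)) = ρ • G.metric := by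
    ext J
    rw [Pi.smul_apply, Algebra.smul_def, metric, ← hG (J 0) (J 1), contractWith]
    refine Finset.sum_congr rfl fun a _ => Finset.sum_congr rfl fun b _ => ?_
    congr 2
    ext t
    fin_cases t <;> rfl
  have h2 := G.nab_contract m (fun J => G.Rm (J ∘ σ)) ![l, j]
  rw [h1, nab_smul, nab_metric, smul_zero, Pi.zero_apply, contractWith] at h2
  rw [h2]
  refine Finset.sum_congr rfl fun a _ => Finset.sum_congr rfl fun b _ => ?_
  rw [nab_perm]
  congr 2
  ext t
  fin_cases t <;> rfl

/-- The curvature tensor of an Einstein metric is divergence free. -/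
lemma sum_h_mul_div_Rm (hG : G.IsEinstein ρ) (j k l : Fin n) :
    ∑ a, ∑ b, G.h a b * G.nab a G.Rm ![j, b, k, l] = 0 := by
  have h : ∀ a b, G.nab a G.Rm ![j, b, k, l] =
      G.nab l G.Rm ![k, a, j, b] - G.nab k G.Rm ![l, a, j, b] := by
    intro a b
    have h1 := G.nab_Rm_bianchi a k l j b
    rw [G.nab_Rm_antisymm l a k] at h1
    rw [G.nab_Rm_pair a j b]
    linear_combination h1
  simp only [h, mul_sub, Finset.sum_sub_distrib, sum_h_mul_nab_Rm hG, sub_zero]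

lemma sum_h_mul_cov_div_Rm (hG : G.IsEinstein ρ) (i j k l : Fin n) :
    ∑ a, ∑ b, G.h a b * G.cov (G.cov G.Rm) ![i, a, j, b, k, l] = 0 := by
  let σ : Fin 5 ≃ Fin 5 := Equiv.ofBijective ![0, 2, 1, 3, 4] (by decide)
  have h1 : contractWith G.h (fun J => G.cov G.Rm (J ∘ σ)) = 0 := by
    ext J
    rw [contractWith, Pi.zero_apply, ← sum_h_mul_div_Rm hG (J 0) (J 1) (J 2)]
    refine Finset.sum_congr rfl fun a _ => Finset.sum_congr rfl fun b _ => ?_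
    congr 1
  have h2 := G.nab_contract i (fun J => G.cov G.Rm (J ∘ σ)) ![j, k, l]
  rw [h1, nab_zero, Pi.zero_apply, contractWith] at h2
  rw [h2]
  refine Finset.sum_congr rfl fun a _ => Finset.sum_congr rfl fun b _ => ?_
  rw [nab_perm, ← cov_cons]
  congr 2
  ext t
  fin_cases t <;> rfl

/-- The Laplacian of the curvature tensor of an Einstein metric, by the second Bianchi identity and
the Ricci identity. -/
lemma laplacian_Rm (hG : G.IsEinstein ρ) (i j k l : Fin n) :
    ∑ a, ∑ b, G.h a b * G.cov (G.cov G.Rm) ![a, b, i, j, k, l] =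
      ∑ a, ∑ b, G.h a b * (act (G.K a i) G.Rm ![j, b, k, l] + act (G.K a j) G.Rm ![b, i, k, l]) :=
          by
  have h : ∀ a b, G.cov (G.cov G.Rm) ![a, b, i, j, k, l] =
      act (G.K a i) G.Rm ![j, b, k, l] + act (G.K a j) G.Rm ![b, i, k, l]
      - G.cov (G.cov G.Rm) ![i, a, j, b, k, l] + G.cov (G.cov G.Rm) ![j, a, i, b, k, l] := by
    intro a b
    have h1 := G.cov_cov_Rm_bianchi a b i j k l
    have h2 : G.cov (G.cov G.Rm) ![a, i, j, b, k, l] - G.cov (G.cov G.Rm) ![i, a, j, b, k, l] = _ :=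
      G.cov_cov_sub G.Rm a i ![j, b, k, l]
    have h3 : G.cov (G.cov G.Rm) ![a, j, b, i, k, l] - G.cov (G.cov G.Rm) ![j, a, b, i, k, l] = _ :=
      G.cov_cov_sub G.Rm a j ![b, i, k, l]
    rw [G.cov_cov_Rm_antisymm j a b i] at h3
    linear_combination h1 - h2 - h3
  simp only [h, mul_add, mul_sub, Finset.sum_add_distrib, Finset.sum_sub_distrib,
    sum_h_mul_cov_div_Rm hG]
  ring

variable (G)

lemma K_apply (a i p q : Fin n) : G.K a i p q = ∑ m, G.h p m * G.Rm ![a, i, m, q] := by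
  have : G.K a i = G.h * (G.g * G.K a i) := by
    rw [← Matrix.mul_assoc, G.h_mul_g, Matrix.one_mul]
  rw [this, Matrix.mul_apply]
  rfl

end MetricAlgebra

/-! ### Components in a frame -/

section Frame

variable {n k l m : ℕ}

/-- The double contraction of `R ⊗ R` with free indices `I`; the functions `u` and `v` say which of
the eight indices, four contracted and four free, are those of the two factors. -/
def quadratic {𝒜 : Type*} [CommRing 𝒜] (u v : Fin 4 → Fin 8) (h : Matrix (Fin n) (Fin n) 𝒜)
    (R : (Fin 4 → Fin n) → 𝒜) : (Fin 4 → Fin n) → 𝒜 :=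
  contractWith h (contractWith h fun J => R (J ∘ u) * R (J ∘ v))

/-- The expression in the curvature tensor `R` that gives the Laplacian of the curvature tensor of
an Einstein metric with inverse `h`. -/
def laplacianForm {𝒜 : Type*} [CommRing 𝒜] (h : Matrix (Fin n) (Fin n) 𝒜)
    (R : (Fin 4 → Fin n) → 𝒜) (I : Fin 4 → Fin n) : 𝒜 :=
  quadratic ![2, 4, 1, 5] ![0, 3, 6, 7] h R I + quadratic ![2, 4, 1, 3] ![5, 0, 6, 7] h R I
    + quadratic ![2, 4, 1, 6] ![5, 3, 0, 7] h R I + quadratic ![2, 4, 1, 7] ![5, 3, 6, 0] h R I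
    + quadratic ![2, 5, 1, 3] ![0, 4, 6, 7] h R I + quadratic ![2, 5, 1, 4] ![3, 0, 6, 7] h R I
    + quadratic ![2, 5, 1, 6] ![3, 4, 0, 7] h R I + quadratic ![2, 5, 1, 7] ![3, 4, 6, 0] h R I

lemma MetricAlgebra.laplacian_Rm_eq {𝒜 : Type*} [CommRing 𝒜] [Algebra ℝ 𝒜]
    {G : MetricAlgebra n 𝒜} {ρ : ℝ} (hG : G.IsEinstein ρ) (I : Fin 4 → Fin n) :
    contractWith G.h (G.cov (G.cov G.Rm)) I = laplacianForm G.h G.Rm I := by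
  have h := laplacian_Rm hG (I 0) (I 1) (I 2) (I 3)
  have hq : ∀ u v : Fin 4 → Fin 8, quadratic u v G.h G.Rm I = ∑ a, ∑ b, G.h a b *
      ∑ p, ∑ m, G.h p m * (G.Rm (![p, m, a, b, I 0, I 1, I 2, I 3] ∘ u) *
        G.Rm (![p, m, a, b, I 0, I 1, I 2, I 3] ∘ v)) := by
    intro u v
    rw [eq_vec_four I]
    rfl
  have h0 : ∀ (a : Fin n) (i q : Fin n) (f : Fin n → 𝒜), ∑ p, G.K a i p q * f p =
      ∑ p, ∑ m, G.h p m * (G.Rm ![a, i, m, q] * f p) := by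
    intro a i q f
    refine Finset.sum_congr rfl fun p _ => ?_
    rw [K_apply, Finset.sum_mul]
    exact Finset.sum_congr rfl fun m _ => mul_assoc _ _ _
  have hl : contractWith G.h (G.cov (G.cov G.Rm)) I =
      ∑ a, ∑ b, G.h a b * G.cov (G.cov G.Rm) ![a, b, I 0, I 1, I 2, I 3] := by
    rw [eq_vec_four I]
    rfl
  rw [hl, h]
  simp only [act_four, h0, laplacianForm, hq, mul_add, Finset.sum_add_distrib]
  have hc : ∀ (J : Fin 8 → Fin n) (a b c d : Fin 8), J ∘ ![a, b, c, d] =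
      ![J a, J b, J c, J d] := by
    intro J a b c d
    ext t
    fin_cases t <;> rfl
  simp only [hc, Matrix.cons_val]
  ring

/-- The components `T(b_{A₁}, …, b_{Aₖ})` of a tensor in the frame with components `B a i` of
`b_a`. -/
def inFrame (B : Fin n → Fin n → ℝ) (T : (Fin k → Fin n) → ℝ) (A : Fin k → Fin n) : ℝ :=
  ∑ I : Fin k → Fin n, (∏ s, B (A s) (I s)) * T I

variable {B : Fin n → Fin n → ℝ}

lemma inFrame_add (T S : (Fin k → Fin n) → ℝ) :
    inFrame B (T + S) = inFrame B T + inFrame B S := by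
  ext A
  simp [inFrame, mul_add, Finset.sum_add_distrib]

lemma inFrame_neg (T : (Fin k → Fin n) → ℝ) : inFrame B (-T) = -inFrame B T := by
  ext A
  simp [inFrame]

lemma inFrame_perm (σ : Fin k ≃ Fin k) (T : (Fin k → Fin n) → ℝ) (A : Fin k → Fin n) :
    inFrame B (fun J => T (J ∘ σ)) A = inFrame B T (A ∘ σ) := by
  rw [inFrame, inFrame]
  conv_rhs => rw [← Equiv.sum_comp (Equiv.arrowCongr σ.symm (Equiv.refl (Fin n)))]
  refine Finset.sum_congr rfl fun J _ => ?_
  rw [← Equiv.prod_comp σ]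
  rfl

lemma inFrame_contractWith {h : Matrix (Fin n) (Fin n) ℝ}
    (hB : ∀ a b, h a b = ∑ c, B c a * B c b) (T : (Fin (k + 2) → Fin n) → ℝ) (A : Fin k → Fin n) :
    inFrame B (contractWith h T) A = ∑ c, inFrame B T (Fin.cons c (Fin.cons c A)) := by
  have e : ∀ c, inFrame B T (Fin.cons c (Fin.cons c A)) = ∑ I : Fin k → Fin n, ∑ a, ∑ b,
      (∏ s, B (A s) (I s)) * (B c a * B c b * T (Fin.cons a (Fin.cons b I))) := by
    intro c
    rw [inFrame, sum_fun_succ, Finset.sum_congr rfl fun a _ => sum_fun_succ _]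
    simp only [Fin.prod_univ_succ (n := k + 1), Fin.prod_univ_succ (n := k), Fin.cons_zero,
      Fin.cons_succ]
    rw [Finset.sum_congr rfl fun a _ => Finset.sum_comm, Finset.sum_comm]
    exact Finset.sum_congr rfl fun I _ => Finset.sum_congr rfl fun a _ =>
      Finset.sum_congr rfl fun b _ => by ring
  simp only [e]
  rw [Finset.sum_comm]
  refine Finset.sum_congr rfl fun I _ => ?_
  simp only [contractWith, Finset.mul_sum, hB, Finset.sum_mul]
  rw [Finset.sum_congr rfl fun a _ => Finset.sum_comm, Finset.sum_comm]

lemma inFrame_mul {r : ℕ} (e : Fin k ⊕ Fin l ≃ Fin r) (T : (Fin k → Fin n) → ℝ)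
    (S : (Fin l → Fin n) → ℝ) (A : Fin r → Fin n) :
    inFrame B (fun J => T (J ∘ e ∘ Sum.inl) * S (J ∘ e ∘ Sum.inr)) A =
      inFrame B T (A ∘ e ∘ Sum.inl) * inFrame B S (A ∘ e ∘ Sum.inr) := by
  rw [inFrame, inFrame, inFrame, Finset.sum_mul_sum, ← Fintype.sum_prod_type',
    ← Equiv.sum_comp ((Equiv.arrowCongr e (Equiv.refl (Fin n))).symm.trans
      (Equiv.sumArrowEquivProdArrow (Fin k) (Fin l) (Fin n)))]
  refine Finset.sum_congr rfl fun J _ => ?_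
  rw [← Equiv.prod_comp e, Fintype.prod_sum_type]
  change (_ * _) * (_ * _) = (∏ s, B (A (e (Sum.inl s))) (J (e (Sum.inl s)))) * _
    * ((∏ s, B (A (e (Sum.inr s))) (J (e (Sum.inr s)))) * _)
  exact mul_mul_mul_comm _ _ _ _

lemma inFrame_quadratic {h : Matrix (Fin n) (Fin n) ℝ} (hB : ∀ a b, h a b = ∑ c, B c a * B c b)
    {u v : Fin 4 → Fin 8} (huv : Function.Bijective (Sum.elim u v)) (R : (Fin 4 → Fin n) → ℝ)
    (A : Fin 4 → Fin n) : inFrame B (quadratic u v h R) A = ∑ a, ∑ p,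
      inFrame B R (![p, p, a, a, A 0, A 1, A 2, A 3] ∘ u) *
      inFrame B R (![p, p, a, a, A 0, A 1, A 2, A 3] ∘ v) := by
  rw [quadratic, inFrame_contractWith hB]
  refine Finset.sum_congr rfl fun a _ => ?_
  rw [inFrame_contractWith hB]
  refine Finset.sum_congr rfl fun p _ => ?_
  have := inFrame_mul (B := B) (Equiv.ofBijective (Sum.elim u v) huv) R R
    (Fin.cons p (Fin.cons p (Fin.cons a (Fin.cons a A))))
  refine this.trans ?_
  rw [MetricAlgebra.eq_vec_four A]
  rfl

end Frame

/-- The trilinear contraction of an algebraic Einstein curvature tensor with the expression for its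
Laplacian. -/
lemma sum_laplacian_mul {n : ℕ} {W : Fin n → Fin n → Fin n → Fin n → ℝ} (hW : IsCurvatureTensor W)
    {ρ : ℝ} (hric : ∀ i k, ∑ j, W i j k j = ρ * delta n i k) :
    ∑ i, ∑ j, ∑ k, ∑ l, (∑ a, ∑ p, (W a i p j * W p a k l + W a i p a * W j p k l
      + W a i p k * W j a p l + W a i p l * W j a k p + W a j p a * W p i k l
      + W a j p i * W a p k l + W a j p k * W a i p l + W a j p l * W a i k p)) * W i j k l =
    2 * ρ * normSq W - cubicA W - 4 * cubicB W := by
  have hr : ∀ (i : Fin n) (f : Fin n → ℝ), ∑ a, ∑ p, W a i p a * f p = -(ρ * f i) := by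
    intro i f
    rw [Finset.sum_comm]
    have : ∀ p, ∑ a, W a i p a * f p = -(ρ * (delta n i p * f p)) := by
      intro p
      rw [← Finset.sum_mul, Finset.sum_congr rfl fun a _ => hW.antisymm a i p a,
        Finset.sum_neg_distrib, hric]
      ring
    rw [Finset.sum_congr rfl fun p _ => this p, Finset.sum_neg_distrib, ← Finset.mul_sum,
      sum_delta_mul]
  have e2 : ∑ x : Fin 6 → Fin n, W (x 4) (x 0) (x 5) (x 4) * W (x 1) (x 5) (x 2) (x 3) *
      W (x 0) (x 1) (x 2) (x 3) = ρ * normSq W := by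
    rw [sum_fun_six fun i j k l a p => W a i p a * W j p k l * W i j k l, normSq, sum_fun_four]
    simp only [mul_assoc, hr, Finset.mul_sum]
    refine Finset.sum_congr rfl fun i _ => Finset.sum_congr rfl fun j _ =>
      Finset.sum_congr rfl fun k _ => Finset.sum_congr rfl fun l _ => ?_
    dsimp
    rw [hW.antisymm j i]
    ring
  have e5 : ∑ x : Fin 6 → Fin n, W (x 4) (x 1) (x 5) (x 4) * W (x 5) (x 0) (x 2) (x 3) *
      W (x 0) (x 1) (x 2) (x 3) = ρ * normSq W := by
    rw [← e2, ← sum_rename ![1, 0, 2, 3, 4, 5] (by decide)]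
    refine Finset.sum_congr rfl fun x _ => ?_
    dsimp
    rw [hW.antisymm (x 5), hW.antisymm (x 1) (x 0)]
    ring
  have e1 : 2 * ∑ x : Fin 6 → Fin n, W (x 4) (x 0) (x 5) (x 1) * W (x 5) (x 4) (x 2) (x 3) *
      W (x 0) (x 1) (x 2) (x 3) = -cubicA W := by
    have h := sum_rename ![0, 1, 2, 3, 5, 4] (by decide) fun x : Fin 6 → Fin n =>
      W (x 4) (x 0) (x 5) (x 1) * W (x 5) (x 4) (x 2) (x 3) * W (x 0) (x 1) (x 2) (x 3)
    dsimp at h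
    rw [two_mul, cubicA, ← Finset.sum_neg_distrib]
    conv_lhs => lhs; rw [← h]
    rw [← Finset.sum_add_distrib]
    refine Finset.sum_congr rfl fun x _ => ?_
    have h1 : W (x 4) (x 0) (x 5) (x 1) - W (x 5) (x 0) (x 4) (x 1) =
        W (x 4) (x 5) (x 0) (x 1) := by
      linarith [hW.bianchi (x 4) (x 0) (x 5) (x 1), hW.pair (x 5) (x 0) (x 4) (x 1),
        hW.antisymm_right (x 4) (x 5) (x 0) (x 1), hW.antisymm_right (x 4) (x 1) (x 0) (x 5)]
    rw [hW.pair (x 2) (x 3), hW.antisymm (x 5) (x 4) (x 2), ← h1]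
    ring
  have e6 : ∑ x : Fin 6 → Fin n, W (x 4) (x 1) (x 5) (x 0) * W (x 4) (x 5) (x 2) (x 3) *
      W (x 0) (x 1) (x 2) (x 3) = ∑ x : Fin 6 → Fin n, W (x 4) (x 0) (x 5) (x 1) *
        W (x 5) (x 4) (x 2) (x 3) * W (x 0) (x 1) (x 2) (x 3) := by
    rw [← sum_rename ![1, 0, 2, 3, 4, 5] (by decide)]
    refine Finset.sum_congr rfl fun x _ => ?_
    dsimp
    rw [hW.antisymm (x 5), hW.antisymm (x 1) (x 0)]
    ring
  have e3 : ∑ x : Fin 6 → Fin n, W (x 4) (x 0) (x 5) (x 2) * W (x 1) (x 4) (x 5) (x 3) *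
      W (x 0) (x 1) (x 2) (x 3) = -cubicB W := by
    rw [cubicB, ← Finset.sum_neg_distrib]
    refine Finset.sum_congr rfl fun x _ => ?_
    rw [hW.antisymm (x 4), hW.antisymm_right (x 0) (x 4), hW.antisymm_right (x 1) (x 4)]
    ring
  have e4 : ∑ x : Fin 6 → Fin n, W (x 4) (x 0) (x 5) (x 3) * W (x 1) (x 4) (x 2) (x 5) *
      W (x 0) (x 1) (x 2) (x 3) = -cubicB W := by
    rw [← e3, ← sum_rename ![0, 1, 3, 2, 4, 5] (by decide)]
    refine Finset.sum_congr rfl fun x _ => ?_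
    dsimp
    rw [hW.antisymm_right (x 1) (x 4), hW.antisymm_right (x 0) (x 1)]
    ring
  have e7 : ∑ x : Fin 6 → Fin n, W (x 4) (x 1) (x 5) (x 2) * W (x 4) (x 0) (x 5) (x 3) *
      W (x 0) (x 1) (x 2) (x 3) = -cubicB W := by
    rw [← e3, ← sum_rename ![1, 0, 2, 3, 4, 5] (by decide)]
    refine Finset.sum_congr rfl fun x _ => ?_
    dsimp
    rw [hW.antisymm (x 1) (x 4), hW.antisymm (x 1) (x 0)]
    ring
  have e8 : ∑ x : Fin 6 → Fin n, W (x 4) (x 1) (x 5) (x 3) * W (x 4) (x 0) (x 2) (x 5) *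
      W (x 0) (x 1) (x 2) (x 3) = -cubicB W := by
    rw [← e3]
    refine Finset.sum_congr rfl fun x _ => ?_
    rw [hW.antisymm (x 1) (x 4), hW.antisymm_right (x 4) (x 0)]
    ring
  simp only [Finset.sum_mul]
  rw [← sum_fun_six fun i j k l a p => (W a i p j * W p a k l + W a i p a * W j p k l
      + W a i p k * W j a p l + W a i p l * W j a k p + W a j p a * W p i k l
      + W a j p i * W a p k l + W a j p k * W a i p l + W a j p l * W a i k p) * W i j k l]
  simp only [add_mul, Finset.sum_add_distrib, e2, e3, e4, e5, e6, e7, e8]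
  linarith

/-! ### The curvature tensor and its Laplacian in an orthonormal frame -/

section Point

variable {n : ℕ} {𝒜 : Type*} [CommRing 𝒜] [Algebra ℝ 𝒜] {G : MetricAlgebra n 𝒜}
  {B : Fin n → Fin n → ℝ} {ρ : ℝ}

/-- The evaluation at a point of the inverse metric, in terms of an orthonormal frame. -/
lemma MetricAlgebra.eval_h_eq (ev : 𝒜 →ₐ[ℝ] ℝ)
    (hB : ∀ i k, ∑ a, ∑ b, B i a * B k b * ev (G.g a b) = delta n i k) (a b : Fin n) :
    ev (G.h a b) = ∑ c, B c a * B c b := by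
  set M : Matrix (Fin n) (Fin n) ℝ := Matrix.of B
  set g : Matrix (Fin n) (Fin n) ℝ := G.g.map ev
  set h : Matrix (Fin n) (Fin n) ℝ := G.h.map ev
  have h1 : M * (g * M.transpose) = 1 := by
    ext i k
    rw [Matrix.one_apply, ← delta, ← hB, Matrix.mul_apply]
    refine Finset.sum_congr rfl fun a _ => ?_
    rw [Matrix.mul_apply, Finset.mul_sum]
    refine Finset.sum_congr rfl fun b _ => ?_
    simp only [M, g, Matrix.of_apply, Matrix.map_apply, Matrix.transpose_apply]
    ring
  have h2 : g * (M.transpose * M) = 1 := by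
    rw [← Matrix.mul_assoc]
    exact mul_eq_one_comm.1 h1
  have h3 : h * g = 1 := by
    have := congrArg (fun X : Matrix (Fin n) (Fin n) 𝒜 => X.map ev) G.h_mul_g
    simpa [Matrix.map_mul] using this
  have h4 : h = M.transpose * M := by
    rw [← Matrix.mul_one h, ← h2, ← Matrix.mul_assoc, h3, Matrix.one_mul]
  have h5 := congrFun (congrFun h4 a) b
  rw [Matrix.mul_apply] at h5
  exact h5

/-- The components of the curvature tensor at a point in an orthonormal frame form an algebraic
curvature tensor. -/
lemma MetricAlgebra.isCurvatureTensor_inFrame (ev : 𝒜 →ₐ[ℝ] ℝ) :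
    IsCurvatureTensor fun i j k l => inFrame B (fun J => ev (G.Rm J)) ![i, j, k, l] where
  antisymm i j k l := by
    have h : (fun J => (fun J => ev (G.Rm J)) (J ∘ Equiv.ofBijective ![1, 0, 2, 3] (by decide))) =
        -fun J => ev (G.Rm J) := by
      ext J
      rw [Pi.neg_apply]
      conv_rhs => rw [eq_vec_four J]
      rw [← map_neg, ← G.Rm_antisymm, eq_vec_four (J ∘ _)]
      rfl
    have h2 := inFrame_perm (B := B) (Equiv.ofBijective ![1, 0, 2, 3] (by decide))
      (fun J => ev (G.Rm J)) ![j, i, k, l]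
    rw [h, inFrame_neg, Pi.neg_apply] at h2
    rw [h2]
    congr 1
    ext t
    fin_cases t <;> rfl
  pair i j k l := by
    have h : (fun J => (fun J => ev (G.Rm J)) (J ∘ Equiv.ofBijective ![2, 3, 0, 1] (by decide))) =
        fun J => ev (G.Rm J) := by
      ext J
      conv_rhs => rw [eq_vec_four J]
      rw [← G.Rm_pair, eq_vec_four (J ∘ _)]
      rfl
    have h2 := inFrame_perm (B := B) (Equiv.ofBijective ![2, 3, 0, 1] (by decide))
      (fun J => ev (G.Rm J)) ![i, j, k, l]
    rw [h] at h2
    rw [h2]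
    congr 1
    ext t
    fin_cases t <;> rfl
  bianchi i j k l := by
    let σ : Fin 4 ≃ Fin 4 := Equiv.ofBijective ![0, 2, 3, 1] (by decide)
    let τ : Fin 4 ≃ Fin 4 := Equiv.ofBijective ![0, 3, 1, 2] (by decide)
    have h : (fun J => ev (G.Rm J)) + (fun J => (fun J => ev (G.Rm J)) (J ∘ σ))
        + (fun J => (fun J => ev (G.Rm J)) (J ∘ τ)) = 0 := by
      ext J
      have e1 : J ∘ σ = ![J 0, J 2, J 3, J 1] := by
        ext t; fin_cases t <;> rfl
      have e2 : J ∘ τ = ![J 0, J 3, J 1, J 2] := by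
        ext t; fin_cases t <;> rfl
      simp only [Pi.add_apply, Pi.zero_apply, e1, e2]
      rw [eq_vec_four J, ← map_add, ← map_add]
      convert map_zero ev
      simp only [Matrix.cons_val]
      have h1 := G.Rm_bianchi (J 2) (J 3) (J 1) (J 0)
      rwa [G.Rm_pair (J 2) (J 3) (J 0), G.Rm_pair (J 3) (J 1) (J 0),
        G.Rm_pair (J 1) (J 2) (J 0)] at h1
    have h2 := congrFun (congrArg (inFrame B) h) ![i, j, k, l]
    rw [inFrame_add, inFrame_add, Pi.add_apply, Pi.add_apply,
      inFrame_perm σ fun J => ev (G.Rm J), inFrame_perm τ fun J => ev (G.Rm J)] at h2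
    have e1 : ![i, j, k, l] ∘ σ = ![i, k, l, j] := by
      ext t; fin_cases t <;> rfl
    have e2 : ![i, j, k, l] ∘ τ = ![i, l, j, k] := by
      ext t; fin_cases t <;> rfl
    rw [e1, e2] at h2
    rw [h2]
    simp [inFrame]

lemma MetricAlgebra.inFrame_metric (ev : 𝒜 →ₐ[ℝ] ℝ)
    (hB : ∀ i k, ∑ a, ∑ b, B i a * B k b * ev (G.g a b) = delta n i k) (i k : Fin n) :
    inFrame B (fun J => ev (G.metric J)) ![i, k] = delta n i k := by
  rw [← hB, inFrame, sum_fun_succ, Finset.sum_congr rfl fun a _ => sum_fun_succ _]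
  simp [Fin.prod_univ_two]
  rfl

/-- The Ricci curvature of an Einstein metric at a point in an orthonormal frame. -/
lemma MetricAlgebra.sum_inFrame_Rm (hG : G.IsEinstein ρ) (ev : 𝒜 →ₐ[ℝ] ℝ)
    (hB : ∀ i k, ∑ a, ∑ b, B i a * B k b * ev (G.g a b) = delta n i k) (i k : Fin n) :
    ∑ j, inFrame B (fun J => ev (G.Rm J)) ![i, j, k, j] = ρ * delta n i k := by
  let σ : Fin 4 ≃ Fin 4 := Equiv.ofBijective ![2, 0, 3, 1] (by decide)
  have h1 : contractWith (G.h.map ev) (fun J => (fun J => ev (G.Rm J)) (J ∘ σ)) =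
      fun J => ρ * ev (G.metric J) := by
    ext J
    have h2 := congrArg ev (hG (J 0) (J 1))
    simp only [map_sum, map_mul, AlgHom.commutes] at h2
    rw [metric]
    refine Eq.trans ?_ h2
    refine Finset.sum_congr rfl fun a _ => Finset.sum_congr rfl fun b _ => ?_
    simp only [Matrix.map_apply]
    congr 3
  have h2 := inFrame_contractWith (B := B) (h := G.h.map ev) (G.eval_h_eq ev hB)
    (fun J => (fun J => ev (G.Rm J)) (J ∘ σ)) ![i, k]
  have h3 : inFrame B (fun J => ρ * ev (G.metric J)) ![i, k] = ρ * delta n i k := by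
    rw [← G.inFrame_metric ev hB, inFrame, inFrame, Finset.mul_sum]
    exact Finset.sum_congr rfl fun J _ => by ring
  rw [h1, h3] at h2
  rw [h2]
  refine Finset.sum_congr rfl fun c _ => ?_
  rw [inFrame_perm σ fun J => ev (G.Rm J)]
  congr 1
  ext t
  fin_cases t <;> rfl

lemma map_quadratic {𝒞 ℬ : Type*} [CommRing 𝒞] [CommRing ℬ] (ev : 𝒞 →+* ℬ) (u v : Fin 4 → Fin 8)
    (h : Matrix (Fin n) (Fin n) 𝒞) (R : (Fin 4 → Fin n) → 𝒞) (I : Fin 4 → Fin n) :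
    ev (quadratic u v h R I) = quadratic u v (h.map ev) (fun J => ev (R J)) I := by
  simp [quadratic, contractWith]

/-- `⟨ΔR, R⟩` for an Einstein metric, at a point and in terms of the curvature tensor. -/
theorem MetricAlgebra.tensorInner_laplacian (hG : G.IsEinstein ρ) (ev : 𝒜 →ₐ[ℝ] ℝ)
    (hB : ∀ i k, ∑ a, ∑ b, B i a * B k b * ev (G.g a b) = delta n i k)
    {W : Fin n → Fin n → Fin n → Fin n → ℝ}
    (hW : W = fun i j k l => inFrame B (fun J => ev (G.Rm J)) ![i, j, k, l]) :
    tensorInner (inFrame B fun I => ev (contractWith G.h (G.cov (G.cov G.Rm)) I))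
      (inFrame B fun J => ev (G.Rm J)) =
    2 * ρ * normSq W - cubicA W - 4 * cubicB W := by
  have hc : IsCurvatureTensor W := hW ▸ G.isCurvatureTensor_inFrame ev
  rw [← sum_laplacian_mul hc (ρ := ρ) (by rw [hW]; exact sum_inFrame_Rm hG ev hB), tensorInner,
    sum_fun_four]
  refine Finset.sum_congr rfl fun i _ => Finset.sum_congr rfl fun j _ =>
    Finset.sum_congr rfl fun k _ => Finset.sum_congr rfl fun l _ => ?_
  congr 1
  · have h1 : (fun I => ev (contractWith G.h (G.cov (G.cov G.Rm)) I)) =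
        laplacianForm (G.h.map ev) (fun J => ev (G.Rm J)) := by
      ext I
      rw [laplacian_Rm_eq hG, laplacianForm]
      simp only [map_add]
      have := fun u v => map_quadratic (ev : 𝒜 →+* ℝ) u v G.h G.Rm I
      simp only [RingHom.coe_coe] at this
      simp only [this]
      rfl
    have h2 : ∀ (u v : Fin 4 → Fin 8), Function.Bijective (Sum.elim u v) →
        inFrame B (quadratic u v (G.h.map ev) fun J => ev (G.Rm J)) ![i, j, k, l] =
        ∑ a, ∑ p, inFrame B (fun J => ev (G.Rm J)) (![p, p, a, a, i, j, k, l] ∘ u) *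
          inFrame B (fun J => ev (G.Rm J)) (![p, p, a, a, i, j, k, l] ∘ v) :=
      fun u v huv => inFrame_quadratic (G.eval_h_eq ev hB) huv _ _
    have h3 : ∀ a b : (Fin 4 → Fin n) → ℝ, (fun I => a I + b I) = a + b := fun _ _ => rfl
    rw [h1]
    have h4 : laplacianForm (G.h.map ev) (fun J => ev (G.Rm J)) = _ + _ + _ + _ + _ + _ + _ + _ :=
      rfl
    rw [h4]
    simp only [inFrame_add, Pi.add_apply]
    rw [h2 _ _ (by decide), h2 _ _ (by decide), h2 _ _ (by decide), h2 _ _ (by decide),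
      h2 _ _ (by decide), h2 _ _ (by decide), h2 _ _ (by decide), h2 _ _ (by decide)]
    have hv : ∀ (J : Fin 8 → Fin n) (a b c d : Fin 8), J ∘ ![a, b, c, d] =
        ![J a, J b, J c, J d] := by
      intro J a b c d
      ext t
      fin_cases t <;> rfl
    simp only [hv, Matrix.cons_val, Finset.sum_add_distrib, hW]
  · rw [hW]

end Point

/-! ### Smooth functions on an open subset of `ℝⁿ` -/

section Smooth

open TopologicalSpace

variable {n : ℕ}

/-- The extension by zero of a function on an open set. Smoothness and derivatives on the set are
expressed through it; the values outside do not matter. -/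
noncomputable def extendZero {U : Opens (EuclideanSpace ℝ (Fin n))} (f : U → ℝ)
    (y : EuclideanSpace ℝ (Fin n)) : ℝ :=
  open Classical in if h : y ∈ U then f ⟨y, h⟩ else 0

variable {U : Opens (EuclideanSpace ℝ (Fin n))}

lemma extendZero_of_mem (f : U → ℝ) (y : U) : extendZero f y = f y := by
  simp [extendZero]

lemma extendZero_add (f f' : U → ℝ) : extendZero (f + f') = extendZero f + extendZero f' := by
  ext y
  by_cases h : y ∈ U <;> simp [extendZero, h]

lemma extendZero_mul (f f' : U → ℝ) : extendZero (f * f') = extendZero f * extendZero f' := by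
  ext y
  by_cases h : y ∈ U <;> simp [extendZero, h]

lemma extendZero_smul (c : ℝ) (f : U → ℝ) : extendZero (c • f) = c • extendZero f := by
  ext y
  by_cases h : y ∈ U <;> simp [extendZero, h]

lemma extendZero_eventuallyEq {f : U → ℝ} {F : EuclideanSpace ℝ (Fin n) → ℝ}
    (h : ∀ y : U, f y = F y) (y : U) : extendZero f =ᶠ[nhds (y : EuclideanSpace ℝ (Fin n))] F := by
  filter_upwards [U.isOpen.mem_nhds y.2] with z hz
  exact (extendZero_of_mem f ⟨z, hz⟩).trans (h ⟨z, hz⟩)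

lemma contDiffOn_extendZero {f : U → ℝ} {F : EuclideanSpace ℝ (Fin n) → ℝ}
    (h : ∀ y : U, f y = F y) (hF : ContDiffOn ℝ ∞ F U) : ContDiffOn ℝ ∞ (extendZero f) U :=
  hF.congr fun y hy => (extendZero_of_mem f ⟨y, hy⟩).trans (h ⟨y, hy⟩)

/-- The algebra of smooth functions on an open subset `U` of `ℝⁿ`. -/
noncomputable def smoothAlgebra (U : Opens (EuclideanSpace ℝ (Fin n))) : Subalgebra ℝ (U → ℝ) where
  carrier := {f | ContDiffOn ℝ ∞ (extendZero f) U}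
  mul_mem' := by
    intro f f' hf hf'
    rw [Set.mem_ofPred_eq, extendZero_mul]
    exact ContDiffOn.mul hf hf'
  add_mem' := by
    intro f f' hf hf'
    rw [Set.mem_ofPred_eq, extendZero_add]
    exact ContDiffOn.add hf hf'
  algebraMap_mem' c :=
    contDiffOn_extendZero (F := fun _ => c) (fun _ => rfl) contDiffOn_const

lemma smoothAlgebra_contDiffAt (f : smoothAlgebra U) (y : U) :
    ContDiffAt ℝ ∞ (extendZero f.1) y :=
  (f.2 : ContDiffOn ℝ ∞ (extendZero f.1) U).contDiffAt (U.isOpen.mem_nhds y.2)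

lemma smoothAlgebra_differentiableAt (f : smoothAlgebra U) (y : U) :
    DifferentiableAt ℝ (extendZero f.1) y :=
  (smoothAlgebra_contDiffAt f y).differentiableAt (by simp)

lemma contDiffOn_pderiv {F : EuclideanSpace ℝ (Fin n) → ℝ} (hF : ContDiffOn ℝ ∞ F U) (i : Fin n) :
    ContDiffOn ℝ ∞ (pderiv i F) U :=
  (hF.fderiv_of_isOpen U.isOpen (by simp)).clm_apply contDiffOn_const

/-- Restriction to `U` of a function that is smooth on `U`. -/
noncomputable def restrictSmooth (F : EuclideanSpace ℝ (Fin n) → ℝ) (hF : ContDiffOn ℝ ∞ F U) :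
    smoothAlgebra U :=
  ⟨fun y => F y, contDiffOn_extendZero (fun _ => rfl) hF⟩

/-- The partial derivatives as derivations of the algebra of smooth functions. -/
noncomputable def partialDerivation (U : Opens (EuclideanSpace ℝ (Fin n))) (i : Fin n) :
    Derivation ℝ (smoothAlgebra U) (smoothAlgebra U) :=
  Derivation.mk'
    { toFun := fun f => restrictSmooth (pderiv i (extendZero f.1)) (contDiffOn_pderiv f.2 i)
      map_add' := fun f f' => by
        apply Subtype.ext
        funext y
        change pderiv i (extendZero (f.1 + f'.1)) y = _
        rw [extendZero_add, pderiv, fderiv_add (smoothAlgebra_differentiableAt f y)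
          (smoothAlgebra_differentiableAt f' y)]
        rfl
      map_smul' := fun c f => by
        apply Subtype.ext
        funext y
        change pderiv i (extendZero (c • f.1)) y = _
        rw [extendZero_smul, pderiv, fderiv_const_smul (smoothAlgebra_differentiableAt f y)]
        rfl }
    fun f f' => by
      apply Subtype.ext
      funext y
      change pderiv i (extendZero (f.1 * f'.1)) y =
        f.1 y * pderiv i (extendZero f'.1) y + f'.1 y * pderiv i (extendZero f.1) y
      rw [extendZero_mul, pderiv, fderiv_mul (smoothAlgebra_differentiableAt f y)
          (smoothAlgebra_differentiableAt f' y), extendZero_of_mem, extendZero_of_mem]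
      rfl

lemma partialDerivation_apply (i : Fin n) {f : smoothAlgebra U}
    {F : EuclideanSpace ℝ (Fin n) → ℝ} (h : ∀ y : U, f.1 y = F y) (y : U) :
    (partialDerivation U i f).1 y = pderiv i F y := by
  change pderiv i (extendZero f.1) y = _
  rw [pderiv, (extendZero_eventuallyEq h y).fderiv_eq, pderiv]

lemma partialDerivation_comm (i j : Fin n) (f : smoothAlgebra U) :
    partialDerivation U i (partialDerivation U j f) =
      partialDerivation U j (partialDerivation U i f) := by
  apply Subtype.ext
  funext y
  have e : ∀ i j, (partialDerivation U i (partialDerivation U j f)).1 y =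
      fderiv ℝ (fderiv ℝ (extendZero f.1)) y (EuclideanSpace.single i 1)
        (EuclideanSpace.single j 1) := by
    intro i j
    rw [partialDerivation_apply i (F := pderiv j (extendZero f.1)) (fun _ => rfl) y]
    have h1 : DifferentiableAt ℝ (fderiv ℝ (extendZero f.1)) y :=
      ((smoothAlgebra_contDiffAt f y).fderiv_right (m := 1) (by norm_cast)).differentiableAt
        one_ne_zero
    unfold pderiv
    rw [fderiv_clm_apply h1 (differentiableAt_const _)]
    simp
  rw [e, e]
  have h2 : IsSymmSndFDerivAt ℝ (extendZero f.1) (y : EuclideanSpace ℝ (Fin n)) :=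
    (smoothAlgebra_contDiffAt f y).isSymmSndFDerivAt
      (by rw [minSmoothness_of_isRCLikeNormedField]; norm_cast)
  exact h2 _ _

/-- Evaluation at a point. -/
noncomputable def evalAt (y : U) : smoothAlgebra U →ₐ[ℝ] ℝ :=
  (Pi.evalAlgHom ℝ (fun _ : U => ℝ) y).comp (smoothAlgebra U).val

lemma evalAt_apply (y : U) (f : smoothAlgebra U) : evalAt y f = f.1 y := rfl

lemma isUnit_of_forall_ne_zero {f : smoothAlgebra U} (h : ∀ y, f.1 y ≠ 0) : IsUnit f := by
  refine IsUnit.of_mul_eq_one (restrictSmooth (fun y => (extendZero f.1 y)⁻¹)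
    (ContDiffOn.inv f.2 fun y hy => ?_)) ?_
  · rw [extendZero_of_mem f.1 ⟨y, hy⟩]
    exact h _
  · apply Subtype.ext
    funext y
    change f.1 y * (extendZero f.1 y)⁻¹ = 1
    rw [extendZero_of_mem]
    exact mul_inv_cancel₀ (h y)

section Metric

variable {g : EuclideanSpace ℝ (Fin n) → Matrix (Fin n) (Fin n) ℝ}

/-- The metric with smooth components `g`, as a matrix over the algebra of smooth functions. -/
noncomputable def smoothMetric (hg : ∀ i j, ContDiffOn ℝ ∞ (fun y => g y i j) U) :
    Matrix (Fin n) (Fin n) (smoothAlgebra U) :=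
  Matrix.of fun i j => restrictSmooth (fun y => g y i j) (hg i j)

lemma isUnit_det_smoothMetric (hg : ∀ i j, ContDiffOn ℝ ∞ (fun y => g y i j) U)
    (hdet : ∀ y ∈ U, (g y).det ≠ 0) : IsUnit (smoothMetric hg).det := by
  refine isUnit_of_forall_ne_zero fun y => ?_
  rw [← evalAt_apply, AlgHom.map_det]
  exact hdet y y.2

/-- The metric algebra of a Riemannian metric on an open subset of `ℝⁿ`. -/
noncomputable def smoothMetricAlgebra (hg : ∀ i j, ContDiffOn ℝ ∞ (fun y => g y i j) U)
    (hsymm : ∀ y ∈ U, ∀ i j, g y i j = g y j i) (hdet : ∀ y ∈ U, (g y).det ≠ 0) :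
    MetricAlgebra n (smoothAlgebra U) where
  D := partialDerivation U
  D_comm := partialDerivation_comm
  g := smoothMetric hg
  h := (smoothMetric hg)⁻¹
  g_symm i j := Subtype.ext (funext fun y => hsymm y y.2 i j)
  g_mul_h := Matrix.mul_nonsing_inv _ (isUnit_det_smoothMetric hg hdet)

variable (hg : ∀ i j, ContDiffOn ℝ ∞ (fun y => g y i j) U)
    (hsymm : ∀ y ∈ U, ∀ i j, g y i j = g y j i) (hdet : ∀ y ∈ U, (g y).det ≠ 0)

lemma smoothMetricAlgebra_h (i j : Fin n) (y : U) :
    ((smoothMetricAlgebra hg hsymm hdet).h i j).1 y = (g y)⁻¹ i j := by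
  set G := smoothMetricAlgebra hg hsymm hdet
  have h1 : G.g.map (evalAt y) * G.h.map (evalAt y) = 1 := by
    rw [← Matrix.map_mul, G.g_mul_h]
    simp
  have h2 : (g y)⁻¹ = G.h.map (evalAt y) := Matrix.inv_eq_right_inv h1
  rw [h2]
  rfl

lemma smoothMetricAlgebra_Γ (a p i : Fin n) (y : U) :
    ((smoothMetricAlgebra hg hsymm hdet).Γ a p i).1 y = christoffel g y p a i := by
  set G := smoothMetricAlgebra hg hsymm hdet with hG
  have hD : ∀ a i j, evalAt y (G.D a (G.g i j)) = pderiv a (fun z => g z i j) y := fun a i j =>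
    partialDerivation_apply a (fun _ => rfl) y
  have hh : ∀ i j, evalAt y (G.h i j) = (g y)⁻¹ i j := fun i j =>
    smoothMetricAlgebra_h hg hsymm hdet i j y
  rw [← evalAt_apply, MetricAlgebra.Γ, Matrix.of_apply, christoffel]
  simp only [map_mul, map_sum, map_sub, map_add, hD, hh, AlgHom.commutes]
  rfl

lemma smoothMetricAlgebra_cov {k : ℕ} {T : CoordTensor n k}
    {S : (Fin k → Fin n) → smoothAlgebra U} (hTS : ∀ (y : U) I, (S I).1 y = T y I)
    (y : U) (I : Fin (k + 1) → Fin n) :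
    ((smoothMetricAlgebra hg hsymm hdet).cov S I).1 y = covDeriv g T y I := by
  have hΓ := smoothMetricAlgebra_Γ hg hsymm hdet
  set G := smoothMetricAlgebra hg hsymm hdet with hG
  have hD : ∀ a J, evalAt y (G.D a (S J)) = pderiv a (fun z => T z J) y := fun a J =>
    partialDerivation_apply a (fun y => hTS y J) y
  have hΓ' : ∀ a p i, evalAt y (G.Γ a p i) = christoffel g y p a i := fun a p i => hΓ a p i y
  have hS : ∀ J, evalAt y (S J) = T y J := hTS y
  rw [← evalAt_apply, MetricAlgebra.cov, MetricAlgebra.nab, act, covDeriv]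
  simp only [map_sub, map_sum, map_mul, hD, hΓ', hS]

lemma smoothMetricAlgebra_Rm (y : U) (I : Fin 4 → Fin n) :
    ((smoothMetricAlgebra hg hsymm hdet).Rm I).1 y = riemann g y I := by
  have hΓ := smoothMetricAlgebra_Γ hg hsymm hdet
  set G := smoothMetricAlgebra hg hsymm hdet with hG
  have hD : ∀ a b p i, evalAt y (G.D a (G.Γ b p i)) =
      pderiv a (fun z => christoffel g z p b i) y := fun a b p i =>
    partialDerivation_apply a (fun y => hΓ b p i y) y
  have hΓ' : ∀ a p i, evalAt y (G.Γ a p i) = christoffel g y p a i := fun a p i => hΓ a p i y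
  have hgy : ∀ i j, evalAt y (G.g i j) = g y i j := fun _ _ => rfl
  rw [← evalAt_apply, MetricAlgebra.Rm, riemann, Matrix.mul_apply]
  simp only [MetricAlgebra.K, MetricAlgebra.dMat, Matrix.add_apply, Matrix.sub_apply,
    Matrix.of_apply, Matrix.mul_apply, map_sub, map_add, map_sum, map_mul, hD, hΓ', hgy,
    Finset.sum_sub_distrib]
  refine Finset.sum_congr rfl fun m _ => ?_
  congr 2
  congr 1 <;> exact Finset.sum_congr rfl fun p _ => mul_comm _ _

lemma smoothMetricAlgebra_laplacian (y : U) (I : Fin 4 → Fin n) :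
    (contractWith (smoothMetricAlgebra hg hsymm hdet).h ((smoothMetricAlgebra hg hsymm hdet).cov
      ((smoothMetricAlgebra hg hsymm hdet).cov (smoothMetricAlgebra hg hsymm hdet).Rm)) I).1 y =
      laplacian g (riemann g) y I := by
  have h1 := smoothMetricAlgebra_cov hg hsymm hdet
    (smoothMetricAlgebra_cov hg hsymm hdet (smoothMetricAlgebra_Rm hg hsymm hdet))
  have h2 := smoothMetricAlgebra_h hg hsymm hdet
  set G := smoothMetricAlgebra hg hsymm hdet with hG
  have h1' : ∀ J, evalAt y (G.cov (G.cov G.Rm) J) = _ := h1 y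
  have h2' : ∀ i j, evalAt y (G.h i j) = _ := fun i j => h2 i j y
  rw [← evalAt_apply, contractWith, laplacian]
  simp only [map_sum, map_mul, h1', h2']

/-- The Einstein condition in coordinates. -/
lemma smoothMetricAlgebra_isEinstein {ρ : ℝ} (h : ∀ y ∈ U, ∀ i k, ricci g y i k = ρ * g y i k) :
    (smoothMetricAlgebra hg hsymm hdet).IsEinstein ρ := by
  intro i k
  apply Subtype.ext
  funext y
  have h1 := smoothMetricAlgebra_Rm hg hsymm hdet
  have h2 := smoothMetricAlgebra_h hg hsymm hdet
  set G := smoothMetricAlgebra hg hsymm hdet with hG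
  have h1' : ∀ J, evalAt y (G.Rm J) = _ := h1 y
  have h2' : ∀ i j, evalAt y (G.h i j) = _ := fun i j => h2 i j y
  refine Eq.trans ?_ (h y y.2 i k)
  rw [← evalAt_apply, ricci]
  simp only [map_sum, map_mul, h1', h2']

end Metric

end Smooth

/-! ### Smooth charts -/

section Chart

variable {n : ℕ} {M : Type*} [TopologicalSpace M] [ChartedSpace (EuclideanSpace ℝ (Fin n)) M]
  {e : OpenPartialHomeomorph M (EuclideanSpace ℝ (Fin n))}

lemma mdifferentiable_of_mem_maximalAtlas (he : e ∈ IsManifold.maximalAtlas (𝓡 n) ∞ M) :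
    e.MDifferentiable (𝓡 n) (𝓡 n) :=
  ⟨(contMDiffOn_of_mem_maximalAtlas he).mdifferentiableOn (by simp),
    (contMDiffOn_symm_of_mem_maximalAtlas he).mdifferentiableOn (by simp)⟩

lemma contMDiffOn_coordVector [IsManifold (𝓡 n) ∞ M]
    (he : e ∈ IsManifold.maximalAtlas (𝓡 n) ∞ M) (i : Fin n) :
    ContMDiffOn (𝓡 n) (𝓡 n).tangent ∞
      (fun y => (⟨e.symm y, coordVector e y i⟩ : TangentBundle (𝓡 n) M)) e.target := by
  have h1 := (contMDiffOn_symm_of_mem_maximalAtlas he).contMDiffOn_tangentMapWithin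
    (m := ∞) (by simp) e.open_target.uniqueMDiffOn
  have h2 : ContMDiff (𝓡 n) (𝓡 n).tangent ∞
      (fun y => (⟨y, EuclideanSpace.single i 1⟩ :
        TangentBundle (𝓡 n) (EuclideanSpace ℝ (Fin n)))) :=
    contMDiff_vectorSpace_iff_contDiff.2 contDiff_const
  refine ((h1.comp h2.contMDiffOn (s := e.target) fun y hy => hy)).congr fun y hy => ?_
  simp only [Function.comp_apply, tangentMapWithin, coordVector]
  rw [mfderivWithin_of_isOpen e.open_target hy]

lemma mfderiv_mfderiv_symm (he : e ∈ IsManifold.maximalAtlas (𝓡 n) ∞ M)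
    {y : EuclideanSpace ℝ (Fin n)} (hy : y ∈ e.target) (w : EuclideanSpace ℝ (Fin n)) :
    mfderiv (𝓡 n) (𝓡 n) e (e.symm y) (mfderiv (𝓡 n) (𝓡 n) e.symm y w) = w :=
  DFunLike.congr_fun ((mdifferentiable_of_mem_maximalAtlas he).comp_symm_deriv hy) w

/-- The other composite: a one-sided inverse on a finite-dimensional space is two-sided. -/
lemma mfderiv_symm_mfderiv (he : e ∈ IsManifold.maximalAtlas (𝓡 n) ∞ M)
    {y : EuclideanSpace ℝ (Fin n)} (hy : y ∈ e.target) (v : TangentSpace (𝓡 n) (e.symm y)) :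
    mfderiv (𝓡 n) (𝓡 n) e.symm y (mfderiv (𝓡 n) (𝓡 n) e (e.symm y) v) = v := by
  let S : EuclideanSpace ℝ (Fin n) →L[ℝ] EuclideanSpace ℝ (Fin n) := mfderiv (𝓡 n) (𝓡 n) e.symm y
  let D : EuclideanSpace ℝ (Fin n) →L[ℝ] EuclideanSpace ℝ (Fin n) :=
    mfderiv (𝓡 n) (𝓡 n) e (e.symm y)
  have h : (D : EuclideanSpace ℝ (Fin n) →ₗ[ℝ] EuclideanSpace ℝ (Fin n)) *
      (S : EuclideanSpace ℝ (Fin n) →ₗ[ℝ] EuclideanSpace ℝ (Fin n)) = 1 :=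
    LinearMap.ext fun w => mfderiv_mfderiv_symm he hy w
  exact LinearMap.congr_fun (mul_eq_one_comm.1 h) v

lemma sum_smul_coordVector (y : EuclideanSpace ℝ (Fin n)) (c : Fin n → ℝ) :
    ∑ i, c i • coordVector e y i = mfderiv (𝓡 n) (𝓡 n) e.symm y (WithLp.toLp 2 c) := by
  have h : (WithLp.toLp 2 c : EuclideanSpace ℝ (Fin n)) =
      ∑ i, c i • EuclideanSpace.single i (1 : ℝ) := by
    ext j
    simp [Pi.single_apply]
  rw [h]
  exact ((map_sum (mfderiv (𝓡 n) (𝓡 n) e.symm y) _ _).trans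
    (Finset.sum_congr rfl fun i _ => map_smul (mfderiv (𝓡 n) (𝓡 n) e.symm y) _ _)).symm

lemma sum_coordComponent_smul (he : e ∈ IsManifold.maximalAtlas (𝓡 n) ∞ M)
    {y : EuclideanSpace ℝ (Fin n)} (hy : y ∈ e.target) (v : TangentSpace (𝓡 n) (e.symm y)) :
    ∑ i, coordComponent e v i • coordVector e y i = v := by
  rw [sum_smul_coordVector]
  exact mfderiv_symm_mfderiv he hy v

lemma coordComponent_sum_smul (he : e ∈ IsManifold.maximalAtlas (𝓡 n) ∞ M)
    {y : EuclideanSpace ℝ (Fin n)} (hy : y ∈ e.target) (c : Fin n → ℝ) (j : Fin n) :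
    coordComponent e (∑ i, c i • coordVector e y i) j = c j := by
  rw [sum_smul_coordVector]
  exact congrArg (fun w : EuclideanSpace ℝ (Fin n) => w j) (mfderiv_mfderiv_symm he hy _)

variable [Bundle.RiemannianBundle (fun x : M => TangentSpace (𝓡 n) x)]

lemma chartMetric_symm (y : EuclideanSpace ℝ (Fin n)) (i j : Fin n) :
    chartMetric e y i j = chartMetric e y j i := by
  simp only [chartMetric, Matrix.of_apply]
  exact real_inner_comm _ _

lemma inner_sum_coordVector (y : EuclideanSpace ℝ (Fin n)) (c d : Fin n → ℝ) :
    inner ℝ (∑ i, c i • coordVector e y i) (∑ j, d j • coordVector e y j) =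
      ∑ i, ∑ j, c i * d j * chartMetric e y i j := by
  simp only [sum_inner, inner_sum, real_inner_smul_left, real_inner_smul_right, chartMetric,
    Matrix.of_apply]
  rw [Finset.sum_comm]
  exact Finset.sum_congr rfl fun i _ => Finset.sum_congr rfl fun j _ => by ring

lemma det_chartMetric_ne_zero (he : e ∈ IsManifold.maximalAtlas (𝓡 n) ∞ M)
    {y : EuclideanSpace ℝ (Fin n)} (hy : y ∈ e.target) : (chartMetric e y).det ≠ 0 := by
  intro h
  obtain ⟨c, hc, h0⟩ := Matrix.exists_mulVec_eq_zero_iff.2 h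
  have h1 : inner ℝ (∑ i, c i • coordVector e y i) (∑ j, c j • coordVector e y j) = 0 := by
    rw [inner_sum_coordVector]
    refine Finset.sum_eq_zero fun i _ => ?_
    have := congrFun h0 i
    simp only [Matrix.mulVec, dotProduct, Pi.zero_apply] at this
    have e : ∀ j, c i * c j * chartMetric e y i j = c i * (chartMetric e y i j * c j) := fun j => by
      ring
    simp only [e, ← Finset.mul_sum, this, mul_zero]
  have h2 : ∑ i, c i • coordVector e y i = 0 := inner_self_eq_zero.1 h1
  refine hc (funext fun j => ?_)
  rw [← coordComponent_sum_smul he hy c j, h2]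
  simp only [coordComponent, map_zero]
  rfl

lemma contDiffOn_chartMetric [IsManifold (𝓡 n) ∞ M]
    [IsContMDiffRiemannianBundle (𝓡 n) ∞ (EuclideanSpace ℝ (Fin n))
      (fun x : M => TangentSpace (𝓡 n) x)]
    (he : e ∈ IsManifold.maximalAtlas (𝓡 n) ∞ M) (i j : Fin n) :
    ContDiffOn ℝ ∞ (fun y => chartMetric e y i j) e.target := by
  rw [← contMDiffOn_iff_contDiffOn]
  exact ContMDiffOn.inner_bundle (contMDiffOn_coordVector he i) (contMDiffOn_coordVector he j)

end Chart

end SecondKind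

/-- Throughout, `e` is any smooth chart around `p` and `b` any orthonormal basis of the tangent space
at `p`; `N = n(n+1)/2 - 1`, `μ j` is the eigenvalue `λ_{j+1}` of `R̊` at `p`, and `m` is the mean of
the eigenvalues. -/
theorem proposition3p4 (n : ℕ) (hn : n = 4 ∨ n = 5 ∨ 8 ≤ n)
    (M : Type*) [TopologicalSpace M] [ChartedSpace (EuclideanSpace ℝ (Fin n)) M]
    [IsManifold (𝓡 n) ∞ M]
    [Bundle.RiemannianBundle (fun x : M => TangentSpace (𝓡 n) x)]
    [IsContMDiffRiemannianBundle (𝓡 n) ∞ (EuclideanSpace ℝ (Fin n))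
      (fun x : M => TangentSpace (𝓡 n) x)]
    (hM : SecondKind.IsEinstein n M)
    (e : OpenPartialHomeomorph M (EuclideanSpace ℝ (Fin n)))
    (he : e ∈ IsManifold.maximalAtlas (𝓡 n) ∞ M) (p : M) (hp : p ∈ e.source)
    (b : OrthonormalBasis (Fin n) ℝ (TangentSpace (𝓡 n) p))
    (hcone : SecondKind.ConeCondition (SecondKind.curvatureAt e p b)) :
    let R := SecondKind.curvatureAt e p b
    let ΔR := SecondKind.laplacianCurvatureAt e p b
    let N := SecondKind.secondKindDim n
    let θ := SecondKind.coneConstant n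
    let μ := SecondKind.secondKindEigenvalue R
    let m := SecondKind.secondKindMean R
    0 ≤ SecondKind.tensorInner ΔR R ∧
      (SecondKind.tensorInner ΔR R = 0 ↔
        (∀ j < N, μ j = m) ∨
          (μ 0 = -((2 * ((N : ℝ) - 1) * θ + N) / ((N : ℝ) - 2)) * m ∧
            ∀ j, 1 ≤ j → j < N → μ j = ((N : ℝ) + 2 * θ) / ((N : ℝ) - 2) * m)) := by
  intro R ΔR N θ μ m
  obtain ⟨ρ, hρ⟩ := hM
  obtain ⟨y, hy, rfl⟩ : ∃ y ∈ e.target, p = e.symm y :=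
    ⟨e p, e.map_source hp, (e.left_inv hp).symm⟩
  have hy' : e (e.symm y) = y := e.right_inv hy
  -- In the coordinates of `e` the curvature and its Laplacian live in the metric algebra of smooth
  -- functions on the target of `e`, and `B` is the frame `b` in these coordinates.
  let U : TopologicalSpace.Opens (EuclideanSpace ℝ (Fin n)) := ⟨e.target, e.open_target⟩
  have hg : ∀ i j, ContDiffOn ℝ ∞ (fun y => SecondKind.chartMetric e y i j) U := fun i j =>
    SecondKind.contDiffOn_chartMetric he i j
  have hsymm : ∀ y ∈ U, ∀ i j, SecondKind.chartMetric e y i j = SecondKind.chartMetric e y j i :=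
    fun y _ i j => SecondKind.chartMetric_symm y i j
  have hdet : ∀ y ∈ U, (SecondKind.chartMetric e y).det ≠ 0 := fun y hy =>
    SecondKind.det_chartMetric_ne_zero he hy
  have hG := SecondKind.smoothMetricAlgebra_isEinstein hg hsymm hdet
    fun y hy i k => hρ e he y hy i k
  have hRm := SecondKind.smoothMetricAlgebra_Rm hg hsymm hdet ⟨y, hy⟩
  have hlap := SecondKind.smoothMetricAlgebra_laplacian hg hsymm hdet ⟨y, hy⟩
  set G := SecondKind.smoothMetricAlgebra hg hsymm hdet with hGdef
  let ev := SecondKind.evalAt (U := U) ⟨y, hy⟩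
  let B : Fin n → Fin n → ℝ := fun i a => SecondKind.coordComponent e (b i) a
  have hB : ∀ i k, ∑ a, ∑ c, B i a * B k c * ev (G.g a c) = SecondKind.delta n i k := by
    intro i k
    have h := SecondKind.inner_sum_coordVector (e := e) y (B i) (B k)
    rw [SecondKind.sum_coordComponent_smul he hy, SecondKind.sum_coordComponent_smul he hy,
      orthonormal_iff_ite.1 b.orthonormal] at h
    exact h.symm
  have hR : R = SecondKind.inFrame B fun J => ev (G.Rm J) := by
    funext A
    simp only [R, SecondKind.curvatureAt, SecondKind.tensorEval, SecondKind.inFrame, hy']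
    exact Finset.sum_congr rfl fun I _ => congrArg _ (hRm I).symm
  have hΔR : ΔR = SecondKind.inFrame B fun I =>
      ev (SecondKind.contractWith G.h (G.cov (G.cov G.Rm)) I) := by
    funext A
    simp only [ΔR, SecondKind.laplacianCurvatureAt, SecondKind.tensorEval, SecondKind.inFrame, hy']
    exact Finset.sum_congr rfl fun I _ => congrArg _ (hlap I).symm
  refine SecondKind.cone_estimate hn (ρ := ρ) (R := R) ?_ ?_ hcone ?_
  · rw [hR]
    exact G.isCurvatureTensor_inFrame ev
  · rw [hR]
    exact SecondKind.MetricAlgebra.sum_inFrame_Rm hG ev hB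
  · rw [hΔR, hR]
    exact SecondKind.MetricAlgebra.tensorInner_laplacian hG ev hB rfl
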